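/- **Setting.** An *action operad* $\Lambda$ is an operad of sets (with unit in $\Lambda(1)$ and multiplication $\mu^\Lambda\colon \Lambda(n)\times\Lambda(k_1)\times\cdots\times\Lambda(k_n)\to\Lambda(k_1+\cdots+k_n)$) in which every $\Lambda(n)$ is a group, together with group homomorphisms $\pi_n\colon\Lambda(n)\to\Sigma_n$ that form a map of operads to the operad of symmetric groups, such that $$\mu^\Lambda(g;f_1,\dots,f_n)\,\mu^\Lambda(g';f_1',\dots,f_n')=\mu^\Lambda(gg';f_{\pi(g')(1)}f_1',\dots,f_{\pi(g')(n)}f_n').$$ The Borel construction is the 2-monad $(E\Lambda,\eta,\mu)$ on the 2-category $\mathbf{Cat}$ of small categories given by $$E\Lambda(X)=\coprod_{n\ge 0}E\Lambda(n)\times_{\Lambda(n)}X^n ,$$ where $E\Lambda(n)$ is the category with object set $\Lambda(n)$ and exactly one morphism between any two objects; the class of $(g;x_1,\dots,x_n)$ is written $[g;x_1,\dots,x_n]$, and $[gh;x_1,\dots,x_n]=[g;x_{\pi(h)^{-1}(1)},\dots,x_{\pi(h)^{-1}(n)}]$. Every object is of the form $[e;x_1,\dots,x_n]$. The unit is $x\mapsto[e;x]$,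 and the multiplication is $$[g;[h_1;x_{11},\dots],\dots,[h_n;x_{n1},\dots]]\mapsto[\mu^\Lambda(g;h_1,\dots,h_n);x_{11},\dots].$$ $\mathbf{Prof}$ is the bicategory of small categories, profunctors $F\colon X\nrightarrow Y$ (functors $Y^{op}\times X\to\mathbf{Sets}$) and natural transformations, with composition $(G\circ F)(z,x)=\int^{y\in Y}G(z,y)\times F(y,x)$. The embedding pseudofunctor $(-)^+\colon\mathbf{Cat}\to\mathbf{Prof}$ is the identity on objects and has $F^+(y,x)=Y(y,Fx)$. **Theorem.** Let $\Lambda$ be an action operad. The 2-monad $E\Lambda$ on $\mathbf{Cat}$ lifts to a pseudomonad $\widetilde{E\Lambda}$ on the bicategory $\mathbf{Prof}$. More precisely: * On objects, $\widetilde{E\Lambda}(X)=E\Lambda(X)$. For a profunctor $F\colon X\nrightarrow Y$, the profunctor $\widetilde{E\Lambda}F\colon E\Lambda X\nrightarrow E\Lambda Y$ is $$\widetilde{E\Lambda}F\big([e;y_1,\dots,y_m],[e;x_1,\dots,x_n]\big)=\begin{cases}\varnothing & m\neq n,\\ \displaystyle\coprod_{g\in\Lambda(n)}\prod_{i=1}^nF(y_i,x_{\pi(g)(i)})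 & m=n,\end{cases}$$ with the evident actions of $E\Lambda(Y)$ and $E\Lambda(X)$, and the same formula defines $\widetilde{E\Lambda}$ on 2-cells. For every functor $G\colon X\to Y$ one has $\widetilde{E\Lambda}(G^+)=(E\Lambda G)^+$. * There are invertible comparison 2-cells making $\widetilde{E\Lambda}$ a pseudofunctor $\mathbf{Prof}\to\mathbf{Prof}$; there are invertible naturality 2-cells making the 1-cells $\eta_X^+\colon X\nrightarrow E\Lambda X$ and $\mu_X^+\colon E\Lambda E\Lambda X\nrightarrow E\Lambda X$ into pseudonatural transformations $1\Rightarrow\widetilde{E\Lambda}$ and $\widetilde{E\Lambda}\,\widetilde{E\Lambda}\Rightarrow\widetilde{E\Lambda}$; and there are invertible modifications (associativity, left unit, right unit) satisfying the two pseudomonad coherence axioms. * All this structure can be chosen compatibly with $(-)^+$: under the equalities $\widetilde{E\Lambda}(G^+)=(E\Lambda G)^+$, the action of $\widetilde{E\Lambda}$ on the 2-cells $\alpha^+$, its comparison 2-cells at identities and at pairs of composable profunctors $F^+,G^+$, the naturality 2-cells of unit and multiplication at profunctors $G^+$, and the associativity and unit modifications are the 2-cells obtained from the 2-functor structure, the strict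 2-naturality and the strict monad laws of $(E\Lambda,\eta,\mu)$ by means of the pseudofunctor structure of $(-)^+$. -/

import Mathlib

open CategoryTheory Bicategory Opposite

universe u

/-- The multiplication of the operad of symmetric groups: the `i`-th block, of size `k i`, is
permuted by `τ i` and then moved as a whole to position `σ i`. -/
def permOperadMul {n m : ℕ} {k : Fin n → ℕ} (hm : ∑ i, k i = m) (σ : Equiv.Perm (Fin n))
    (τ : ∀ i, Equiv.Perm (Fin (k i))) : Equiv.Perm (Fin m) :=
  (((((finCongr hm.symm).trans finSigmaFinEquiv.symm).trans (Equiv.sigmaCongrRight τ)).trans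
    (Equiv.sigmaCongrLeft' σ)).trans finSigmaFinEquiv).trans
      (finCongr ((Equiv.sum_comp σ.symm k).trans hm))

/-- An action operad: an operad `Λ` of sets whose sets `Λ n` are groups, with an operad map `π` to
the symmetric groups consisting of homomorphisms, subject to one further axiom.  The operadic
multiplication `Λ n × Λ (k 1) × ⋯ × Λ (k n) → Λ (k 1 + ⋯ + k n)` is written with values in `Λ m`
for any `m` equal to the sum, so that no transport is needed in the axioms. -/
structure ActionOperad where
  /-- the underlying sets -/
  gp : ℕ → Type u
  /-- the group structures -/
  [group : ∀ n, Group (gp n)]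
  /-- the underlying permutations -/
  π : ∀ n, gp n →* Equiv.Perm (Fin n)
  /-- the operadic unit -/
  unit : gp 1
  /-- the operadic multiplication -/
  mul : ∀ {n m : ℕ} {k : Fin n → ℕ} (_ : ∑ i, k i = m), gp n → (∀ i, gp (k i)) → gp m
  unit_mul : ∀ {n : ℕ} (hm : ∑ _i : Fin 1, n = n) (g : gp n), mul hm unit (fun _ => g) = g
  mul_unit : ∀ {n : ℕ} (hm : ∑ _i : Fin n, 1 = n) (g : gp n), mul hm g (fun _ => unit) = g
  mul_assoc : ∀ {n m : ℕ} {k : Fin n → ℕ} {p : ∀ i, Fin (k i) → ℕ}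
    (h₁ : ∑ i, ∑ j, p i j = m)
    (h₂ : ∑ l, p (finSigmaFinEquiv.symm l).1 (finSigmaFinEquiv.symm l).2 = m)
    (f : gp n) (g : ∀ i, gp (k i)) (h : ∀ i j, gp (p i j)),
    mul h₁ f (fun i => mul rfl (g i) (h i)) =
      mul h₂ (mul rfl f g) (fun l => h (finSigmaFinEquiv.symm l).1 (finSigmaFinEquiv.symm l).2)
  π_mul : ∀ {n m : ℕ} {k : Fin n → ℕ} (hm : ∑ i, k i = m) (g : gp n) (h : ∀ i, gp (k i)),
    π m (mul hm g h) = permOperadMul hm (π n g) (fun i => π (k i) (h i))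
  /-- `μ(g; f₁, …, fₙ) μ(g'; f₁', …, fₙ') = μ(g g'; f_{π(g')(1)} f₁', …, f_{π(g')(n)} fₙ')`,
  where `fⱼ` is written as `f (π(g')⁻¹ j)`. -/
  mul_mul_mul : ∀ {n m : ℕ} {k : Fin n → ℕ} (g g' : gp n)
    (h₁ : ∑ j, k ((π n g')⁻¹ j) = m) (h₂ : ∑ i, k i = m) (f f' : ∀ i, gp (k i)),
    mul h₁ g (fun j => f ((π n g')⁻¹ j)) * mul h₂ g' f' = mul h₂ (g * g') (fun i => f i * f' i)

attribute [instance] ActionOperad.group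

namespace ActionOperad

variable (Λ : ActionOperad.{u})

/-- Transport along an equality of arities. -/
def cast {m n : ℕ} (h : m = n) (g : Λ.gp m) : Λ.gp n := h ▸ g

@[simp] lemma cast_rfl {m : ℕ} (h : m = m) (g : Λ.gp m) : Λ.cast h g = g := rfl

@[simp] lemma cast_cast {m n p : ℕ} (h : m = n) (h' : n = p) (g : Λ.gp m) :
    Λ.cast h' (Λ.cast h g) = Λ.cast (h.trans h') g := by subst h; rfl

@[simp] lemma cast_one {m n : ℕ} (h : m = n) : Λ.cast h 1 = 1 := by subst h; rfl

@[simp] lemma cast_mul {m n : ℕ} (h : m = n) (g g' : Λ.gp m) :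
    Λ.cast h (g * g') = Λ.cast h g * Λ.cast h g' := by subst h; rfl

@[simp] lemma π_cast {m n : ℕ} (h : m = n) (g : Λ.gp m) (i : Fin n) :
    (Λ.π n (Λ.cast h g) i : ℕ) = Λ.π m g (Fin.cast h.symm i) := by subst h; rfl

lemma unit_eq_one : Λ.unit = 1 := by
  have h₁ : ∑ _i : Fin 1, 1 = 1 := by simp
  have a := Λ.unit_mul h₁ 1
  have b := Λ.mul_unit h₁ 1
  have c := Λ.mul_mul_mul (k := fun _ => 1) Λ.unit 1 h₁ h₁ (fun _ => 1) (fun _ => Λ.unit)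
  simp only [one_mul, mul_one] at c
  rw [a, b, Λ.unit_mul h₁] at c
  simpa using c.symm

lemma mul_congr {n n' m m' : ℕ} {k : Fin n → ℕ} {k' : Fin n' → ℕ} (hn : n = n') (hm : m = m')
    (hk : ∀ i, k i = k' (Fin.cast hn i)) (h : ∑ i, k i = m) (h' : ∑ i, k' i = m')
    (g : Λ.gp n) (g' : Λ.gp n') (f : ∀ i, Λ.gp (k i)) (f' : ∀ i, Λ.gp (k' i))
    (hg : Λ.cast hn g = g') (hf : ∀ i, Λ.cast (hk i) (f i) = f' (Fin.cast hn i)) :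
    Λ.cast hm (Λ.mul h g f) = Λ.mul h' g' f' := by
  subst hn hm
  obtain rfl : k = k' := funext hk
  obtain rfl : f = f' := funext hf
  subst hg
  rfl

lemma mul_one_one {n m : ℕ} {k : Fin n → ℕ} (h : ∑ i, k i = m) :
    Λ.mul h 1 (fun i => (1 : Λ.gp (k i))) = 1 := by
  have := Λ.mul_mul_mul (k := k) 1 1 (by simpa using h) h (fun _ => 1) (fun _ => 1)
  have e : Λ.mul (k := fun j => k ((Λ.π n 1)⁻¹ j)) (by simpa using h) 1
      (fun j => (1 : Λ.gp (k ((Λ.π n 1)⁻¹ j)))) = Λ.mul h 1 (fun i => (1 : Λ.gp (k i))) := by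
    refine (Λ.mul_congr rfl rfl ?_ _ _ _ _ _ _ rfl ?_)
    · intro i; simp
    · intro i; simp
  rw [e] at this
  simpa using this

end ActionOperad

/-- For equal lengths `m = n` this is the set `∐_{g ∈ Λ(n)} ∏_i P i (π(g)(i))`, and it is empty for
`m ≠ n`.  To avoid transports, the component at `i` is recorded as a function of `j` with
`j = π(g)(i)`. -/
structure Twist (Λ : ActionOperad.{u}) {m n : ℕ} (P : Fin m → Fin n → Type u) : Type u where
  len : m = n
  g : Λ.gp m
  f : ∀ (i : Fin m) (j : Fin n), (j : ℕ) = Λ.π m g i → P i j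

namespace Twist

variable {Λ : ActionOperad.{u}} {l m n r : ℕ}

lemma isEmpty_of_ne (h : m ≠ n) (P : Fin m → Fin n → Type u) : IsEmpty (Twist Λ P) :=
  ⟨fun t => h t.len⟩

/-- The defining formula `∐_{g ∈ Λ(n)} ∏_i P i (π(g)(i))`. -/
def equivSigma (P : Fin n → Fin n → Type u) :
    Twist Λ P ≃ Σ g : Λ.gp n, ∀ i, P i (Λ.π n g i) where
  toFun t := ⟨t.g, fun i => t.f i _ rfl⟩
  invFun s := ⟨rfl, s.1, fun i j h => (Fin.ext h : j = Λ.π n s.1 i) ▸ s.2 i⟩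
  left_inv t := by
    obtain ⟨len, g, f⟩ := t
    simp only [Twist.mk.injEq, heq_eq_eq, true_and]
    funext i j h
    obtain rfl : j = Λ.π n g i := Fin.ext h
    rfl
  right_inv _ := rfl

/-- The index to which `i` is sent. -/
def tgt {P : Fin m → Fin n → Type u} (t : Twist Λ P) (i : Fin m) : Fin n :=
  Fin.cast t.len (Λ.π m t.g i)

lemma ext' {P : Fin m → Fin n → Type u} {s t : Twist Λ P} (hg : s.g = t.g)
    (hf : ∀ i j h h', s.f i j h = t.f i j h') : s = t := by
  cases s; cases t
  cases hg
  congr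
  funext i j h
  exact hf i j h h

/-- Composition: group elements multiply, components are combined along matching indices. -/
def comp {P : Fin l → Fin m → Type u} {Q : Fin m → Fin n → Type u} {R : Fin l → Fin n → Type u}
    (c : ∀ i j k, P i j → Q j k → R i k) (s : Twist Λ P) (t : Twist Λ Q) : Twist Λ R where
  len := s.len.trans t.len
  g := Λ.cast s.len.symm t.g * s.g
  f i k h := c i (s.tgt i) k (s.f i _ rfl) (t.f _ k (by
    rw [h, map_mul, Equiv.Perm.mul_apply, ActionOperad.π_cast]; rfl))

/-- Applying functions to all components. -/
def map {P Q : Fin m → Fin n → Type u} (c : ∀ i j, P i j → Q i j) (s : Twist Λ P) : Twist Λ Q where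
  len := s.len
  g := s.g
  f i j h := c i j (s.f i j h)

/-- The elements with trivial group element. -/
def diag {P : Fin n → Fin n → Type u} (c : ∀ i, P i i) : Twist Λ P where
  len := rfl
  g := 1
  f i j h := (Fin.ext (by simpa using h.symm) : i = j) ▸ c i

lemma diag_f {P : Fin n → Fin n → Type u} (c : ∀ i, P i i) (i : Fin n) (h) :
    (diag (Λ := Λ) c).f i i h = c i := rfl

lemma f_congr {P : Fin m → Fin n → Type u} (s : Twist Λ P) {i : Fin m} {j : Fin n} (h h') :
    s.f i j h = s.f i j h' := rfl

lemma comp_f {P : Fin l → Fin m → Type u} {Q : Fin m → Fin n → Type u}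
    {R : Fin l → Fin n → Type u} (c : ∀ i j k, P i j → Q j k → R i k) (s : Twist Λ P)
    (t : Twist Λ Q) (i : Fin l) (j : Fin m) (k : Fin n) (hj : (j : ℕ) = Λ.π l s.g i)
    (hk : (k : ℕ) = Λ.π m t.g j) (h) :
    (comp c s t).f i k h = c i j k (s.f i j hj) (t.f j k hk) := by
  obtain rfl : j = s.tgt i := Fin.ext hj
  rfl

lemma val_tgt {P : Fin m → Fin n → Type u} (t : Twist Λ P) (i : Fin m) :
    (t.tgt i : ℕ) = Λ.π m t.g i := rfl

lemma tgt_comp {P : Fin l → Fin m → Type u} {Q : Fin m → Fin n → Type u}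
    {R : Fin l → Fin n → Type u} (c : ∀ i j k, P i j → Q j k → R i k) (s : Twist Λ P)
    (t : Twist Λ Q) (i : Fin l) : (comp c s t).tgt i = t.tgt (s.tgt i) := by
  apply Fin.ext
  simp only [val_tgt, comp, map_mul, Equiv.Perm.mul_apply, ActionOperad.π_cast]
  rfl

lemma comp_assoc {P₁ : Fin l → Fin m → Type u} {P₂ : Fin m → Fin n → Type u}
    {P₃ : Fin n → Fin r → Type u} {Q₁ : Fin l → Fin n → Type u} {Q₂ : Fin m → Fin r → Type u}
    {R : Fin l → Fin r → Type u} (c₁ : ∀ i j k, P₁ i j → P₂ j k → Q₁ i k)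
    (c₁' : ∀ i j k, Q₁ i j → P₃ j k → R i k) (c₂ : ∀ i j k, P₂ i j → P₃ j k → Q₂ i k)
    (c₂' : ∀ i j k, P₁ i j → Q₂ j k → R i k)
    (h : ∀ i j k t (a : P₁ i j) (b : P₂ j k) (d : P₃ k t),
      c₁' _ _ _ (c₁ _ _ _ a b) d = c₂' _ _ _ a (c₂ _ _ _ b d))
    (s : Twist Λ P₁) (t : Twist Λ P₂) (w : Twist Λ P₃) :
    comp c₁' (comp c₁ s t) w = comp c₂' s (comp c₂ t w) := by
  refine ext' ?_ ?_
  · simp [comp, mul_assoc]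
  · intro i k h₁ h₂
    have e₁ : ((t.tgt (s.tgt i) : Fin n) : ℕ) = Λ.π l (comp c₁ s t).g i := by
      rw [← tgt_comp c₁, val_tgt]
    have e₃ : (k : ℕ) = (w.tgt (t.tgt (s.tgt i)) : ℕ) := by
      rw [← tgt_comp c₁, ← tgt_comp c₁', val_tgt, h₁]
    have e₂ : (k : ℕ) = Λ.π n w.g (t.tgt (s.tgt i)) := e₃
    rw [comp_f c₁' (comp c₁ s t) w i (t.tgt (s.tgt i)) k e₁ e₂,
      comp_f c₁ s t i (s.tgt i) _ rfl rfl,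
      comp_f c₂' s (comp c₂ t w) i (s.tgt i) k rfl (by rw [← val_tgt, tgt_comp, e₃]),
      comp_f c₂ t w (s.tgt i) (t.tgt (s.tgt i)) k rfl e₂, h]

lemma diag_comp {P : Fin l → Fin l → Type u} {Q R : Fin l → Fin n → Type u}
    (c : ∀ i j k, P i j → Q j k → R i k) (u : ∀ i, P i i) (t : Twist Λ Q) :
    comp c (diag u) t = map (fun i j q => c i i j (u i) q) t := by
  refine ext' (by simp [comp, diag, map]) ?_
  intro i k h h'
  rw [comp_f c _ _ i i k (by simp [diag]) h']
  rfl

lemma comp_diag {P : Fin l → Fin n → Type u} {Q : Fin n → Fin n → Type u}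
    {R : Fin l → Fin n → Type u} (c : ∀ i j k, P i j → Q j k → R i k) (u : ∀ i, Q i i)
    (s : Twist Λ P) :
    comp c s (diag u) = map (fun i j p => c i j j p (u j)) s := by
  refine ext' (by simp [comp, diag, map]) ?_
  intro i k h h'
  rw [comp_f c _ _ i k k h' (by simp [diag])]
  rfl

lemma map_id {P : Fin m → Fin n → Type u} (s : Twist Λ P) : map (fun _ _ p => p) s = s := rfl

end Twist

lemma finSigma_val_iff {n n' : ℕ} (hn : n = n') {k : Fin n → ℕ} {k' : Fin n' → ℕ}
    (hk : ∀ i, k i = k' (Fin.cast hn i)) (s : (i : Fin n) × Fin (k i))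
    (s' : (i : Fin n') × Fin (k' i)) :
    (finSigmaFinEquiv s : ℕ) = finSigmaFinEquiv s' ↔ (s.1 : ℕ) = s'.1 ∧ (s.2 : ℕ) = s'.2 := by
  subst hn
  obtain rfl : k = k' := funext hk
  constructor
  · intro h
    have := finSigmaFinEquiv.injective (Fin.ext h)
    subst this
    exact ⟨rfl, rfl⟩
  · rintro ⟨h₁, h₂⟩
    obtain ⟨i, j⟩ := s
    obtain ⟨i', j'⟩ := s'
    obtain rfl : i = i' := Fin.ext h₁
    obtain rfl : j = j' := Fin.ext h₂
    rfl

lemma permOperadMul_apply {n m : ℕ} {k : Fin n → ℕ} (hm : ∑ i, k i = m) (σ : Equiv.Perm (Fin n))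
    (τ : ∀ i, Equiv.Perm (Fin (k i))) (i : Fin n) (j : Fin (k i)) (l : Fin m)
    (hl : (l : ℕ) = finSigmaFinEquiv (⟨i, j⟩ : (i : Fin n) × Fin (k i))) :
    (permOperadMul hm σ τ l : ℕ) = finSigmaFinEquiv (n := fun i => k (σ.symm i))
      ⟨σ i, Fin.cast (congrArg k (σ.symm_apply_apply i).symm) (τ i j)⟩ := by
  subst hm
  obtain rfl : l = finSigmaFinEquiv (⟨i, j⟩ : (i : Fin n) × Fin (k i)) := Fin.ext hl
  simp only [permOperadMul, Equiv.trans_apply, finCongr_apply, Fin.val_cast, Fin.cast_refl, id_eq,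
    Equiv.symm_apply_apply]
  refine (finSigma_val_iff rfl (fun _ => rfl) _ _).2 ⟨rfl, ?_⟩
  have key : ∀ (a b : Fin n) (e : a = b) (x : Fin (k a)),
      ((e ▸ x : Fin (k b)) : ℕ) = x := by
    intro a b e x; subst e; rfl
  exact key _ _ _ _

lemma sum_castLE {n a : ℕ} (h : a ≤ n) (f : Fin n → ℕ) :
    ∑ x : Fin a, f (Fin.castLE h x) = ∑ x : Fin n, if (x : ℕ) < a then f x else 0 := by
  rw [← Finset.sum_filter]
  refine Finset.sum_bij (fun x _ => Fin.castLE h x) ?_ ?_ ?_ ?_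
  · intro x _; simp
  · intro x _ y _ hxy; simpa [Fin.ext_iff] using hxy
  · intro y hy
    exact ⟨⟨y, by simpa using hy⟩, Finset.mem_univ _, rfl⟩
  · intros; rfl

lemma finSigma_val {n : ℕ} {k : Fin n → ℕ} (s : (i : Fin n) × Fin (k i)) :
    (finSigmaFinEquiv s : ℕ) = (∑ x : Fin n, if (x : ℕ) < s.1 then k x else 0) + s.2 := by
  rw [finSigmaFinEquiv_apply, sum_castLE]

lemma finSigma_lt_of_lt {n : ℕ} {k : Fin n → ℕ} (s t : (i : Fin n) × Fin (k i))
    (h : s.1 < t.1) : (finSigmaFinEquiv s : ℕ) < finSigmaFinEquiv t := by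
  rw [finSigma_val, finSigma_val]
  have h₁ : (∑ x : Fin n, if (x : ℕ) < s.1 then k x else 0) + k s.1 ≤
      ∑ x : Fin n, if (x : ℕ) < t.1 then k x else 0 := by
    have : k s.1 = ∑ x : Fin n, if x = s.1 then k x else 0 := by simp
    rw [this, ← Finset.sum_add_distrib]
    refine Finset.sum_le_sum fun x _ => ?_
    have h' : (s.1 : ℕ) < t.1 := h
    rcases lt_trichotomy (x : ℕ) s.1 with h₂ | h₂ | h₂
    · simp [h₂, h₂.trans h', Fin.ext_iff, h₂.ne]
    · simp [Fin.ext_iff, h₂, h']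
    · simp [Fin.ext_iff, h₂.ne', not_lt.2 h₂.le]
  have := s.2.2
  omega

lemma finSigma_lt_iff {n : ℕ} {k : Fin n → ℕ} (s t : (i : Fin n) × Fin (k i)) :
    (finSigmaFinEquiv s : ℕ) < finSigmaFinEquiv t ↔
      s.1 < t.1 ∨ (s.1 = t.1 ∧ (s.2 : ℕ) < t.2) := by
  rcases lt_trichotomy s.1 t.1 with h | h | h
  · exact iff_of_true (finSigma_lt_of_lt s t h) (Or.inl h)
  · rw [finSigma_val, finSigma_val]
    simp [h]
  · simp only [(finSigma_lt_of_lt t s h).not_gt, false_iff, not_or, not_and]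
    exact ⟨h.not_gt, fun h' => absurd h' h.ne'⟩

lemma finSigma_assoc {n : ℕ} {k : Fin n → ℕ} {p : ∀ i, Fin (k i) → ℕ} (i : Fin n) (j : Fin (k i))
    (t : Fin (p i j)) (t' : Fin (p (finSigmaFinEquiv.symm (finSigmaFinEquiv
      (⟨i, j⟩ : (i : Fin n) × Fin (k i)))).1 (finSigmaFinEquiv.symm (finSigmaFinEquiv
      (⟨i, j⟩ : (i : Fin n) × Fin (k i)))).2)) (ht : (t : ℕ) = t') :
    (finSigmaFinEquiv (n := fun i => ∑ j, p i j) ⟨i, finSigmaFinEquiv ⟨j, t⟩⟩ : ℕ) =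
      finSigmaFinEquiv (n := fun l : Fin (∑ i, k i) =>
        p (finSigmaFinEquiv.symm l).1 (finSigmaFinEquiv.symm l).2)
        ⟨finSigmaFinEquiv ⟨i, j⟩, t'⟩ := by
  rw [finSigma_val, finSigma_val, finSigma_val]
  simp only
  rw [← (finSigmaFinEquiv (n := k)).sum_comp, Fintype.sum_sigma, ← add_assoc, ht]
  congr 1
  have h₀ : ∀ s : (i : Fin n) × Fin (k i), p (finSigmaFinEquiv.symm (finSigmaFinEquiv s)).1
      (finSigmaFinEquiv.symm (finSigmaFinEquiv s)).2 = p s.1 s.2 := by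
    intro s; rw [Equiv.symm_apply_apply]
  simp only [h₀, finSigma_lt_iff]
  have : ∀ x : Fin n, (∑ y : Fin (k x), if x < i ∨ x = i ∧ (y : ℕ) < j then p x y else 0) =
      (if (x : ℕ) < i then ∑ y, p x y else 0) +
        if x = i then (∑ y : Fin (k x), if (y : ℕ) < j then p x y else 0) else 0 := by
    intro x
    rcases lt_trichotomy x i with h | h | h
    · simp [h, h.ne]
    · subst h; simp
    · simp [h.not_gt, h.ne']
  simp only [this, Finset.sum_add_distrib]
  simp

lemma sum_finSigma {n : ℕ} {k : Fin n → ℕ} (p : ∀ i, Fin (k i) → ℕ) :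
    ∑ i, ∑ j, p i j =
      ∑ l : Fin (∑ i, k i), p (finSigmaFinEquiv.symm l).1 (finSigmaFinEquiv.symm l).2 := by
  rw [← Fintype.sum_sigma' p]
  exact (Equiv.sum_comp finSigmaFinEquiv.symm fun s : (i : Fin n) × Fin (k i) => p s.1 s.2).symm

lemma finSigma_assoc_symm {n : ℕ} {k : Fin n → ℕ} {p : ∀ i, Fin (k i) → ℕ}
    (L : Fin (∑ i, ∑ j, p i j))
    (L' : Fin (∑ l : Fin (∑ i, k i), p (finSigmaFinEquiv.symm l).1 (finSigmaFinEquiv.symm l).2))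
    (h : (L : ℕ) = L') :
    (⟨(finSigmaFinEquiv.symm L).1, (finSigmaFinEquiv.symm (finSigmaFinEquiv.symm L).2).1⟩ :
      (i : Fin n) × Fin (k i)) = finSigmaFinEquiv.symm (finSigmaFinEquiv.symm L').1 ∧
    ((finSigmaFinEquiv.symm (finSigmaFinEquiv.symm L).2).2 : ℕ) =
      (finSigmaFinEquiv.symm L').2 := by
  obtain ⟨⟨i, m⟩, rfl⟩ := finSigmaFinEquiv.surjective L
  obtain ⟨⟨j, t⟩, rfl⟩ := finSigmaFinEquiv.surjective m
  have e : p (finSigmaFinEquiv.symm (finSigmaFinEquiv (⟨i, j⟩ : (i : Fin n) × Fin (k i)))).1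
      (finSigmaFinEquiv.symm (finSigmaFinEquiv (⟨i, j⟩ : (i : Fin n) × Fin (k i)))).2 = p i j := by
    rw [Equiv.symm_apply_apply]
  have h' := finSigma_assoc i j t (Fin.cast e.symm t) rfl
  rw [h] at h'
  obtain rfl := Fin.ext h'
  have k₁ : ∀ S : (i : Fin n) × Fin (∑ j, p i j), S = ⟨i, finSigmaFinEquiv ⟨j, t⟩⟩ →
      (⟨S.1, (finSigmaFinEquiv.symm S.2).1⟩ : (i : Fin n) × Fin (k i)) = ⟨i, j⟩ ∧
        ((finSigmaFinEquiv.symm S.2).2 : ℕ) = t := by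
    rintro S rfl
    refine ⟨by simp, ?_⟩
    exact congrArg (fun x : (j : Fin (k i)) × Fin (p i j) => (x.2 : ℕ))
      (finSigmaFinEquiv.symm_apply_apply ⟨j, t⟩)
  have k₂ : ∀ S : (l : Fin (∑ i, k i)) ×
      Fin (p (finSigmaFinEquiv.symm l).1 (finSigmaFinEquiv.symm l).2),
      S = ⟨finSigmaFinEquiv ⟨i, j⟩, Fin.cast e.symm t⟩ →
      finSigmaFinEquiv.symm S.1 = ⟨i, j⟩ ∧ (S.2 : ℕ) = t := by
    rintro S rfl
    simp
  obtain ⟨a₁, a₂⟩ := k₁ _ (Equiv.symm_apply_apply _ _)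
  obtain ⟨b₁, b₂⟩ := k₂ _ (Equiv.symm_apply_apply _ _)
  exact ⟨a₁.trans b₁.symm, a₂.trans b₂.symm⟩

namespace Twist

variable {Λ : ActionOperad.{u}}

section flatten

variable {n n' : ℕ} {k : Fin n → ℕ} {k' : Fin n' → ℕ}
  {P : ∀ (i : Fin n) (i' : Fin n'), Fin (k i) → Fin (k' i') → Type u}

lemma len_tgt (s : Twist Λ fun i i' => Twist Λ (P i i')) (i : Fin n) : k i = k' (s.tgt i) :=
  (s.f i _ rfl).len

lemma sum_len (s : Twist Λ fun i i' => Twist Λ (P i i')) : ∑ i, k i = ∑ i, k' i := by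
  have h := s.len_tgt
  obtain ⟨len, g, f⟩ := s
  subst len
  rw [← Equiv.sum_comp (Λ.π n g) k']
  exact Finset.sum_congr rfl fun i _ => h i

/-- The group element of the flattening, computed with the operadic multiplication. -/
def flattenG (s : Twist Λ fun i i' => Twist Λ (P i i')) : Λ.gp (∑ i, k i) :=
  Λ.mul rfl s.g (fun i => (s.f i (s.tgt i) rfl).g)

lemma flattenG_apply (s : Twist Λ fun i i' => Twist Λ (P i i')) (i : Fin n) (j : Fin (k i))
    (l : Fin (∑ i, k i)) (hl : (l : ℕ) = finSigmaFinEquiv (⟨i, j⟩ : (i : Fin n) × Fin (k i))) :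
    (Λ.π _ s.flattenG l : ℕ) = finSigmaFinEquiv (⟨s.tgt i, (s.f i (s.tgt i) rfl).tgt j⟩ :
      (i : Fin n') × Fin (k' i)) := by
  rw [flattenG, Λ.π_mul, permOperadMul_apply _ _ _ i j l hl]
  refine (finSigma_val_iff s.len (fun x => ?_) _ _).2 ⟨rfl, rfl⟩
  rw [s.len_tgt]
  congr 1
  apply Fin.ext
  simp [val_tgt]

lemma flattenG_iff (s : Twist Λ fun i i' => Twist Λ (P i i')) (i : Fin n) (j : Fin (k i))
    (i' : Fin n') (j' : Fin (k' i'))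
    (l : Fin (∑ i, k i)) (hl : (l : ℕ) = finSigmaFinEquiv (⟨i, j⟩ : (i : Fin n) × Fin (k i))) :
    ((finSigmaFinEquiv (⟨i', j'⟩ : (i : Fin n') × Fin (k' i)) : ℕ) = Λ.π _ s.flattenG l) ↔
      ∃ h : (i' : ℕ) = Λ.π _ s.g i, (j' : ℕ) = Λ.π _ (s.f i i' h).g j := by
  rw [s.flattenG_apply i j l hl, finSigma_val_iff rfl (fun _ => rfl)]
  constructor
  · rintro ⟨h₁, h₂⟩
    obtain rfl : i' = s.tgt i := Fin.ext h₁
    exact ⟨rfl, h₂⟩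
  · rintro ⟨h₁, h₂⟩
    obtain rfl : i' = s.tgt i := Fin.ext h₁
    exact ⟨rfl, h₂⟩

lemma flatten_spec (s : Twist Λ fun i i' => Twist Λ (P i i')) {l : Fin (∑ i, k i)}
    {l' : Fin (∑ i, k' i)} (h : (l' : ℕ) = Λ.π _ s.flattenG l) :
    ∃ h : ((finSigmaFinEquiv.symm l').1 : ℕ) = Λ.π _ s.g (finSigmaFinEquiv.symm l).1,
      ((finSigmaFinEquiv.symm l').2 : ℕ) =
        Λ.π _ (s.f (finSigmaFinEquiv.symm l).1 (finSigmaFinEquiv.symm l').1 h).g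
          (finSigmaFinEquiv.symm l).2 := by
  refine (s.flattenG_iff _ _ _ _ l ?_).1 ?_
  · exact congrArg Fin.val (finSigmaFinEquiv.apply_symm_apply l).symm
  · rw [← h]
    exact congrArg Fin.val (finSigmaFinEquiv.apply_symm_apply l')

/-- Flattening of nested families: group elements are combined by the operadic multiplication,
components are relabelled along `Σ i, Fin (k i) ≃ Fin (∑ i, k i)`. -/
def flatten (s : Twist Λ fun i i' => Twist Λ (P i i')) :
    Twist Λ fun (l : Fin (∑ i, k i)) (l' : Fin (∑ i, k' i)) =>
      P (finSigmaFinEquiv.symm l).1 (finSigmaFinEquiv.symm l').1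
        (finSigmaFinEquiv.symm l).2 (finSigmaFinEquiv.symm l').2 where
  len := s.sum_len
  g := s.flattenG
  f _ _ h := (s.f _ _ (s.flatten_spec h).1).f _ _ (s.flatten_spec h).2

end flatten

lemma flatten_map {n n' : ℕ} {k : Fin n → ℕ} {k' : Fin n' → ℕ}
    {P Q : ∀ (i : Fin n) (i' : Fin n'), Fin (k i) → Fin (k' i') → Type u}
    (c : ∀ i i' j j', P i i' j j' → Q i i' j j')
    (s : Twist Λ fun i i' => Twist Λ (P i i')) :
    flatten (map (fun i i' => map (c i i')) s) = map (fun _ _ => c _ _ _ _) (flatten s) := rfl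

lemma flatten_diag {n : ℕ} {k : Fin n → ℕ} {P : ∀ (i i' : Fin n), Fin (k i) → Fin (k i') → Type u}
    (c : ∀ i j, P i i j j) :
    flatten (diag fun i => diag (c i) : Twist Λ fun i i' => Twist Λ (P i i')) =
      diag fun l => c (finSigmaFinEquiv.symm l).1 (finSigmaFinEquiv.symm l).2 := by
  have key : ∀ (i i' : Fin n) (h),
      ((diag fun i => diag (c i) : Twist Λ fun i i' => Twist Λ (P i i')).f i i' h).g = 1 := by
    intro i i' h
    obtain rfl : i' = i := Fin.ext (by simpa [diag] using h)
    rfl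
  refine ext' ?_ ?_
  · refine Eq.trans ?_ (Λ.mul_one_one (k := k) rfl)
    change Λ.mul rfl 1 _ = _
    congr 1
    funext i
    exact key _ _ _
  · intro l l' h h'
    obtain rfl : l' = l := Fin.ext (by simpa [diag] using h')
    rfl

lemma flatten_comp {l m n : ℕ} {k₁ : Fin l → ℕ} {k₂ : Fin m → ℕ} {k₃ : Fin n → ℕ}
    {P : ∀ i j, Fin (k₁ i) → Fin (k₂ j) → Type u} {Q : ∀ i j, Fin (k₂ i) → Fin (k₃ j) → Type u}
    {R : ∀ i j, Fin (k₁ i) → Fin (k₃ j) → Type u}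
    (c : ∀ i j r i' j' r', P i j i' j' → Q j r j' r' → R i r i' r')
    (s : Twist Λ fun i j => Twist Λ (P i j)) (t : Twist Λ fun i j => Twist Λ (Q i j)) :
    flatten (comp (fun i j r (x : Twist Λ (P i j)) (y : Twist Λ (Q j r)) => (comp (c i j r) x y : Twist Λ (R i r))) s t) =
      comp (fun a b d => c (finSigmaFinEquiv.symm a).1 (finSigmaFinEquiv.symm b).1
        (finSigmaFinEquiv.symm d).1 (finSigmaFinEquiv.symm a).2 (finSigmaFinEquiv.symm b).2
        (finSigmaFinEquiv.symm d).2) (flatten s) (flatten t) := by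
  refine ext' ?_ ?_
  · have h₀ : ∀ i, k₁ i = k₂ (s.tgt i) := s.len_tgt
    have e₁ : ∑ j, k₁ ((Λ.π l s.g)⁻¹ j) = ∑ i, k₁ i := Equiv.sum_comp (Λ.π l s.g)⁻¹ k₁
    have := Λ.mul_mul_mul (k := k₁) (Λ.cast s.len.symm t.g) s.g e₁ rfl
      (fun i => Λ.cast (h₀ i).symm (t.f (s.tgt i) (t.tgt (s.tgt i)) rfl).g) (fun i => (s.f i (s.tgt i) rfl).g)
    have e₂ : Λ.mul e₁ (Λ.cast s.len.symm t.g)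
        (fun j => Λ.cast (h₀ _).symm (t.f (s.tgt ((Λ.π l s.g)⁻¹ j)) (t.tgt (s.tgt ((Λ.π l s.g)⁻¹ j))) rfl).g) =
        Λ.cast s.sum_len.symm t.flattenG := by
      symm
      refine Λ.mul_congr s.len.symm _ ?_ _ _ _ _ _ _ rfl ?_
      · intro i
        rw [h₀]
        congr 1
        apply Fin.ext
        simp [val_tgt]
      · intro i
        have : ∀ (i' : Fin m) (p : ℕ) (_ : i = i') (hh : k₂ i = p) (hh' : k₂ i' = p),
            Λ.cast hh (t.f i (t.tgt i) rfl).g = Λ.cast hh' (t.f i' (t.tgt i') rfl).g := by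
          rintro i' p rfl _ _; rfl
        exact this _ _ (by apply Fin.ext; simp [val_tgt]) _ _
    rw [e₂] at this
    change _ = Λ.cast s.sum_len.symm t.flattenG * Λ.mul rfl s.g _
    rw [this]
    change Λ.mul rfl (Λ.cast s.len.symm t.g * s.g) _ = _
    congr 1
    funext i
    have : ∀ (r : Fin n) (h : r = t.tgt (s.tgt i)) (h'),
        ((comp (fun i j r (x : Twist Λ (P i j)) (y : Twist Λ (Q j r)) => (comp (c i j r) x y : Twist Λ (R i r))) s t).f i r h').g =
          Λ.cast (h₀ i).symm (t.f (s.tgt i) (t.tgt (s.tgt i)) rfl).g *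
            (s.f i (s.tgt i) rfl).g := by
      rintro r rfl h'
      rfl
    exact this _ (tgt_comp _ _ _ _) rfl
  · intro a b h h'
    have h₁ := (flatten s).val_tgt a
    have h₂ := (flatten t).val_tgt ((flatten s).tgt a)
    have h₃ : (b : ℕ) = Λ.π _ (flatten t).g ((flatten s).tgt a) := by
      rw [h', ← val_tgt, tgt_comp, val_tgt]
    rw [comp_f _ (flatten s) (flatten t) a ((flatten s).tgt a) b h₁ h₃]
    have h₄ := (comp (fun i j r (x : Twist Λ (P i j)) (y : Twist Λ (Q j r)) => (comp (c i j r) x y : Twist Λ (R i r))) s t).flatten_spec h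
    change ((comp (fun i j r (x : Twist Λ (P i j)) (y : Twist Λ (Q j r)) => (comp (c i j r) x y : Twist Λ (R i r))) s t).f _ _ h₄.1).f _ _ h₄.2 = _
    have key : ∀ (i : Fin l) (j : Fin m) (r : Fin n) (i' j' r') (hc hc' hs hs' ht ht'),
        ((comp (fun i j r (x : Twist Λ (P i j)) (y : Twist Λ (Q j r)) => (comp (c i j r) x y : Twist Λ (R i r))) s t).f i r hc).f i' r' hc' =
          c i j r i' j' r' ((s.f i j hs).f i' j' hs') ((t.f j r ht).f j' r' ht') := by
      intro i j r i' j' r' hc hc' hs hs' ht ht'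
      have := comp_f (fun i j r (x : Twist Λ (P i j)) (y : Twist Λ (Q j r)) => (comp (c i j r) x y : Twist Λ (R i r))) s t i j r hs ht hc
      have h₅ : ∀ (x : Twist Λ (R i r)) (hx : x = comp (c i j r) (s.f i j hs) (t.f j r ht)) (hh),
          x.f i' r' hh = c i j r i' j' r' ((s.f i j hs).f i' j' hs') ((t.f j r ht).f j' r' ht') := by
        rintro x rfl hh
        exact comp_f _ _ _ _ _ _ _ _ _
      exact h₅ _ this _
    exact key _ _ _ _ _ _ _ _ _ _ _ _

end Twist

/-- The objects of `EΛ(X) = ∐ₙ EΛ(n) ×_{Λ(n)} Xⁿ`: every class has exactly one representative with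
trivial group component, and `⟨n, x⟩` stands for the class `[e; x₁, …, xₙ]`. -/
@[ext]
structure BorelCat (Λ : ActionOperad.{u}) (X : Type u) : Type u where
  len : ℕ
  letter : Fin len → X

namespace BorelCat

variable {Λ : ActionOperad.{u}}

lemma obj_ext {X : Type u} {a b : BorelCat Λ X} (h : a.len = b.len)
    (h' : ∀ (i : Fin a.len) (j : Fin b.len), (i : ℕ) = j → a.letter i = b.letter j) : a = b := by
  obtain ⟨m, x⟩ := a
  obtain ⟨n, y⟩ := b
  obtain rfl : m = n := h
  obtain rfl : x = y := funext fun i => h' i i rfl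
  rfl

/-- For a family of sets `P x y`, the set `∐_{g ∈ Λ(n)} ∏_i P (x_i) (y_{π(g)(i)})` attached to
`a = [e; x₁, …, xₙ]` and `b = [e; y₁, …, yₙ]`; it is empty if `a` and `b` have different lengths. -/
abbrev Arr {X Y : Type u} (P : X → Y → Type u) (a : BorelCat Λ X) (b : BorelCat Λ Y) : Type u :=
  Twist Λ fun i j => P (a.letter i) (b.letter j)

section

variable {X Y Z W : Type u}

/-- Composition of elements of `Arr`. -/
abbrev Arr.comp {P : X → Y → Type u} {Q : Y → Z → Type u} {R : X → Z → Type u}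
    (c : ∀ x y z, P x y → Q y z → R x z) {a : BorelCat Λ X} {b : BorelCat Λ Y} {d : BorelCat Λ Z}
    (s : Arr P a b) (t : Arr Q b d) : Arr R a d :=
  Twist.comp (fun i j k p q => c (a.letter i) (b.letter j) (d.letter k) p q) s t

/-- Applying functions to all components. -/
abbrev Arr.map {P : X → Y → Type u} {Q : Z → W → Type u} {f : X → Z} {g : Y → W}
    (c : ∀ x y, P x y → Q (f x) (g y)) {a : BorelCat Λ X} {b : BorelCat Λ Y} (s : Arr P a b) :
    Arr Q (⟨a.len, fun i => f (a.letter i)⟩ : BorelCat Λ Z)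
      (⟨b.len, fun i => g (b.letter i)⟩ : BorelCat Λ W) :=
  Twist.map (fun i j p => c (a.letter i) (b.letter j) p) s

end

section

variable {X Y Z : Type u} [SmallCategory X] [SmallCategory Y] [SmallCategory Z]

/-- A morphism `[e; x₁, …, xₙ] ⟶ [e; y₁, …, yₙ]` is an element of
`∐_{g ∈ Λ(n)} ∏_i X(x_i, y_{π(g)(i)})`. -/
instance category : SmallCategory (BorelCat Λ X) where
  Hom a b := Arr (fun x y : X => x ⟶ y) a b
  id a := Twist.diag (P := fun i j => a.letter i ⟶ a.letter j) fun i => 𝟙 (a.letter i)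
  comp p q := Arr.comp (fun (x y z : X) (f : x ⟶ y) (g : y ⟶ z) => f ≫ g) p q
  id_comp {a b} p := by
    refine (Twist.diag_comp (P := fun i j => a.letter i ⟶ a.letter j)
      (Q := fun i j => a.letter i ⟶ b.letter j) (R := fun i j => a.letter i ⟶ b.letter j)
      (fun _ _ _ f g => f ≫ g) _ p).trans ?_
    simp only [Category.id_comp]
    rfl
  comp_id {a b} p := by
    refine (Twist.comp_diag (P := fun i j => a.letter i ⟶ b.letter j)
      (Q := fun i j => b.letter i ⟶ b.letter j) (R := fun i j => a.letter i ⟶ b.letter j)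
      (fun _ _ _ f g => f ≫ g) _ p).trans ?_
    simp only [Category.comp_id]
    rfl
  assoc {a b c d} p q r := Twist.comp_assoc
    (P₁ := fun i j => a.letter i ⟶ b.letter j) (P₂ := fun i j => b.letter i ⟶ c.letter j)
    (P₃ := fun i j => c.letter i ⟶ d.letter j) (Q₁ := fun i j => a.letter i ⟶ c.letter j)
    (Q₂ := fun i j => b.letter i ⟶ d.letter j) (R := fun i j => a.letter i ⟶ d.letter j)
    (fun _ _ _ f g => f ≫ g) (fun _ _ _ f g => f ≫ g) (fun _ _ _ f g => f ≫ g)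
    (fun _ _ _ f g => f ≫ g) (fun _ _ _ _ _ _ _ => Category.assoc _ _ _) p q r

/-- A morphism, viewed as an element of `∐_{g ∈ Λ(n)} ∏_i X(x_i, y_{π(g)(i)})`. -/
abbrev toArr {a b : BorelCat Λ X} (p : a ⟶ b) : Arr (fun x y : X => x ⟶ y) a b := p

/-- The morphisms with trivial group element. -/
def diagHom {n : ℕ} {x y : Fin n → X} (f : ∀ i, x i ⟶ y i) :
    (⟨n, x⟩ : BorelCat Λ X) ⟶ ⟨n, y⟩ :=
  Twist.diag (P := fun i j => x i ⟶ y j) f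

lemma diagHom_comp {n : ℕ} {x y : Fin n → X} (f : ∀ i, x i ⟶ y i) {a : BorelCat Λ X}
    (p : (⟨n, y⟩ : BorelCat Λ X) ⟶ a) :
    diagHom f ≫ p = Twist.map (P := fun i j => y i ⟶ a.letter j)
      (Q := fun i j => x i ⟶ a.letter j) (fun i _ q => f i ≫ q) (toArr p) :=
  Twist.diag_comp (P := fun i j => x i ⟶ y j) (Q := fun i j => y i ⟶ a.letter j)
    (R := fun i j => x i ⟶ a.letter j) (fun _ _ _ f g => f ≫ g) f p

lemma comp_diagHom {n : ℕ} {x y : Fin n → X} (f : ∀ i, x i ⟶ y i) {a : BorelCat Λ X}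
    (p : a ⟶ (⟨n, x⟩ : BorelCat Λ X)) :
    p ≫ diagHom f = Twist.map (P := fun i j => a.letter i ⟶ x j)
      (Q := fun i j => a.letter i ⟶ y j) (fun _ j q => q ≫ f j) (toArr p) :=
  Twist.comp_diag (P := fun i j => a.letter i ⟶ x j) (Q := fun i j => x i ⟶ y j)
    (R := fun i j => a.letter i ⟶ y j) (fun _ _ _ f g => f ≫ g) f p

lemma diagHom_diagHom {n : ℕ} {x y z : Fin n → X} (f : ∀ i, x i ⟶ y i) (g : ∀ i, y i ⟶ z i) :
    (diagHom f : (⟨n, x⟩ : BorelCat Λ X) ⟶ ⟨n, y⟩) ≫ diagHom g = diagHom fun i => f i ≫ g i := by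
  rw [diagHom_comp]
  refine Twist.ext' rfl ?_
  intro i j h h'
  have h'' : (j : ℕ) = Λ.π n 1 i := h'
  obtain rfl : j = i := Fin.ext (by simpa using h'')
  rfl

lemma hom_ext {a b : BorelCat Λ X} {p q : a ⟶ b} (hg : (toArr p).g = (toArr q).g)
    (hf : ∀ i j h h', (toArr p).f i j h = (toArr q).f i j h') : p = q :=
  Twist.ext' hg hf

/-- The action of `EΛ` on functors. -/
def map (F : X ⥤ Y) : BorelCat Λ X ⥤ BorelCat Λ Y where
  obj a := ⟨a.len, fun i => F.obj (a.letter i)⟩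
  map p := Arr.map (P := fun x x' : X => x ⟶ x') (Q := fun y y' : Y => y ⟶ y')
    (fun _ _ f => F.map f) (toArr p)
  map_id a := by
    refine Twist.ext' rfl ?_
    intro i j h h'
    have h'' : (j : ℕ) = Λ.π a.len 1 i := h'
    obtain rfl : j = i := Fin.ext (by simpa using h'')
    exact F.map_id _
  map_comp p q := by
    refine Twist.ext' rfl ?_
    intro i j h h'
    exact F.map_comp _ _

/-- The action of `EΛ` on natural transformations. -/
def map₂ {F G : X ⥤ Y} (α : F ⟶ G) : (map F : BorelCat Λ X ⥤ BorelCat Λ Y) ⟶ map G where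
  app a := diagHom fun i => α.app (a.letter i)
  naturality a b p := by
    refine (comp_diagHom _ _).trans (Eq.trans ?_ (diagHom_comp _ _).symm)
    refine Twist.ext' rfl ?_
    intro i j h h'
    exact α.naturality _

/-- The unit `X ⟶ EΛ(X)`, `x ↦ [e; x]`. -/
def unit (Λ : ActionOperad.{u}) (X : Type u) [SmallCategory X] : X ⥤ BorelCat Λ X where
  obj x := ⟨1, fun _ => x⟩
  map f := diagHom fun _ => f
  map_id x := rfl
  map_comp f g := by
    refine Eq.trans ?_ (diagHom_comp _ _).symm
    refine Twist.ext' rfl ?_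
    intro i j h h'
    obtain rfl : i = j := Subsingleton.elim _ _
    rfl

/-- The multiplication `EΛ(EΛ(X)) ⟶ EΛ(X)`: words of words are concatenated, and group elements
are combined by the operadic multiplication. -/
def mult (Λ : ActionOperad.{u}) (X : Type u) [SmallCategory X] :
    BorelCat Λ (BorelCat Λ X) ⥤ BorelCat Λ X where
  obj w := ⟨∑ i, (w.letter i).len,
    fun l => (w.letter (finSigmaFinEquiv.symm l).1).letter (finSigmaFinEquiv.symm l).2⟩
  map {v w} p := Twist.flatten
    (P := fun i i' j j' => (v.letter i).letter j ⟶ (w.letter i').letter j') (toArr p)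
  map_id w := Twist.flatten_diag
    (P := fun i i' j j' => (w.letter i).letter j ⟶ (w.letter i').letter j')
    fun i j => 𝟙 ((w.letter i).letter j)
  map_comp {v w z} p q := Twist.flatten_comp
    (P := fun i i' j j' => (v.letter i).letter j ⟶ (w.letter i').letter j')
    (Q := fun i i' j j' => (w.letter i).letter j ⟶ (z.letter i').letter j')
    (R := fun i i' j j' => (v.letter i).letter j ⟶ (z.letter i').letter j')
    (fun _ _ _ _ _ _ a b => a ≫ b) (toArr p) (toArr q)

lemma diagHom_map (F : X ⥤ Y) {n : ℕ} {x y : Fin n → X} (f : ∀ i, x i ⟶ y i) :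
    diagHom (fun i => F.map (f i)) = (map F).map (diagHom f : (⟨n, x⟩ : BorelCat Λ X) ⟶ ⟨n, y⟩) := by
  refine Twist.ext' rfl ?_
  intro i j h h'
  have h'' : (j : ℕ) = Λ.π n 1 i := h'
  obtain rfl : j = i := Fin.ext (by simpa using h'')
  rfl

lemma flatten_diagHom {n : ℕ} {k : Fin n → ℕ} {x y : ∀ i, Fin (k i) → X}
    (f : ∀ i j, x i j ⟶ y i j) :
    (mult Λ X).map (diagHom fun i => diagHom (f i) :
      (⟨n, fun i => ⟨k i, x i⟩⟩ : BorelCat Λ (BorelCat Λ X)) ⟶ ⟨n, fun i => ⟨k i, y i⟩⟩) =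
    diagHom fun l => f (finSigmaFinEquiv.symm l).1 (finSigmaFinEquiv.symm l).2 :=
  Twist.flatten_diag (P := fun i i' j j' => x i j ⟶ y i' j') f

lemma hom_heq {a a' b b' : BorelCat Λ X} (ha : a = a') (hb : b = b') (p : a ⟶ b) (p' : a' ⟶ b')
    (hl : a.len = a'.len) (hg : Λ.cast hl ((toArr p).g) = (toArr p').g)
    (hf : ∀ (i : Fin a.len) (i' : Fin a'.len) (j : Fin b.len) (j' : Fin b'.len) (h h')
      (_ : (i : ℕ) = i') (_ : (j : ℕ) = j'), HEq ((toArr p).f i j h) ((toArr p').f i' j' h')) :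
    HEq p p' := by
  subst ha hb
  refine heq_of_eq (hom_ext hg ?_)
  intro i j h h'
  exact eq_of_heq (hf i i j j h h' rfl rfl)

lemma map_id_eq : (map (𝟭 X) : BorelCat Λ X ⥤ BorelCat Λ X) = 𝟭 _ := rfl

lemma map_comp_eq (F : X ⥤ Y) (G : Y ⥤ Z) :
    (map (F ⋙ G) : BorelCat Λ X ⥤ BorelCat Λ Z) = map F ⋙ map G := rfl

lemma unit_naturality (F : X ⥤ Y) : F ⋙ unit Λ Y = unit Λ X ⋙ map F := by
  refine Functor.hext (fun _ => rfl) fun x y f => heq_of_eq (hom_ext rfl ?_)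
  intro i j h h'
  obtain rfl : i = j := Subsingleton.elim (α := Fin 1) _ _
  rfl

lemma mult_naturality (F : X ⥤ Y) :
    map (map F) ⋙ mult Λ Y = mult Λ X ⋙ map F := rfl

lemma unit_mult : unit Λ (BorelCat Λ X) ⋙ mult Λ X = 𝟭 (BorelCat Λ X) := by
  have hl : ∀ a : BorelCat Λ X, ∑ _i : Fin 1, a.len = a.len := fun a => by simp
  have hi : ∀ (a : BorelCat Λ X) (l : Fin (∑ _i : Fin 1, a.len)),
      ((finSigmaFinEquiv.symm l).2 : ℕ) = l := fun a l => by
    rw [← finSigmaFinEquiv_one, Equiv.apply_symm_apply]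
  have ho : ∀ a : BorelCat Λ X, (mult Λ X).obj ((unit Λ (BorelCat Λ X)).obj a) = a := by
    intro a
    refine obj_ext (hl a) ?_
    intro i j h
    change a.letter _ = _
    congr 1
    exact Fin.ext ((hi a i).trans h)
  refine Functor.hext ho ?_
  intro a b p
  refine hom_heq (ho a) (ho b) _ _ (hl a) ?_ ?_
  · refine Eq.trans ?_ (Λ.unit_mul (hl a) ((toArr p).g))
    refine Λ.mul_congr rfl _ (fun _ => rfl) _ _ _ _ _ _ Λ.unit_eq_one.symm ?_
    intro (i : Fin 1)
    have key : ∀ (j : Fin 1) (h), ((toArr ((unit Λ (BorelCat Λ X)).map p)).f i j h).g =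
        (toArr p).g := by
      intro j h
      obtain rfl : i = j := Subsingleton.elim _ _
      rfl
    exact key _ _
  · intro i i' j j' h h' hi' hj'
    have key : ∀ (i₀ j₀ : Fin 1) (h₁) (i₁ : Fin a.len) (j₁ : Fin b.len) (h₂) (_ : i₁ = i')
        (_ : j₁ = j'), HEq (Twist.f (toArr ((toArr ((unit Λ (BorelCat Λ X)).map p)).f i₀ j₀ h₁)) i₁ j₁ h₂)
          ((toArr p).f i' j' h') := by
      intro i₀ j₀ h₁ i₁ j₁ h₂ e₁ e₂
      obtain rfl : i₀ = j₀ := Subsingleton.elim _ _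
      subst e₁ e₂
      rfl
    exact key _ _ _ _ _ _ (Fin.ext ((hi a i).trans hi')) (Fin.ext ((hi b j).trans hj'))

lemma map_unit_mult : map (unit Λ X) ⋙ mult Λ X = 𝟭 (BorelCat Λ X) := by
  have hl : ∀ a : BorelCat Λ X, ∑ _i : Fin a.len, 1 = a.len := fun a => by simp
  have hi : ∀ (n : ℕ) (l : Fin (∑ _i : Fin n, 1)),
      ((finSigmaFinEquiv.symm l).1 : ℕ) = l := fun n l => by
    have h := finSigma_val (finSigmaFinEquiv.symm l)
    rw [Equiv.apply_symm_apply, ← sum_castLE (by omega) (fun _ => 1)] at h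
    simpa using h.symm
  have ho : ∀ a : BorelCat Λ X, (mult Λ X).obj ((map (unit Λ X)).obj a) = a := by
    intro a
    refine obj_ext (hl a) ?_
    intro i j h
    change a.letter _ = _
    congr 1
    exact Fin.ext ((hi _ i).trans h)
  refine Functor.hext ho ?_
  intro a b p
  refine hom_heq (ho a) (ho b) _ _ (hl a) ?_ ?_
  · refine Eq.trans ?_ (Λ.mul_unit (hl a) ((toArr p).g))
    refine Λ.mul_congr rfl _ (fun _ => rfl) _ _ _ _ _ _ rfl ?_
    intro i
    exact Λ.unit_eq_one.symm
  · intro i i' j j' h h' hi' hj'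
    have key : ∀ (i₀ : Fin a.len) (j₀ : Fin b.len) (h₁) (i₁ j₁ : Fin 1) (h₂) (_ : i₀ = i')
        (_ : j₀ = j'), HEq (Twist.f (toArr ((toArr ((map (unit Λ X)).map p)).f i₀ j₀ h₁)) i₁ j₁ h₂)
          ((toArr p).f i' j' h') := by
      intro i₀ j₀ h₁ i₁ j₁ h₂ e₁ e₂
      obtain rfl : i₁ = j₁ := Subsingleton.elim _ _
      subst e₁ e₂
      rfl
    exact key _ _ (Twist.flatten_spec _ h).1 _ _ (Twist.flatten_spec _ h).2 (Fin.ext ((hi _ i).trans hi')) (Fin.ext ((hi _ j).trans hj'))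

lemma mult_mult : map (mult Λ X) ⋙ mult Λ X = mult Λ (BorelCat Λ X) ⋙ mult Λ X := by
  have hl : ∀ w : BorelCat Λ (BorelCat Λ (BorelCat Λ X)),
      ∑ i, ∑ j, ((w.letter i).letter j).len = ∑ l : Fin (∑ i, (w.letter i).len),
        ((w.letter (finSigmaFinEquiv.symm l).1).letter (finSigmaFinEquiv.symm l).2).len := by
    intro w
    exact sum_finSigma fun i j => ((w.letter i).letter j).len
  have ho : ∀ w : BorelCat Λ (BorelCat Λ (BorelCat Λ X)),
      (mult Λ X).obj ((map (mult Λ X)).obj w) =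
        (mult Λ X).obj ((mult Λ (BorelCat Λ X)).obj w) := by
    intro w
    refine obj_ext (hl w) ?_
    intro L L' h
    obtain ⟨h₁, h₂⟩ := finSigma_assoc_symm (p := fun i j => ((w.letter i).letter j).len) L L' h
    have key : ∀ (s s' : (i : Fin w.len) × Fin (w.letter i).len) (_ : s = s')
        (t : Fin ((w.letter s.1).letter s.2).len) (t' : Fin ((w.letter s'.1).letter s'.2).len)
        (_ : (t : ℕ) = t'), ((w.letter s.1).letter s.2).letter t =
          ((w.letter s'.1).letter s'.2).letter t' := by
      rintro s _ rfl t t' ht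
      rw [Fin.ext ht]
    exact key _ _ h₁ _ _ h₂
  refine Functor.hext ho ?_
  intro v w p
  refine hom_heq (ho v) (ho w) _ _ (hl v) ?_ ?_
  · have e := Λ.mul_assoc (k := fun i => (v.letter i).len)
      (p := fun i j => ((v.letter i).letter j).len) (hl v) rfl (toArr p).g
      (fun i => ((toArr p).f i ((toArr p).tgt i) rfl).g)
      (fun i j => ((toArr ((toArr p).f i ((toArr p).tgt i) rfl)).f j
        (Twist.tgt (toArr ((toArr p).f i ((toArr p).tgt i) rfl)) j) rfl).g)
    refine Eq.trans ?_ (e.trans ?_)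
    · exact Λ.mul_congr rfl (hl v) (fun _ => rfl) _ _ _ _ _ _ rfl (fun _ => rfl)
    · refine congrArg (Λ.mul rfl _) (funext fun l => ?_)
      have key : ∀ (i i') (h) (j j') (h'),
          ((toArr ((toArr p).f i ((toArr p).tgt i) rfl)).f j
            (Twist.tgt (toArr ((toArr p).f i ((toArr p).tgt i) rfl)) j) rfl).g =
          (toArr ((toArr ((toArr p).f i i' h)).f j j' h')).g := by
        intro i i' h j j' h'
        obtain rfl : i' = (toArr p).tgt i := Fin.ext h
        obtain rfl : j' = Twist.tgt (toArr ((toArr p).f i ((toArr p).tgt i) rfl)) j := Fin.ext h'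
        rfl
      exact key _ _ _ _ _ (Twist.flatten_spec (toArr p) rfl).2
  · intro L L' K K' h h' hL hK
    obtain ⟨a₁, a₂⟩ := finSigma_assoc_symm (p := fun i j => ((v.letter i).letter j).len) L L' hL
    obtain ⟨b₁, b₂⟩ := finSigma_assoc_symm (p := fun i j => ((w.letter i).letter j).len) K K' hK
    have key : ∀ (s s' : (i : Fin v.len) × Fin (v.letter i).len) (_ : s = s')
        (r r' : (i : Fin w.len) × Fin (w.letter i).len) (_ : r = r')
        (t : Fin ((v.letter s.1).letter s.2).len) (t' : Fin ((v.letter s'.1).letter s'.2).len)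
        (_ : (t : ℕ) = t')
        (x : Fin ((w.letter r.1).letter r.2).len) (x' : Fin ((w.letter r'.1).letter r'.2).len)
        (_ : (x : ℕ) = x') (c₁ c₂ c₃ c₁' c₂' c₃'),
        HEq ((toArr ((toArr ((toArr p).f s.1 r.1 c₁)).f s.2 r.2 c₂)).f t x c₃)
          ((toArr ((toArr ((toArr p).f s'.1 r'.1 c₁')).f s'.2 r'.2 c₂')).f t' x' c₃') := by
      rintro s _ rfl r _ rfl t t' ht x x' hx c₁ c₂ c₃ c₁' c₂' c₃'
      obtain rfl := Fin.ext ht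
      obtain rfl := Fin.ext hx
      rfl
    have d := Twist.flatten_spec (toArr ((map (mult Λ X)).map p)) h
    have d' := Twist.flatten_spec (toArr ((mult Λ (BorelCat Λ X)).map p)) h'
    have d₂ := Twist.flatten_spec (toArr ((toArr p).f _ _ d.1)) d.2
    have d₂' := Twist.flatten_spec (toArr p) d'.1
    exact key _ _ a₁ _ _ b₁ _ _ a₂ _ _ b₂ d.1 d₂.1 d₂.2 d₂'.1 d₂'.2 d'.2

end

end BorelCat

namespace BorelCat

section Quotient

variable {Λ : ActionOperad.{u}} {X : Type u} [SmallCategory X] {n : ℕ}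

/-- Morphisms between letters with equal indices. -/
def shift {x y : Fin n → X} (f : ∀ i, x i ⟶ y i) {i j : Fin n} (h : i = j) : x i ⟶ y j := h ▸ f i

lemma shift_comp {x y z : Fin n → X} (f : ∀ i, x i ⟶ y i) (g : ∀ i, y i ⟶ z i) {i j k : Fin n}
    (h : i = j) (h' : j = k) :
    shift (fun i => f i ≫ g i) (h.trans h') = shift f h ≫ shift g h' := by
  subst h h'
  rfl

lemma π_one_inv (i : Fin n) : (Λ.π n 1)⁻¹ i = i := by
  rw [map_one]
  rfl

lemma inv_eq_inv (g g' : Λ.gp n) (i j : Fin n) (h : (j : ℕ) = Λ.π n (g' * g⁻¹) i) :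
    (Λ.π n g)⁻¹ i = (Λ.π n g')⁻¹ j := by
  obtain rfl : j = _ := Fin.ext h
  simp

lemma f_eq_of_eq {m n : ℕ} {P : Fin m → Fin n → Type u} {s t : Twist Λ P} (e : s = t)
    (i j h h') : s.f i j h = t.f i j h' := by
  subst e
  rfl

variable (Λ X n) in
/-- The quotient functor `EΛ(n) × Xⁿ ⟶ EΛ(n) ×_{Λ(n)} Xⁿ`, sending `(g; x₁, …, xₙ)` to
`[g; x₁, …, xₙ] = [e; x_{π(g)⁻¹(1)}, …, x_{π(g)⁻¹(n)}]`. -/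
def quot : Codiscrete (Λ.gp n) × (Fin n → X) ⥤ BorelCat Λ X where
  obj p := ⟨n, fun i => p.2 ((Λ.π n p.1.as)⁻¹ i)⟩
  map {p q} f := ⟨rfl, q.1.as * p.1.as⁻¹, fun i j h => shift f.2 (inv_eq_inv _ _ i j h)⟩
  map_id p := by
    refine hom_ext (mul_inv_cancel _) ?_
    intro i j h h'
    have h'' : (j : ℕ) = Λ.π n 1 i := h'
    obtain rfl : j = i := Fin.ext (by simpa using h'')
    rfl
  map_comp {p q r} f g := by
    refine hom_ext ?_ ?_
    · change _ = (r.1.as * q.1.as⁻¹) * (q.1.as * p.1.as⁻¹)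
      group
    · intro i j h h'
      exact shift_comp f.2 g.2 (inv_eq_inv _ _ i _ rfl) (inv_eq_inv _ _ _ j (by
        have e : (j : ℕ) = Λ.π n (r.1.as * p.1.as⁻¹) i := h
        rw [e]
        simp))

variable (X) in
/-- The free action of `Λ(n)` on `EΛ(n) × Xⁿ` whose orbits are the classes of the equivalence
relation `(g h; x₁, …, xₙ) ∼ (g; x_{π(h)⁻¹(1)}, …, x_{π(h)⁻¹(n)})`. -/
def act (h : Λ.gp n) : Codiscrete (Λ.gp n) × (Fin n → X) ⥤ Codiscrete (Λ.gp n) × (Fin n → X) :=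
  (Codiscrete.functor fun g => g.as * h⁻¹).prod (Pi.comap (fun _ => X) ⇑(Λ.π n h)⁻¹)

lemma act_obj (h g : Λ.gp n) (x : Fin n → X) :
    (act X h).obj (⟨g * h⟩, x) = (⟨g⟩, fun i => x ((Λ.π n h)⁻¹ i)) := by
  refine Prod.ext ?_ rfl
  exact congrArg Codiscrete.mk (mul_inv_cancel_right g h)

lemma act_quot (h : Λ.gp n) : act X h ⋙ quot Λ X n = quot Λ X n := by
  have key : ∀ (g : Λ.gp n) (i : Fin n),
      (Λ.π n h)⁻¹ ((Λ.π n (g * h⁻¹))⁻¹ i) = (Λ.π n g)⁻¹ i := by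
    intro g i
    simp
  refine Functor.hext (fun p => ?_) ?_
  · exact congrArg (BorelCat.mk n) (funext fun i => congrArg p.2 (key p.1.as i))
  · intro p q f
    refine hom_heq ?_ ?_ _ _ rfl ?_ ?_
    · exact congrArg (BorelCat.mk n) (funext fun i => congrArg p.2 (key p.1.as i))
    · exact congrArg (BorelCat.mk n) (funext fun i => congrArg q.2 (key q.1.as i))
    · change (q.1.as * h⁻¹) * (p.1.as * h⁻¹)⁻¹ = q.1.as * p.1.as⁻¹
      group
    · intro i i' j j' c c' hi hj
      obtain rfl := Fin.ext hi
      obtain rfl := Fin.ext hj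
      have gen : ∀ (a b a' b' : Fin n) (e : a = b) (e' : a' = b') (_ : (Λ.π n h)⁻¹ a = a'),
          HEq (shift (x := fun i => p.2 ((Λ.π n h)⁻¹ i)) (y := fun i => q.2 ((Λ.π n h)⁻¹ i))
            (fun i => f.2 ((Λ.π n h)⁻¹ i)) e) (shift f.2 e') := by
        rintro a _ _ _ rfl rfl rfl
        rfl
      exact gen _ _ _ _ _ _ (key p.1.as i)

/-- Every object is a class `[g; x₁, …, xₙ]`. -/
lemma quot_obj_surjective (a : BorelCat Λ X) : ∃ n p, (quot Λ X n).obj p = a :=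
  ⟨a.len, (⟨1⟩, a.letter), obj_ext rfl (by
    intro i j h
    obtain rfl := Fin.ext h
    exact congrArg a.letter (π_one_inv i))⟩

/-- The object parts of the quotient functors identify exactly the elements of each orbit. -/
lemma quot_obj_eq_iff (p q : Codiscrete (Λ.gp n) × (Fin n → X)) :
    (quot Λ X n).obj p = (quot Λ X n).obj q ↔ ∃ h : Λ.gp n, q = (act X h).obj p := by
  constructor
  · intro e
    obtain ⟨⟨g⟩, x⟩ := p
    obtain ⟨⟨g'⟩, x'⟩ := q
    have e' : (fun i => x ((Λ.π n g)⁻¹ i)) = fun i => x' ((Λ.π n g')⁻¹ i) := by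
      simpa [quot] using e
    refine ⟨g'⁻¹ * g, Prod.ext (congrArg Codiscrete.mk (by group)) ?_⟩
    funext i
    have := congrFun e' (Λ.π n g' i)
    simpa [act] using this.symm
  · rintro ⟨h, rfl⟩
    exact (Functor.congr_obj (act_quot h) p).symm

lemma arrow_ext {C : Type*} [Category C] {a a' b b' : C} {f : a ⟶ b} {f' : a' ⟶ b'} (ha : a = a')
    (hb : b = b') (h : HEq f f') : Arrow.mk f = Arrow.mk f' := by
  subst ha hb
  rw [eq_of_heq h]

/-- Every morphism is the class of a morphism of `EΛ(n) × Xⁿ`. -/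
lemma quot_map_surjective {a b : BorelCat Λ X} (f : a ⟶ b) :
    ∃ (n : ℕ) (p q : Codiscrete (Λ.gp n) × (Fin n → X)) (φ : p ⟶ q),
      Arrow.mk ((quot Λ X n).map φ) = Arrow.mk f := by
  obtain ⟨n, x⟩ := a
  obtain ⟨m, y⟩ := b
  obtain ⟨len, g, f⟩ := f
  change n = m at len
  subst len
  refine ⟨n, (⟨1⟩, x), (⟨g⟩, fun i => y (Λ.π n g i)), ((), fun i => f i _ rfl), ?_⟩
  have h₁ : (quot Λ X n).obj (⟨1⟩, x) = ⟨n, x⟩ :=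
    congrArg (BorelCat.mk n) (funext fun i => congrArg x (π_one_inv i))
  have h₂ : (quot Λ X n).obj (⟨g⟩, fun i => y (Λ.π n g i)) = ⟨n, y⟩ := by simp [quot]
  refine arrow_ext h₁ h₂ (hom_heq h₁ h₂ _ _ rfl ?_ ?_)
  · change g * 1⁻¹ = g
    simp
  · intro i i' j j' c c' hi hj
    obtain rfl := Fin.ext hi
    obtain rfl := Fin.ext hj
    have gen : ∀ (a b b' : Fin n) (e : a = b) (e' : (b' : ℕ) = Λ.π n g a),
        HEq (shift (y := fun i => y (Λ.π n g i)) (fun i => f i (Λ.π n g i) rfl) e) (f a b' e') := by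
      rintro a _ b' rfl e'
      obtain rfl : b' = _ := Fin.ext e'
      rfl
    have e₁ : (Λ.π n 1)⁻¹ i = i := π_one_inv i
    have gen' : ∀ (a : Fin n) (b : Fin n) (e : a = b), a = i →
        HEq (shift (y := fun i => y (Λ.π n g i)) (fun i => f i (Λ.π n g i) rfl) e) (f i j c') := by
      rintro a b e rfl
      exact gen a b j e c'
    exact gen' _ _ _ e₁

/-- The morphism parts of the quotient functors identify exactly the elements of each orbit. -/
lemma quot_map_eq_iff {p q p' q' : Codiscrete (Λ.gp n) × (Fin n → X)} (φ : p ⟶ q)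
    (ψ : p' ⟶ q') :
    Arrow.mk ((quot Λ X n).map φ) = Arrow.mk ((quot Λ X n).map ψ) ↔
      ∃ h : Λ.gp n, Arrow.mk ψ = Arrow.mk ((act X h).map φ) := by
  have main : ∀ {p q p' q' : Codiscrete (Λ.gp n) × (Fin n → X)} (φ : p ⟶ q) (ψ : p' ⟶ q')
      (_ : p.1.as = p'.1.as) (_ : Arrow.mk ((quot Λ X n).map φ) = Arrow.mk ((quot Λ X n).map ψ)),
      Arrow.mk ψ = Arrow.mk φ := by
    rintro ⟨⟨g⟩, x⟩ ⟨⟨k⟩, y⟩ ⟨⟨g'⟩, x'⟩ ⟨⟨k'⟩, y'⟩ ⟨⟨⟩, φ⟩ ⟨⟨⟩, ψ⟩ e₀ e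
    obtain rfl : g = g' := e₀
    have eg := congrArg (fun t : Arrow (BorelCat Λ X) =>
      (⟨t.left.len, (toArr t.hom).g⟩ : Σ m, Λ.gp m)) e
    have eg' : k * g⁻¹ = k' * g⁻¹ := eq_of_heq (Sigma.mk.inj eg).2
    obtain rfl : k = k' := mul_right_cancel eg'
    have ex : (fun i => x ((Λ.π n g)⁻¹ i)) = fun i => x' ((Λ.π n g)⁻¹ i) := by
      simpa [quot] using congrArg (fun t : Arrow (BorelCat Λ X) => t.left) e
    have ey : (fun i => y ((Λ.π n k)⁻¹ i)) = fun i => y' ((Λ.π n k)⁻¹ i) := by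
      simpa [quot] using congrArg (fun t : Arrow (BorelCat Λ X) => t.right) e
    obtain rfl : x = x' := funext fun i => by simpa using congrFun ex (Λ.π n g i)
    obtain rfl : y = y' := funext fun i => by simpa using congrFun ey (Λ.π n k i)
    have eh := (Arrow.mk_inj _ _).1 e
    have ef : ∀ (i j : Fin n) (h : (j : ℕ) = Λ.π n (k * g⁻¹) i),
        shift φ (inv_eq_inv g k i j h) = shift ψ (inv_eq_inv g k i j h) := by
      intro i j h
      exact f_eq_of_eq eh i j h h
    have : φ = ψ := funext fun i => by
      have := ef (Λ.π n g i) (Λ.π n k i) (by simp)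
      have gen : ∀ (a b : Fin n) (h : a = b), a = i → shift φ h = shift ψ h → φ i = ψ i := by
        rintro a _ rfl rfl h
        exact h
      exact gen _ _ _ (by simp) this
    rw [this]
  have hact : ∀ h : Λ.gp n, Arrow.mk ((quot Λ X n).map ((act X h).map φ)) =
      Arrow.mk ((quot Λ X n).map φ) := fun h =>
    congrArg (fun F : _ ⥤ BorelCat Λ X => Arrow.mk (F.map φ)) (act_quot h)
  constructor
  · intro e
    refine ⟨p'.1.as⁻¹ * p.1.as, main _ _ ?_ ((hact _).trans e)⟩
    change p.1.as * (p'.1.as⁻¹ * p.1.as)⁻¹ = p'.1.as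
    group
  · rintro ⟨h, e⟩
    refine (hact h).symm.trans ?_
    exact congrArg (fun t : Arrow _ => Arrow.mk ((quot Λ X n).map t.hom)) e.symm

end Quotient

end BorelCat

/-- On objects, the multiplication is
`[g; [h₁; x₁₁, …], …, [hₙ; xₙ₁, …]] ↦ [μ(g; h₁, …, hₙ); x₁₁, …]`. -/
lemma BorelCat.mult_quot_obj {Λ : ActionOperad.{u}} {X : Type u} [SmallCategory X] {n : ℕ}
    {k : Fin n → ℕ} (g : Λ.gp n) (h : ∀ i, Λ.gp (k i)) (x : ∀ i, Fin (k i) → X) :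
    (mult Λ X).obj ((quot Λ (BorelCat Λ X) n).obj
      (⟨g⟩, fun i => (quot Λ X (k i)).obj (⟨h i⟩, x i))) =
    (quot Λ X (∑ i, k i)).obj (⟨Λ.mul rfl g h⟩, fun l =>
      x (finSigmaFinEquiv.symm l).1 (finSigmaFinEquiv.symm l).2) := by
  refine obj_ext (Equiv.sum_comp (Λ.π n g)⁻¹ k) ?_
  intro l l' hl
  change x ((Λ.π n g)⁻¹ (finSigmaFinEquiv.symm l).1)
    ((Λ.π _ (h ((Λ.π n g)⁻¹ (finSigmaFinEquiv.symm l).1)))⁻¹ (finSigmaFinEquiv.symm l).2) =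
    x (finSigmaFinEquiv.symm ((Λ.π _ (Λ.mul rfl g h))⁻¹ l')).1
      (finSigmaFinEquiv.symm ((Λ.π _ (Λ.mul rfl g h))⁻¹ l')).2
  have gen : ∀ (s : (j : Fin n) × Fin (k ((Λ.π n g)⁻¹ j))) (t : (i : Fin n) × Fin (k i))
      (l' : Fin (∑ i, k i)) (_ : finSigmaFinEquiv t = (Λ.π _ (Λ.mul rfl g h))⁻¹ l')
      (_ : (finSigmaFinEquiv s : ℕ) = l'),
      x ((Λ.π n g)⁻¹ s.1) ((Λ.π _ (h ((Λ.π n g)⁻¹ s.1)))⁻¹ s.2) = x t.1 t.2 := by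
    rintro ⟨j, s⟩ ⟨i, t⟩ l' ht hs
    obtain rfl : Λ.π _ (Λ.mul rfl g h) (finSigmaFinEquiv ⟨i, t⟩) = l' := by
      rw [ht]
      simp
    rw [Λ.π_mul, permOperadMul_apply rfl _ _ i t _ rfl] at hs
    obtain ⟨h₁, h₂⟩ := (finSigma_val_iff (k := fun j => k ((Λ.π n g)⁻¹ j))
      (k' := fun j => k ((Λ.π n g).symm j)) rfl (fun _ => rfl) _ _).1 hs
    have e₁ : j = Λ.π n g i := Fin.ext h₁
    have e₂ : (s : ℕ) = Λ.π _ (h i) t := h₂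
    have gen' : ∀ (i' : Fin n) (s : Fin (k i')) (_ : i' = i) (_ : (s : ℕ) = Λ.π _ (h i) t),
        x i' ((Λ.π _ (h i'))⁻¹ s) = x i t := by
      rintro _ s rfl e
      obtain rfl := Fin.ext e
      simp
    exact gen' _ s (by simp [e₁]) e₂
  exact gen _ _ l' (Equiv.apply_symm_apply _ _) ((congrArg Fin.val
    (Equiv.apply_symm_apply finSigmaFinEquiv l)).trans hl)

/-- A 2-monad on a strict bicategory: a strict 2-functor `T` with 2-natural transformations
`unit : 1 ⟶ T` and `mult : T ∘ T ⟶ T` satisfying the monad laws strictly. -/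
structure TwoMonad (K : Type*) [Bicategory K] [Bicategory.Strict K] where
  T : StrictPseudofunctor K K
  unit : ∀ X : K, X ⟶ T.obj X
  mult : ∀ X : K, T.obj (T.obj X) ⟶ T.obj X
  unit_naturality : ∀ {X Y : K} (f : X ⟶ Y), f ≫ unit Y = unit X ≫ T.map f
  unit_naturality₂ : ∀ {X Y : K} {f g : X ⟶ Y} (α : f ⟶ g),
    α ▷ unit Y ≫ eqToHom (unit_naturality g) = eqToHom (unit_naturality f) ≫ unit X ◁ T.map₂ α
  mult_naturality : ∀ {X Y : K} (f : X ⟶ Y),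
    T.map (T.map f) ≫ mult Y = mult X ≫ T.map f
  mult_naturality₂ : ∀ {X Y : K} {f g : X ⟶ Y} (α : f ⟶ g),
    T.map₂ (T.map₂ α) ▷ mult Y ≫ eqToHom (mult_naturality g) =
      eqToHom (mult_naturality f) ≫ mult X ◁ T.map₂ α
  unit_mult : ∀ X : K, unit (T.obj X) ≫ mult X = 𝟙 (T.obj X)
  map_unit_mult : ∀ X : K, T.map (unit X) ≫ mult X = 𝟙 (T.obj X)
  map_mult_mult : ∀ X : K, T.map (mult X) ≫ mult X = mult (T.obj X) ≫ mult X

namespace ActionOperad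

variable (Λ : ActionOperad.{u})

/-- `EΛ` on categories, functors and natural transformations. -/
def borelPrelax : PrelaxFunctor Cat.{u, u} Cat.{u, u} where
  obj X := Cat.of (BorelCat Λ X)
  map F := (BorelCat.map F.toFunctor).toCatHom
  map₂ α := (BorelCat.map₂ α.toNatTrans).toCatHom₂
  map₂_id _ := Cat.Hom₂.ext (NatTrans.ext rfl)
  map₂_comp _ _ := Cat.Hom₂.ext (NatTrans.ext (funext fun _ => (BorelCat.diagHom_diagHom _ _).symm))

/-- The 2-functor underlying the 2-monad `EΛ`. -/
def borelFunctor : StrictPseudofunctor Cat.{u, u} Cat.{u, u} :=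
  StrictPseudofunctor.mk'
    { toPrelaxFunctor := Λ.borelPrelax
      map_id := fun X => Cat.ext BorelCat.map_id_eq
      map_comp := fun F G => Cat.ext (BorelCat.map_comp_eq F.toFunctor G.toFunctor)
      map₂_whisker_left := by
        intro X Y Z F G H α
        refine Cat.Hom₂.ext (NatTrans.ext (funext fun a => ?_))
        exact ((Category.id_comp _).trans (Category.comp_id _)).symm
      map₂_whisker_right := by
        intro X Y Z F G α H
        refine Cat.Hom₂.ext (NatTrans.ext (funext fun a => ?_))
        refine Eq.trans ?_ ((Category.id_comp _).trans (Category.comp_id _)).symm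
        exact BorelCat.diagHom_map H.toFunctor _
      map₂_left_unitor := by
        intro X Y F
        refine Cat.Hom₂.ext (NatTrans.ext (funext fun a => ?_))
        exact (Category.id_comp _).symm
      map₂_right_unitor := by
        intro X Y F
        refine Cat.Hom₂.ext (NatTrans.ext (funext fun a => ?_))
        exact (Category.id_comp _).symm
      map₂_associator := by
        intro W X Y Z F G H
        refine Cat.Hom₂.ext (NatTrans.ext (funext fun a => ?_))
        exact ((Category.id_comp _).trans (Category.comp_id _)).symm }

lemma cat_square_of_heq {X Y : Cat.{u, u}} {F G F' G' : X ⟶ Y} (hF : F = F') (hG : G = G')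
    (α : F ⟶ G) (β : F' ⟶ G') (h : ∀ a, HEq (α.toNatTrans.app a) (β.toNatTrans.app a)) :
    α ≫ eqToHom hG = eqToHom hF ≫ β := by
  subst hF hG
  simp only [eqToHom_refl, Category.comp_id, Category.id_comp]
  exact Cat.Hom₂.ext (NatTrans.ext (funext fun a => eq_of_heq (h a)))

/-- The Borel construction 2-monad `EΛ` on `Cat`. -/
def borel : TwoMonad Cat.{u, u} where
  T := Λ.borelFunctor
  unit X := (BorelCat.unit Λ X).toCatHom
  mult X := (BorelCat.mult Λ X).toCatHom
  unit_naturality F := Cat.ext (BorelCat.unit_naturality F.toFunctor)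
  unit_naturality₂ _ := cat_square_of_heq _ _ _ _ fun _ => HEq.rfl
  mult_naturality F := Cat.ext (BorelCat.mult_naturality F.toFunctor)
  mult_naturality₂ {X Y F G} α := cat_square_of_heq _ _ _ _ fun a => heq_of_eq
    (BorelCat.flatten_diagHom (Λ := Λ) (X := Y) (n := a.len) (k := fun i => (a.letter i).len)
      (x := fun i j => F.toFunctor.obj ((a.letter i).letter j))
      (y := fun i j => G.toFunctor.obj ((a.letter i).letter j))
      (fun i j => α.toNatTrans.app ((a.letter i).letter j)))
  unit_mult X := Cat.ext BorelCat.unit_mult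
  map_unit_mult X := Cat.ext BorelCat.map_unit_mult
  map_mult_mult X := Cat.ext BorelCat.mult_mult

end ActionOperad

/-- The bicategory of categories, profunctors and transformations has categories as objects. -/
structure Prof : Type (u + 1) where
  /-- the underlying category -/
  cat : Cat.{u, u}

namespace Profunctor

section

variable {C D : Type u} [SmallCategory C] [SmallCategory D]

/-- The set `F(y, x)`, for a profunctor `F : C ⇸ D`, `x ∈ C` and `y ∈ D`. -/
abbrev El (F : Profunctor.{u} C D) (y : D) (x : C) : Type u := (F.obj x).obj (op y)

/-- The contravariant action. -/
abbrev pre (F : Profunctor.{u} C D) {y y' : D} {x : C} (f : y' ⟶ y) (p : El F y x) : El F y' x :=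
  (F.obj x).map f.op p

/-- The covariant action. -/
abbrev post (F : Profunctor.{u} C D) {y : D} {x x' : C} (g : x ⟶ x') (p : El F y x) : El F y x' :=
  (F.map g).app (op y) p

/-- The component of a transformation. -/
abbrev ap {F G : Profunctor.{u} C D} (α : F ⟶ G) {y : D} {x : C} (p : El F y x) : El G y x :=
  (α.app x).app (op y) p

lemma pre_id (F : Profunctor.{u} C D) {y : D} {x : C} (p : El F y x) : pre F (𝟙 y) p = p := by
  simp [pre]

lemma pre_comp (F : Profunctor.{u} C D) {y y' y'' : D} {x : C} (f : y' ⟶ y) (f' : y'' ⟶ y')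
    (p : El F y x) : pre F (f' ≫ f) p = pre F f' (pre F f p) := by
  simp [pre]

lemma post_id (F : Profunctor.{u} C D) {y : D} {x : C} (p : El F y x) : post F (𝟙 x) p = p := by
  simp [post]

lemma post_comp (F : Profunctor.{u} C D) {y : D} {x x' x'' : C} (g : x ⟶ x') (g' : x' ⟶ x'')
    (p : El F y x) : post F (g ≫ g') p = post F g' (post F g p) := by
  simp [post]

lemma post_pre (F : Profunctor.{u} C D) {y y' : D} {x x' : C} (f : y' ⟶ y) (g : x ⟶ x')
    (p : El F y x) : post F g (pre F f p) = pre F f (post F g p) :=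
  NatTrans.naturality_apply (F.map g) f.op p

lemma ap_pre {F G : Profunctor.{u} C D} (α : F ⟶ G) {y y' : D} {x : C} (f : y' ⟶ y)
    (p : El F y x) : ap α (pre F f p) = pre G f (ap α p) :=
  NatTrans.naturality_apply (α.app x) f.op p

lemma ap_post {F G : Profunctor.{u} C D} (α : F ⟶ G) {y : D} {x x' : C} (g : x ⟶ x')
    (p : El F y x) : ap α (post F g p) = post G g (ap α p) :=
  ConcreteCategory.congr_hom (C := Type u) (congrArg (fun t => NatTrans.app t (op y)) (α.naturality g)) p

lemma hom_ext {F G : Profunctor.{u} C D} {α β : F ⟶ G}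
    (h : ∀ (y : D) (x : C) (p : El F y x), ap α p = ap β p) : α = β := by
  ext x y p
  exact h _ _ _

/-- A profunctor from a family of sets with commuting actions. -/
def ofActions (E : D → C → Type u) (l : ∀ {y y' : D} {x : C}, (y' ⟶ y) → E y x → E y' x)
    (r : ∀ {y : D} {x x' : C}, (x ⟶ x') → E y x → E y x')
    (l_id : ∀ {y x} (p : E y x), l (𝟙 y) p = p)
    (l_comp : ∀ {y y' y'' x} (f : y' ⟶ y) (f' : y'' ⟶ y') (p : E y x),
      l (f' ≫ f) p = l f' (l f p))
    (r_id : ∀ {y x} (p : E y x), r (𝟙 x) p = p)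
    (r_comp : ∀ {y x x' x''} (g : x ⟶ x') (g' : x' ⟶ x'') (p : E y x),
      r (g ≫ g') p = r g' (r g p))
    (r_l : ∀ {y y' x x'} (f : y' ⟶ y) (g : x ⟶ x') (p : E y x), r g (l f p) = l f (r g p)) :
    Profunctor.{u} C D where
  obj x :=
    { obj y := E (unop y) x
      map f := ↾fun p => l f.unop p
      map_id y := by ext p; exact l_id p
      map_comp f g := by ext p; exact l_comp _ _ p }
  map g :=
    { app y := ↾fun p => r g p
      naturality y y' f := by ext p; exact r_l _ _ p }
  map_id x := by ext y p; exact r_id p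
  map_comp f g := by ext y p; exact r_comp _ _ p

/-- A transformation from a family of maps compatible with both actions. -/
def ofMaps {F G : Profunctor.{u} C D} (a : ∀ (y : D) (x : C), El F y x → El G y x)
    (a_pre : ∀ {y y' x} (f : y' ⟶ y) (p : El F y x), a y' x (pre F f p) = pre G f (a y x p))
    (a_post : ∀ {y x x'} (g : x ⟶ x') (p : El F y x), a y x' (post F g p) = post G g (a y x p)) :
    F ⟶ G where
  app x :=
    { app y := ↾a (unop y) x
      naturality y y' f := by ext p; exact a_pre f.unop p }
  naturality x x' g := by ext y p; exact a_post g p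

/-- An isomorphism from a family of mutually inverse maps. -/
def isoOfMaps {F G : Profunctor.{u} C D} (α : F ⟶ G) (b : ∀ (y : D) (x : C), El G y x → El F y x)
    (h₁ : ∀ {y x} (p : El F y x), b y x (ap α p) = p)
    (h₂ : ∀ {y x} (q : El G y x), ap α (b y x q) = q) : F ≅ G where
  hom := α
  inv := ofMaps b
    (fun f p => by
      have := ap_pre α f (b _ _ p)
      rw [h₂] at this
      rw [← this, h₁])
    (fun f p => by
      have := ap_post α f (b _ _ p)
      rw [h₂] at this
      rw [← this, h₁])
  hom_inv_id := hom_ext fun _ _ p => h₁ p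
  inv_hom_id := hom_ext fun _ _ p => h₂ p

end

section

variable {B C D : Type u} [SmallCategory B] [SmallCategory C] [SmallCategory D]

/-- The elements of `∐_y G(z, y) × F(y, x)`. -/
structure CompPre (F : Profunctor.{u} B C) (G : Profunctor.{u} C D) (z : D) (x : B) : Type u where
  mid : C
  left : El G z mid
  right : El F mid x

/-- For `f : y ⟶ y'`, the relation identifies `(y, l, f* r)` with `(y', f_* l, r)`. -/
def CompPre.Rel (F : Profunctor.{u} B C) (G : Profunctor.{u} C D) (z : D) (x : B)
    (p q : CompPre F G z x) : Prop :=
  ∃ f : p.mid ⟶ q.mid, q.left = post G f p.left ∧ p.right = pre F f q.right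

/-- The composite `G ∘ F (z, x) = ∫^y G(z, y) × F(y, x)`, the coend being the quotient of
`∐_y G(z, y) × F(y, x)` by the equivalence relation generated by the relation above. -/
def comp (F : Profunctor.{u} B C) (G : Profunctor.{u} C D) : Profunctor.{u} B D :=
  ofActions (fun z x => Quot (CompPre.Rel F G z x))
    (fun f => Quot.map (fun p => ⟨p.mid, pre G f p.left, p.right⟩) (by
      rintro ⟨y, l, r⟩ ⟨y', l', r'⟩ ⟨h, h₁, h₂⟩
      exact ⟨h, (congrArg (pre G f) h₁).trans (post_pre G f h l).symm, h₂⟩))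
    (fun g => Quot.map (fun p => ⟨p.mid, p.left, post F g p.right⟩) (by
      rintro ⟨y, l, r⟩ ⟨y', l', r'⟩ ⟨h, h₁, h₂⟩
      exact ⟨h, h₁, (congrArg (post F g) h₂).trans (post_pre F h g r')⟩))
    (by
      rintro z x ⟨y, l, r⟩
      exact congrArg (fun t => Quot.mk _ (CompPre.mk y t r)) (pre_id G l))
    (by
      rintro z z' z'' x f f' ⟨y, l, r⟩
      exact congrArg (fun t => Quot.mk _ (CompPre.mk y t r)) (pre_comp G f f' l))
    (by
      rintro z x ⟨y, l, r⟩
      exact congrArg (fun t => Quot.mk _ (CompPre.mk y l t)) (post_id F r))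
    (by
      rintro z x x' x'' f f' ⟨y, l, r⟩
      exact congrArg (fun t => Quot.mk _ (CompPre.mk y l t)) (post_comp F f f' r))
    (by
      rintro z z' x x' f g ⟨y, l, r⟩
      rfl)

namespace Comp

variable {F : Profunctor.{u} B C} {G : Profunctor.{u} C D}

/-- The class of a pair. -/
def mk {z : D} {x : B} {y : C} (l : El G z y) (r : El F y x) : El (comp F G) z x :=
  Quot.mk _ ⟨y, l, r⟩

lemma sound {z : D} {x : B} {y y' : C} (f : y ⟶ y') (l : El G z y) (r : El F y' x) :
    mk l (pre F f r) = mk (post G f l) r :=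
  Quot.sound ⟨f, rfl, rfl⟩

lemma ind {z : D} {x : B} {p : El (comp F G) z x → Prop}
    (h : ∀ (y : C) (l : El G z y) (r : El F y x), p (mk l r)) (q : El (comp F G) z x) : p q :=
  Quot.ind (fun t => h t.mid t.left t.right) q

/-- Functions out of the coend. -/
def lift {z : D} {x : B} {T : Type u} (t : ∀ y : C, El G z y → El F y x → T)
    (h : ∀ {y y' : C} (f : y ⟶ y') (l : El G z y) (r : El F y' x),
      t y l (pre F f r) = t y' (post G f l) r) : El (comp F G) z x → T :=
  Quot.lift (fun p => t p.mid p.left p.right) (by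
    rintro ⟨y, l, r⟩ ⟨y', l', r'⟩ ⟨f, h₁, h₂⟩
    dsimp only at f h₁ h₂ ⊢
    rw [h₁, h₂]
    exact h f l r')

end Comp

/-- Whiskering on the left. -/
def whiskerL (F : Profunctor.{u} B C) {G G' : Profunctor.{u} C D} (α : G ⟶ G') :
    comp F G ⟶ comp F G' :=
  ofMaps (fun _ _ => Comp.lift (fun _ l r => Comp.mk (ap α l) r) (fun h l r => by
      rw [Comp.sound, ap_post]))
    (fun f p => by
      induction p using Comp.ind with | h y l r => exact congrArg (Comp.mk · r) (ap_pre α f l))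
    (fun g p => by induction p using Comp.ind with | h y l r => rfl)

/-- Whiskering on the right. -/
def whiskerR {F F' : Profunctor.{u} B C} (α : F ⟶ F') (G : Profunctor.{u} C D) :
    comp F G ⟶ comp F' G :=
  ofMaps (fun _ _ => Comp.lift (fun _ l r => Comp.mk l (ap α r)) (fun h l r => by
      rw [← Comp.sound, ap_pre]))
    (fun f p => by induction p using Comp.ind with | h y l r => rfl)
    (fun g p => by
      induction p using Comp.ind with | h y l r => exact congrArg (Comp.mk l) (ap_post α g r))

/-- The left unitor. -/
def leftUnit (F : Profunctor.{u} B C) : comp (Profunctor.id (C := B)) F ≅ F :=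
  isoOfMaps
    (ofMaps (fun _ _ => Comp.lift (fun _ l r => post F r l) (fun h l r => post_comp F h r l))
      (fun f p => by induction p using Comp.ind with | h y l r => exact post_pre F f r l)
      (fun g p => by induction p using Comp.ind with | h y l r => exact post_comp F r g l))
    (fun _ x p => Comp.mk (F := Profunctor.id) p (𝟙 x))
    (fun p => by
      induction p using Comp.ind with
      | h y l r =>
        refine (Comp.sound (F := Profunctor.id (C := B)) r l (𝟙 _)).symm.trans ?_
        exact congrArg (Comp.mk l) (Category.comp_id r))
    (fun p => post_id F p)

/-- The right unitor. -/
def rightUnit (F : Profunctor.{u} B C) : comp F (Profunctor.id (C := C)) ≅ F :=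
  isoOfMaps
    (ofMaps (fun _ _ => Comp.lift (fun _ l r => pre F l r) (fun h l r => (pre_comp F h l r).symm))
      (fun f p => by induction p using Comp.ind with | h y l r => exact pre_comp F l f r)
      (fun g p => by induction p using Comp.ind with | h y l r => exact (post_pre F l g r).symm))
    (fun y _ p => Comp.mk (G := Profunctor.id) (𝟙 y) p)
    (fun p => by
      induction p using Comp.ind with
      | h y l r =>
        refine (Comp.sound (G := Profunctor.id (C := C)) l (𝟙 _) r).trans ?_
        exact congrArg (Comp.mk (G := Profunctor.id) · r) (Category.id_comp l))
    (fun p => pre_id F p)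

end

section

variable {A B C D : Type u} [SmallCategory A] [SmallCategory B] [SmallCategory C] [SmallCategory D]

/-- The associator. -/
def assoc (F : Profunctor.{u} A B) (G : Profunctor.{u} B C) (H : Profunctor.{u} C D) :
    comp (comp F G) H ≅ comp F (comp G H) :=
  isoOfMaps
    (ofMaps (fun _ _ => Comp.lift
        (fun _ l => Comp.lift (fun _ m r => Comp.mk (G := comp G H) (Comp.mk l m) r)
          (fun h m r => Comp.sound (G := comp G H) h (Comp.mk l m) r))
        (fun h l q => by
          induction q using Comp.ind with
          | h z m r => exact congrArg (Comp.mk (G := comp G H) · r) (Comp.sound h l m)))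
      (fun f p => by
        induction p using Comp.ind with
        | h y l q => induction q using Comp.ind with | h z m r => rfl)
      (fun f p => by
        induction p using Comp.ind with
        | h y l q => induction q using Comp.ind with | h z m r => rfl))
    (fun _ _ => Comp.lift
      (fun _ q r => Comp.lift (fun _ l m => Comp.mk (F := comp F G) l (Comp.mk m r))
        (fun h l m => Comp.sound (F := comp F G) h l (Comp.mk m r)) q)
      (fun h q r => by
        induction q using Comp.ind with
        | h y l m => exact congrArg (Comp.mk (F := comp F G) l) (Comp.sound h m r)))
    (fun p => by
      induction p using Comp.ind with
      | h y l q => induction q using Comp.ind with | h z m r => rfl)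
    (fun p => by
      induction p using Comp.ind with
      | h y q r => induction q using Comp.ind with | h z l m => rfl)

end

end Profunctor

namespace Prof

instance : CategoryStruct Prof.{u} where
  Hom X Y := Profunctor.{u} X.cat Y.cat
  id X := Profunctor.id (C := X.cat)
  comp F G := Profunctor.comp F G

/-- A 1-cell, as a profunctor. -/
abbrev Hom.prof {X Y : Prof.{u}} (F : X ⟶ Y) : Profunctor.{u} X.cat Y.cat := F

instance homCategory (X Y : Prof.{u}) : Category (X ⟶ Y) :=
  inferInstanceAs (Category (X.cat ⥤ Y.catᵒᵖ ⥤ Type u))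

/-- The bicategory of categories, profunctors and transformations. -/
instance bicategory : Bicategory Prof.{u} where
  homCategory := homCategory
  whiskerLeft F _ _ α := Profunctor.whiskerL F α
  whiskerRight α H := Profunctor.whiskerR α H
  associator F G H := Profunctor.assoc F G H
  leftUnitor F := Profunctor.leftUnit F
  rightUnitor F := Profunctor.rightUnit F
  whiskerLeft_id := by
    intros
    refine Profunctor.hom_ext fun _ _ p => ?_
    induction p using Profunctor.Comp.ind with | h y l r => ?_
    rfl
  whiskerLeft_comp := by
    intros
    refine Profunctor.hom_ext fun _ _ p => ?_
    induction p using Profunctor.Comp.ind with | h y l r => ?_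
    rfl
  id_whiskerLeft {_ _ _ G} α := by
    refine Profunctor.hom_ext fun _ _ p => ?_
    induction p using Profunctor.Comp.ind with | h y l r => ?_
    refine Eq.trans ?_ (congrArg (Profunctor.Comp.mk (F := Profunctor.id) · (𝟙 _))
      (Profunctor.ap_post α r l)).symm
    refine Eq.trans ?_ (Profunctor.Comp.sound (F := Profunctor.id) _ _ _)
    exact congrArg (Profunctor.Comp.mk _) (Category.comp_id _).symm
  comp_whiskerLeft := by
    intros
    refine Profunctor.hom_ext fun _ _ p => ?_
    induction p using Profunctor.Comp.ind with | h y l q => ?_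
    induction q using Profunctor.Comp.ind with | h z m r => ?_
    rfl
  id_whiskerRight := by
    intros
    refine Profunctor.hom_ext fun _ _ p => ?_
    induction p using Profunctor.Comp.ind with | h y l r => ?_
    rfl
  comp_whiskerRight := by
    intros
    refine Profunctor.hom_ext fun _ _ p => ?_
    induction p using Profunctor.Comp.ind with | h y l r => ?_
    rfl
  whiskerRight_id α := by
    refine Profunctor.hom_ext fun _ _ p => ?_
    induction p using Profunctor.Comp.ind with | h y l r => ?_
    refine Eq.trans ?_ (congrArg (Profunctor.Comp.mk (G := Profunctor.id) (𝟙 _))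
      (Profunctor.ap_pre α l r)).symm
    refine Eq.trans ?_ (Profunctor.Comp.sound (G := Profunctor.id) _ _ _).symm
    exact congrArg (Profunctor.Comp.mk (G := Profunctor.id) · _) (Category.id_comp _).symm
  whiskerRight_comp _ _ _ := by
    refine Profunctor.hom_ext fun _ _ p => ?_
    induction p using Profunctor.Comp.ind with | h y q l => ?_
    induction q using Profunctor.Comp.ind with | h z m r => ?_
    rfl
  whisker_assoc _ _ _ _ _ := by
    refine Profunctor.hom_ext fun _ _ p => ?_
    induction p using Profunctor.Comp.ind with | h y l q => ?_
    induction q using Profunctor.Comp.ind with | h z m r => ?_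
    rfl
  whisker_exchange _ _ := by
    refine Profunctor.hom_ext fun _ _ p => ?_
    induction p using Profunctor.Comp.ind with | h y l q => ?_
    rfl
  pentagon _ _ _ _ := by
    refine Profunctor.hom_ext fun _ _ p => ?_
    induction p using Profunctor.Comp.ind with | h y l q => ?_
    induction q using Profunctor.Comp.ind with | h z m q => ?_
    induction q using Profunctor.Comp.ind with | h w n r => ?_
    rfl
  triangle F G := by
    refine Profunctor.hom_ext fun _ _ p => ?_
    induction p using Profunctor.Comp.ind with | h y l q => ?_
    induction q using Profunctor.Comp.ind with | h z m r => ?_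
    exact (Profunctor.Comp.sound (F := F) (G := G) m l r).symm

end Prof

/-- The embedding `(-)⁺ : Cat ⥤ Prof`, the identity on objects, with `F⁺(y, x) = Y(y, F x)`. -/
def plus : Cat.{u, u} ⥤ᵖ Prof.{u} where
  obj X := ⟨X⟩
  map F := F.toFunctor.toProfunctor
  map₂ {X Y F G} α := Profunctor.ofMaps (F := F.toFunctor.toProfunctor)
    (G := G.toFunctor.toProfunctor) (fun _ x (p : _ ⟶ _) => p ≫ α.toNatTrans.app x)
    (fun f p => Category.assoc f p _)
    (fun g p => by
      refine (Category.assoc p (F.toFunctor.map g) _).trans ?_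
      rw [α.toNatTrans.naturality g]
      exact (Category.assoc p _ _).symm)
  map₂_id F := Profunctor.hom_ext fun _ _ (p : _ ⟶ _) => Category.comp_id p
  map₂_comp α β := Profunctor.hom_ext fun _ _ (p : _ ⟶ _) => (Category.assoc p _ _).symm
  mapId X := Iso.refl _
  mapComp {X Y Z} F G := Profunctor.isoOfMaps
    (Profunctor.ofMaps (F := (F ≫ G).toFunctor.toProfunctor)
      (G := Profunctor.comp F.toFunctor.toProfunctor G.toFunctor.toProfunctor)
      (fun _ x p => Profunctor.Comp.mk (F := F.toFunctor.toProfunctor)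
        (G := G.toFunctor.toProfunctor) (y := F.toFunctor.obj x) p (𝟙 (F.toFunctor.obj x)))
      (fun f p => rfl)
      (fun g p => by
        refine (Profunctor.Comp.sound (F := F.toFunctor.toProfunctor)
          (G := G.toFunctor.toProfunctor) (F.toFunctor.map g) p (𝟙 _)).symm.trans ?_
        exact congrArg (Profunctor.Comp.mk (F := F.toFunctor.toProfunctor)
          (G := G.toFunctor.toProfunctor) p)
          ((Category.comp_id (F.toFunctor.map g)).trans (Category.id_comp _).symm)))
    (fun _ x => Profunctor.Comp.lift (fun _ (l : _ ⟶ _) (r : _ ⟶ _) => l ≫ G.toFunctor.map r)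
      (fun h (l : _ ⟶ _) (r : _ ⟶ _) => by
        refine (congrArg (l ≫ ·) (G.toFunctor.map_comp h r)).trans ?_
        exact (Category.assoc l _ _).symm))
    (fun {y x} (p : _ ⟶ _) => by
      refine (congrArg (p ≫ ·) (G.toFunctor.map_id (F.toFunctor.obj x))).trans ?_
      exact Category.comp_id p)
    (fun q => by
      induction q using Profunctor.Comp.ind with
      | h y l r =>
        refine (Profunctor.Comp.sound (F := F.toFunctor.toProfunctor)
          (G := G.toFunctor.toProfunctor) r l (𝟙 _)).symm.trans ?_
        exact congrArg (Profunctor.Comp.mk (F := F.toFunctor.toProfunctor)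
          (G := G.toFunctor.toProfunctor) l) (Category.comp_id r))
  map₂_whisker_left := by
    intro X Y Z F G H α
    rw [← Category.assoc, Iso.eq_comp_inv]
    refine Profunctor.hom_ext fun _ _ (p : _ ⟶ _) => ?_
    rfl
  map₂_whisker_right := by
    intro X Y Z F G α H
    rw [← Category.assoc, Iso.eq_comp_inv]
    refine Profunctor.hom_ext fun _ x (p : _ ⟶ _) => ?_
    refine (Profunctor.Comp.sound (F := G.toFunctor.toProfunctor)
          (G := H.toFunctor.toProfunctor) (α.toNatTrans.app x) p (𝟙 _)).symm.trans ?_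
    exact congrArg (Profunctor.Comp.mk (F := G.toFunctor.toProfunctor)
          (G := H.toFunctor.toProfunctor) p)
          ((Category.comp_id (α.toNatTrans.app x)).trans (Category.id_comp _).symm)
  map₂_associator := by
    intro W X Y Z F G H
    simp only [← Category.assoc]
    rw [Iso.eq_comp_inv, ← Bicategory.whiskerLeftIso_inv, Iso.eq_comp_inv]
    refine Profunctor.hom_ext fun _ x (p : _ ⟶ _) => ?_
    exact congrArg (fun t => Profunctor.Comp.mk (F := F.toFunctor.toProfunctor)
        (G := Profunctor.comp G.toFunctor.toProfunctor H.toFunctor.toProfunctor)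
        (Profunctor.Comp.mk (F := G.toFunctor.toProfunctor)
          (G := H.toFunctor.toProfunctor) t (𝟙 _)) (𝟙 (F.toFunctor.obj x))) (Category.comp_id p)
  map₂_left_unitor := by
    intro X Y F
    refine Profunctor.hom_ext fun _ x (p : _ ⟶ _) => ?_
    exact congrArg (p ≫ ·) (F.toFunctor.map_id x).symm
  map₂_right_unitor := by
    intro X Y F
    refine Profunctor.hom_ext fun _ _ (p : _ ⟶ _) => ?_
    rfl

namespace BorelCat

variable {Λ : ActionOperad.{u}} {X Y : Type u} [SmallCategory X] [SmallCategory Y]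

/-- For `F : X ⇸ Y`, words `b = [e; y₁, …, yₘ]` in `Y` and `a = [e; x₁, …, xₙ]` in `X`, the set
`∐_{g ∈ Λ(n)} ∏_i F(y_i, x_{π(g)(i)})` if `m = n`, and the empty set if `m ≠ n`. -/
abbrev ProfArr (F : Profunctor.{u} X Y) (b : BorelCat Λ Y) (a : BorelCat Λ X) : Type u :=
  Arr (fun (y : Y) (x : X) => Profunctor.El F y x) b a

/-- The contravariant action of `EΛ(Y)`. -/
def preArr {F : Profunctor.{u} X Y} {b b' : BorelCat Λ Y} {a : BorelCat Λ X} (f : b' ⟶ b)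
    (p : ProfArr F b a) : ProfArr F b' a :=
  Arr.comp (P := fun y y' : Y => y ⟶ y') (Q := fun y x => Profunctor.El F y x)
    (R := fun y x => Profunctor.El F y x) (fun _ _ _ f p => Profunctor.pre F f p) (toArr f) p

/-- The covariant action of `EΛ(X)`. -/
def postArr {F : Profunctor.{u} X Y} {b : BorelCat Λ Y} {a a' : BorelCat Λ X} (g : a ⟶ a')
    (p : ProfArr F b a) : ProfArr F b a' :=
  Arr.comp (P := fun y x => Profunctor.El F y x) (Q := fun x x' : X => x ⟶ x')
    (R := fun y x => Profunctor.El F y x) (fun _ _ _ p g => Profunctor.post F g p) p (toArr g)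

/-- The extension of `EΛ` to profunctors: for `F : X ⇸ Y`, words `b = [e; y₁, …, yₘ]` in `Y` and
`a = [e; x₁, …, xₙ]` in `X`, the set of elements is empty if `m ≠ n` and
`∐_{g ∈ Λ(n)} ∏_i F(y_i, x_{π(g)(i)})` if `m = n`. -/
def mapProf (Λ : ActionOperad.{u}) (F : Profunctor.{u} X Y) :
    Profunctor.{u} (BorelCat Λ X) (BorelCat Λ Y) :=
  Profunctor.ofActions (ProfArr F) preArr postArr
    (fun {b a} p => by
      refine (Twist.diag_comp (P := fun i j => b.letter i ⟶ b.letter j)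
        (Q := fun i j => Profunctor.El F (b.letter i) (a.letter j))
        (R := fun i j => Profunctor.El F (b.letter i) (a.letter j))
        (fun _ _ _ f p => Profunctor.pre F f p) _ p).trans ?_
      simp only [Profunctor.pre_id]
      rfl)
    (fun {b b' b'' a} f f' p => Twist.comp_assoc
      (P₁ := fun i j => b''.letter i ⟶ b'.letter j) (P₂ := fun i j => b'.letter i ⟶ b.letter j)
      (P₃ := fun i j => Profunctor.El F (b.letter i) (a.letter j))
      (Q₁ := fun i j => b''.letter i ⟶ b.letter j)
      (Q₂ := fun i j => Profunctor.El F (b'.letter i) (a.letter j))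
      (R := fun i j => Profunctor.El F (b''.letter i) (a.letter j))
      (fun _ _ _ f g => f ≫ g) (fun _ _ _ f p => Profunctor.pre F f p)
      (fun _ _ _ f p => Profunctor.pre F f p) (fun _ _ _ f p => Profunctor.pre F f p)
      (fun _ _ _ _ _ _ _ => Profunctor.pre_comp F _ _ _) (toArr f') (toArr f) p)
    (fun {b a} p => by
      refine (Twist.comp_diag (P := fun i j => Profunctor.El F (b.letter i) (a.letter j))
        (Q := fun i j => a.letter i ⟶ a.letter j)
        (R := fun i j => Profunctor.El F (b.letter i) (a.letter j))
        (fun _ _ _ p g => Profunctor.post F g p) _ p).trans ?_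
      simp only [Profunctor.post_id]
      rfl)
    (fun {b a a' a''} g g' p => (Twist.comp_assoc
      (P₁ := fun i j => Profunctor.El F (b.letter i) (a.letter j))
      (P₂ := fun i j => a.letter i ⟶ a'.letter j) (P₃ := fun i j => a'.letter i ⟶ a''.letter j)
      (Q₁ := fun i j => Profunctor.El F (b.letter i) (a'.letter j))
      (Q₂ := fun i j => a.letter i ⟶ a''.letter j)
      (R := fun i j => Profunctor.El F (b.letter i) (a''.letter j))
      (fun _ _ _ p g => Profunctor.post F g p) (fun _ _ _ p g => Profunctor.post F g p)
      (fun _ _ _ f g => f ≫ g) (fun _ _ _ p g => Profunctor.post F g p)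
      (fun _ _ _ _ _ _ _ => (Profunctor.post_comp F _ _ _).symm) p (toArr g) (toArr g')).symm)
    (fun {b b' a a'} f g p => Twist.comp_assoc
      (P₁ := fun i j => b'.letter i ⟶ b.letter j)
      (P₂ := fun i j => Profunctor.El F (b.letter i) (a.letter j))
      (P₃ := fun i j => a.letter i ⟶ a'.letter j)
      (Q₁ := fun i j => Profunctor.El F (b'.letter i) (a.letter j))
      (Q₂ := fun i j => Profunctor.El F (b.letter i) (a'.letter j))
      (R := fun i j => Profunctor.El F (b'.letter i) (a'.letter j))
      (fun _ _ _ f p => Profunctor.pre F f p) (fun _ _ _ p g => Profunctor.post F g p)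
      (fun _ _ _ p g => Profunctor.post F g p) (fun _ _ _ f p => Profunctor.pre F f p)
      (fun _ _ _ _ _ _ _ => Profunctor.post_pre F _ _ _) (toArr f) p (toArr g))

/-- The action on transformations, by the same formula. -/
def mapProf₂ (Λ : ActionOperad.{u}) {F G : Profunctor.{u} X Y} (α : F ⟶ G) :
    mapProf Λ F ⟶ mapProf Λ G :=
  Profunctor.ofMaps
    (fun b a (p : ProfArr F b a) => (Twist.map (fun _ _ q => Profunctor.ap α q) p : ProfArr G b a))
    (fun f p => Twist.ext' rfl fun _ _ _ _ => Profunctor.ap_pre α _ _)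
    (fun g p => Twist.ext' rfl fun _ _ _ _ => Profunctor.ap_post α _ _)

/-- `∅` for words of different lengths. -/
lemma mapProf_isEmpty (F : Profunctor.{u} X Y) {b : BorelCat Λ Y} {a : BorelCat Λ X}
    (h : b.len ≠ a.len) : IsEmpty (Profunctor.El (mapProf Λ F) b a) :=
  Twist.isEmpty_of_ne h fun i j => Profunctor.El F (b.letter i) (a.letter j)

/-- `∐_{g ∈ Λ(n)} ∏_i F(y_i, x_{π(g)(i)})` for words of the same length. -/
def mapProfEquiv (F : Profunctor.{u} X Y) {n : ℕ} (y : Fin n → Y) (x : Fin n → X) :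
    Profunctor.El (mapProf Λ F) ⟨n, y⟩ ⟨n, x⟩ ≃
      Σ g : Λ.gp n, ∀ i, Profunctor.El F (y i) (x (Λ.π n g i)) :=
  Twist.equivSigma fun i j => Profunctor.El F (y i) (x j)

end BorelCat

namespace ActionOperad

variable (Λ : ActionOperad.{u})

/-- The extension of `EΛ` to objects, 1-cells and 2-cells of `Prof`. -/
def tilde : PrelaxFunctor Prof.{u} Prof.{u} where
  obj X := ⟨Cat.of (BorelCat Λ X.cat)⟩
  map F := BorelCat.mapProf Λ F
  map₂ α := BorelCat.mapProf₂ Λ α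
  map₂_id _ := rfl
  map₂_comp _ _ := rfl

/-- `T̃(G⁺) = (EΛ G)⁺` for functors `G`. -/
lemma tilde_plus {X Y : Cat.{u, u}} (G : X ⟶ Y) :
    Λ.tilde.map (plus.map G) = plus.map (Λ.borel.T.map G) := rfl

end ActionOperad

section Pseudomonad

universe w₁ w₂ v₁ v₂ u₁ u₂

variable {B : Type u₁} [Bicategory.{w₁, v₁} B] {C : Type u₂} [Bicategory.{w₂, v₂} C]

/-- The data and axioms that turn given actions on objects, 1-cells and 2-cells into a
pseudofunctor. -/
structure PseudofunctorOn (P : PrelaxFunctor B C) where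
  mapId (a : B) : P.map (𝟙 a) ≅ 𝟙 (P.obj a)
  mapComp {a b c : B} (f : a ⟶ b) (g : b ⟶ c) : P.map (f ≫ g) ≅ P.map f ≫ P.map g
  map₂_whisker_left : ∀ {a b c : B} (f : a ⟶ b) {g h : b ⟶ c} (η : g ⟶ h),
    P.map₂ (f ◁ η) = (mapComp f g).hom ≫ P.map f ◁ P.map₂ η ≫ (mapComp f h).inv
  map₂_whisker_right : ∀ {a b c : B} {f g : a ⟶ b} (η : f ⟶ g) (h : b ⟶ c),
    P.map₂ (η ▷ h) = (mapComp f h).hom ≫ P.map₂ η ▷ P.map h ≫ (mapComp g h).inv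
  map₂_associator : ∀ {a b c d : B} (f : a ⟶ b) (g : b ⟶ c) (h : c ⟶ d),
    P.map₂ (α_ f g h).hom = (mapComp (f ≫ g) h).hom ≫ (mapComp f g).hom ▷ P.map h ≫
      (α_ (P.map f) (P.map g) (P.map h)).hom ≫ P.map f ◁ (mapComp g h).inv ≫
      (mapComp f (g ≫ h)).inv
  map₂_left_unitor : ∀ {a b : B} (f : a ⟶ b),
    P.map₂ (λ_ f).hom = (mapComp (𝟙 a) f).hom ≫ (mapId a).hom ▷ P.map f ≫ (λ_ (P.map f)).hom
  map₂_right_unitor : ∀ {a b : B} (f : a ⟶ b),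
    P.map₂ (ρ_ f).hom = (mapComp f (𝟙 b)).hom ≫ P.map f ◁ (mapId b).hom ≫ (ρ_ (P.map f)).hom

/-- The resulting pseudofunctor. -/
@[simps!]
def PseudofunctorOn.toPseudofunctor {P : PrelaxFunctor B C} (F : PseudofunctorOn P) : B ⥤ᵖ C where
  toPrelaxFunctor := P
  mapId := F.mapId
  mapComp := F.mapComp
  map₂_whisker_left := F.map₂_whisker_left
  map₂_whisker_right := F.map₂_whisker_right
  map₂_associator := F.map₂_associator
  map₂_left_unitor := F.map₂_left_unitor
  map₂_right_unitor := F.map₂_right_unitor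

/-- The data and axioms that turn given 1-cells into the components of a pseudonatural
transformation. -/
structure StrongTransOn (F G : B ⥤ᵖ C) (app : ∀ a, F.obj a ⟶ G.obj a) where
  naturality {a b : B} (f : a ⟶ b) : F.map f ≫ app b ≅ app a ≫ G.map f
  naturality_naturality : ∀ {a b : B} {f g : a ⟶ b} (η : f ⟶ g),
    F.map₂ η ▷ app b ≫ (naturality g).hom = (naturality f).hom ≫ app a ◁ G.map₂ η
  naturality_id : ∀ a : B, (naturality (𝟙 a)).hom ≫ app a ◁ (G.mapId a).hom =
    (F.mapId a).hom ▷ app a ≫ (λ_ (app a)).hom ≫ (ρ_ (app a)).inv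
  naturality_comp : ∀ {a b c : B} (f : a ⟶ b) (g : b ⟶ c),
    (naturality (f ≫ g)).hom ≫ app a ◁ (G.mapComp f g).hom =
      (F.mapComp f g).hom ▷ app c ≫ (α_ _ _ _).hom ≫ F.map f ◁ (naturality g).hom ≫
      (α_ _ _ _).inv ≫ (naturality f).hom ▷ G.map g ≫ (α_ _ _ _).hom

/-- The resulting pseudonatural transformation. -/
@[simps!]
def StrongTransOn.toStrongTrans {F G : B ⥤ᵖ C} {app : ∀ a, F.obj a ⟶ G.obj a}
    (s : StrongTransOn F G app) : Pseudofunctor.StrongTrans F G where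
  app := app
  naturality := s.naturality
  naturality_naturality := s.naturality_naturality
  naturality_id := s.naturality_id
  naturality_comp := s.naturality_comp

/-- Horizontal pasting of two squares. -/
def pasteSq {a₀ a₁ a₂ b₀ b₁ b₂ : B} {a : a₀ ⟶ a₁} {a' : a₁ ⟶ a₂} {b : b₀ ⟶ b₁} {b' : b₁ ⟶ b₂}
    {p : a₀ ⟶ b₀} {q : a₁ ⟶ b₁} {r : a₂ ⟶ b₂} (σ : p ≫ b ⟶ a ≫ q) (τ : q ≫ b' ⟶ a' ≫ r) :
    p ≫ b ≫ b' ⟶ (a ≫ a') ≫ r :=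
  (α_ p b b').inv ≫ σ ▷ b' ≫ (α_ a q b').hom ≫ a ◁ τ ≫ (α_ a a' r).inv

/-- The image of a square under a pseudofunctor. -/
def mapSq (T : B ⥤ᵖ C) {a₀ a₁ b₀ b₁ : B} {a : a₀ ⟶ a₁} {b : b₀ ⟶ b₁} {p : a₀ ⟶ b₀} {q : a₁ ⟶ b₁}
    (σ : p ≫ b ⟶ a ≫ q) : T.map p ≫ T.map b ⟶ T.map a ≫ T.map q :=
  (T.mapComp p b).inv ≫ T.map₂ σ ≫ (T.mapComp a q).hom

section

variable {T : B ⥤ᵖ B} (η : Pseudofunctor.StrongTrans (Pseudofunctor.id B) T)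
  (μ : Pseudofunctor.StrongTrans (T.comp T) T)

/-- The components of the unit. -/
abbrev unitApp (X : B) : X ⟶ T.obj X := η.app X

/-- The naturality squares of the unit. -/
abbrev unitNat {X Y : B} (f : X ⟶ Y) : f ≫ unitApp η Y ≅ unitApp η X ≫ T.map f := η.naturality f

/-- The components of the multiplication. -/
abbrev multApp (X : B) : T.obj (T.obj X) ⟶ T.obj X := μ.app X

/-- The naturality squares of the multiplication. -/
abbrev multNat {X Y : B} (f : X ⟶ Y) :
    T.map (T.map f) ≫ multApp μ Y ≅ multApp μ X ≫ T.map f := μ.naturality f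

/-- Given a pseudofunctor `T` and pseudonatural transformations `η : 1 ⟶ T` and `μ : T T ⟶ T`, the
data and axioms that make them into a pseudomonad: invertible modifications
`assoc : μ ∘ T μ ≅ μ ∘ μ T`, `left : μ ∘ η T ≅ 1` and `right : μ ∘ T η ≅ 1`, subject to the two
coherence axioms. -/
structure PseudomonadOn where
  assoc (X : B) : T.map (multApp μ X) ≫ multApp μ X ≅ multApp μ (T.obj X) ≫ multApp μ X
  left (X : B) : unitApp η (T.obj X) ≫ multApp μ X ≅ 𝟙 (T.obj X)
  right (X : B) : T.map (unitApp η X) ≫ multApp μ X ≅ 𝟙 (T.obj X)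
  assoc_naturality : ∀ {X Y : B} (f : X ⟶ Y),
    T.map (T.map (T.map f)) ◁ (assoc Y).hom ≫
        pasteSq (multNat μ (T.map f)).hom (multNat μ f).hom =
      pasteSq (mapSq T (multNat μ f).hom) (multNat μ f).hom ≫ (assoc X).hom ▷ T.map f
  left_naturality : ∀ {X Y : B} (f : X ⟶ Y),
    T.map f ◁ (left Y).hom ≫ (ρ_ (T.map f)).hom ≫ (λ_ (T.map f)).inv =
      pasteSq (unitNat η (T.map f)).hom (multNat μ f).hom ≫ (left X).hom ▷ T.map f
  right_naturality : ∀ {X Y : B} (f : X ⟶ Y),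
    T.map f ◁ (right Y).hom ≫ (ρ_ (T.map f)).hom ≫ (λ_ (T.map f)).inv =
      pasteSq (mapSq T (unitNat η f).hom) (multNat μ f).hom ≫ (right X).hom ▷ T.map f
  /-- the two 2-cells `μ ∘ T μ ∘ T η T ⟶ μ` agree -/
  unit_coherence : ∀ X : B,
    T.map (unitApp η (T.obj X)) ◁ (assoc X).hom ≫ (α_ _ _ _).inv ≫
        (right (T.obj X)).hom ▷ multApp μ X ≫ (λ_ (multApp μ X)).hom =
      (α_ _ _ _).inv ≫ ((T.mapComp (unitApp η (T.obj X)) (multApp μ X)).inv ≫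
        T.map₂ (left X).hom ≫ (T.mapId (T.obj X)).hom) ▷ multApp μ X ≫ (λ_ (multApp μ X)).hom
  /-- the two 2-cells `μ ∘ T μ ∘ T T μ ⟶ μ ∘ μ T ∘ μ T T` agree -/
  assoc_coherence : ∀ X : B,
    T.map (T.map (multApp μ X)) ◁ (assoc X).hom ≫ (α_ _ _ _).inv ≫
        (multNat μ (multApp μ X)).hom ▷ multApp μ X ≫ (α_ _ _ _).hom ≫
        multApp μ (T.obj (T.obj X)) ◁ (assoc X).hom ≫ (α_ _ _ _).inv =
      (α_ _ _ _).inv ≫ ((T.mapComp (T.map (multApp μ X)) (multApp μ X)).inv ≫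
          T.map₂ (assoc X).hom ≫
          (T.mapComp (multApp μ (T.obj X)) (multApp μ X)).hom) ▷ multApp μ X ≫
        (α_ _ _ _).hom ≫ T.map (multApp μ (T.obj X)) ◁ (assoc X).hom ≫ (α_ _ _ _).inv ≫
        (assoc (T.obj X)).hom ▷ multApp μ X

end

end Pseudomonad

namespace ActionOperad

variable (Λ : ActionOperad.{u})

/-- The equality `T̃(G⁺) = (EΛ G)⁺`, as an invertible 2-cell. -/
def plusIso {X Y : Cat.{u, u}} (G : X ⟶ Y) :
    Λ.tilde.map (plus.map G) ≅ plus.map (Λ.borel.T.map G) :=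
  eqToIso (Λ.tilde_plus G)

/-- The 1-cells `η⁺`. -/
def tildeUnit (X : Prof.{u}) : X ⟶ Λ.tilde.obj X := plus.map (Λ.borel.unit X.cat)

/-- The 1-cells `μ⁺`. -/
def tildeMult (X : Prof.{u}) : Λ.tilde.obj (Λ.tilde.obj X) ⟶ Λ.tilde.obj X :=
  plus.map (Λ.borel.mult X.cat)

variable {Λ}

/-- The 2-cell `F⁺ ≫ G⁺ ⟶ H⁺ ≫ K⁺` obtained from an equality `F ≫ G = H ≫ K` of functors and the
pseudofunctoriality of `(-)⁺`. -/
def plusSq {X Y Y' Z : Cat.{u, u}} {F : X ⟶ Y} {G : Y ⟶ Z} {H : X ⟶ Y'} {K : Y' ⟶ Z}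
    (h : F ≫ G = H ≫ K) : plus.map F ≫ plus.map G ⟶ plus.map H ≫ plus.map K :=
  (plus.mapComp F G).inv ≫ plus.map₂ (eqToHom h) ≫ (plus.mapComp H K).hom

/-- The 2-cell `F⁺ ≫ G⁺ ⟶ 1` obtained from an equality `F ≫ G = 1` of functors and the
pseudofunctoriality of `(-)⁺`. -/
def plusTri {X Y : Cat.{u, u}} {F : X ⟶ Y} {G : Y ⟶ X} (h : F ≫ G = 𝟙 X) :
    plus.map F ≫ plus.map G ⟶ 𝟙 (plus.obj X) :=
  (plus.mapComp F G).inv ≫ plus.map₂ (eqToHom h) ≫ (plus.mapId X).hom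

/-- A pseudomonad structure on the extension of `EΛ` to `Prof`, with unit `η⁺` and multiplication
`μ⁺`, lifts the 2-monad `EΛ` along `(-)⁺ : Cat ⥤ Prof` if all its structure 2-cells restrict along
`(-)⁺` to those induced by the 2-monad and the pseudofunctoriality of `(-)⁺`. -/
structure IsLift (c : PseudofunctorOn Λ.tilde)
    (η : StrongTransOn (Pseudofunctor.id Prof.{u}) c.toPseudofunctor Λ.tildeUnit)
    (μ : StrongTransOn (c.toPseudofunctor.comp c.toPseudofunctor) c.toPseudofunctor Λ.tildeMult)
    (M : PseudomonadOn η.toStrongTrans μ.toStrongTrans) : Prop where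
  map₂ : ∀ {X Y : Cat.{u, u}} {F G : X ⟶ Y} (α : F ⟶ G),
    Λ.tilde.map₂ (plus.map₂ α) ≫ (Λ.plusIso G).hom =
      (Λ.plusIso F).hom ≫ plus.map₂ (Λ.borel.T.map₂ α)
  mapId : ∀ X : Cat.{u, u},
    Λ.tilde.map₂ (plus.mapId X).hom ≫ (c.mapId (plus.obj X)).hom =
      (Λ.plusIso (𝟙 X)).hom ≫ plus.map₂ (Λ.borel.T.mapId X).hom ≫
        (plus.mapId (Λ.borel.T.obj X)).hom
  mapComp : ∀ {X Y Z : Cat.{u, u}} (F : X ⟶ Y) (G : Y ⟶ Z),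
    Λ.tilde.map₂ (plus.mapComp F G).hom ≫ (c.mapComp (plus.map F) (plus.map G)).hom ≫
        (Λ.plusIso F).hom ▷ Λ.tilde.map (plus.map G) ≫
        plus.map (Λ.borel.T.map F) ◁ (Λ.plusIso G).hom =
      (Λ.plusIso (F ≫ G)).hom ≫ plus.map₂ (Λ.borel.T.mapComp F G).hom ≫
        (plus.mapComp (Λ.borel.T.map F) (Λ.borel.T.map G)).hom
  unit : ∀ {X Y : Cat.{u, u}} (G : X ⟶ Y),
    (η.naturality (plus.map G)).hom ≫ plus.map (Λ.borel.unit X) ◁ (Λ.plusIso G).hom =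
      plusSq (Λ.borel.unit_naturality G)
  mult : ∀ {X Y : Cat.{u, u}} (G : X ⟶ Y),
    (μ.naturality (plus.map G)).hom ≫ plus.map (Λ.borel.mult X) ◁ (Λ.plusIso G).hom =
      (Λ.tilde.map₂ (Λ.plusIso G).hom ≫ (Λ.plusIso (Λ.borel.T.map G)).hom) ▷
        plus.map (Λ.borel.mult Y) ≫ plusSq (Λ.borel.mult_naturality G)
  assoc : ∀ X : Cat.{u, u},
    (M.assoc (plus.obj X)).hom =
      (Λ.plusIso (Λ.borel.mult X)).hom ▷ plus.map (Λ.borel.mult X) ≫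
        plusSq (Λ.borel.map_mult_mult X)
  left : ∀ X : Cat.{u, u}, (M.left (plus.obj X)).hom = plusTri (Λ.borel.unit_mult X)
  right : ∀ X : Cat.{u, u},
    (M.right (plus.obj X)).hom =
      (Λ.plusIso (Λ.borel.unit X)).hom ▷ plus.map (Λ.borel.mult X) ≫
        plusTri (Λ.borel.map_unit_mult X)

end ActionOperad

/-!
Write `T̃` for the extension of `T = EΛ` to `Prof`.  An element of a composite profunctor is a
class of pairs (`Comp.mk`), a 2-cell of `Prof` is a family of functions on elements, and all
structure 2-cells of `T̃` are described by what they do to such pairs.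

Three families of 2-cells have to be constructed, and in each case only one direction has an
evident formula: `T̃G ∘ T̃F ⟶ T̃(G ∘ F)` multiplies group elements and pairs components
(`mapCompInv`), while `η⁺ ∘ F ⟶ T̃F ∘ η⁺` and `μ⁺ ∘ T̃T̃F ⟶ T̃F ∘ μ⁺` apply the unit and the
multiplication of `T` to elements of profunctors (`unitSq`, `multSq`).  Each of them is bijective on
elements (`mapCompInv_bijective`, `unitSq_bijective`, `multSq_bijective`).  The reason is the same
in all cases: since `Λ` acts through permutations of the letters of a word, every class has a
representative in which one of the two components has trivial group element, and two such
representatives with the same image are related letter by letter.  By the co-Yoneda lemma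
(`mk_id_bijective`) the targets of the last two families are `T̃F(-, η -)` and `T̃F(-, μ -)`.

The axioms of a pseudofunctor and of a pseudonatural transformation are then checked on pairs,
where they follow from the associativity of the composition of twisted families
(`Twist.comp_assoc`) and its compatibility with the multiplication (`multArr_pairArr`).

The modifications are `plusSq` and `plusTri` of the monad laws of `T`.  Their naturality says that
the monad laws hold for elements of profunctors, and not only for morphisms.  An element of a
profunctor `F : X ⇸ Y` is a morphism of the collage of `F`, a category containing `X` and `Y`,
and `T` takes the collage to a category in which the elements of `T̃F` are morphisms of words;
so these laws are instances of the monad laws of `T` at the collage (`multArr_unitArr`,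
`multArr_mapUnitArr`, `multArr_mapMultArr`).  In the two coherence axioms all 1-cells come from
functors and all 2-cells from equalities of functors, so that both sides are given by the same
`eqToHom` (`plus_unit_coherence`, `plus_assoc_coherence`).  For the compatibility with `(-)⁺` it
suffices, again by the co-Yoneda lemma, to compare 2-cells on pairs of identities (`plusSq_eq`).
-/

/-! ### Finite families of quotient classes -/

/-- A function on a finite product that is invariant under reflexive relations on the factors
only depends on the classes of the components in the quotients: the components can be
changed one at a time. -/
lemma Quot.eq_of_forall_mk_eq {ι : Type*} [Finite ι] {A : ι → Type*} {r : ∀ i, A i → A i → Prop}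
    (hr : ∀ i a, r i a a) {S : Type*} (Φ : (∀ i, A i) → S)
    (hΦ : ∀ p q, (∀ i, r i (p i) (q i)) → Φ p = Φ q) {p q : ∀ i, A i}
    (h : ∀ i, Quot.mk (r i) (p i) = Quot.mk (r i) (q i)) : Φ p = Φ q := by
  classical
  cases nonempty_fintype ι
  have step : ∀ (i : ι) (a b : A i) (_ : Relation.EqvGen (r i) a b) (x : ∀ i, A i),
      Φ (Function.update x i a) = Φ (Function.update x i b) := by
    intro i a b e x
    induction e with
    | rel a b e =>
      refine hΦ _ _ fun j => ?_
      by_cases hj : j = i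
      · subst hj
        simpa using e
      · simpa [hj] using hr j (x j)
    | refl => rfl
    | symm a b _ e => exact e.symm
    | trans a b c _ _ e e' => exact e.trans e'
  have main : ∀ s : Finset ι, Φ (s.piecewise q p) = Φ p := by
    intro s
    induction s using Finset.induction_on with
    | empty => simp
    | insert i s hi ih =>
      rw [Finset.piecewise_insert, ← ih, ← step i _ _ (Quot.eqvGen_exact (h i))]
      congr 1
      rw [Function.update_eq_self_iff]
      simp [hi]
  simpa using (main Finset.univ).symm

namespace Twist

variable {Λ : ActionOperad.{u}} {l m n : ℕ}

/-- Two elements agree if their group elements do and the components at `(i, π(g)(i))` do. -/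
lemma ext_tgt {P : Fin m → Fin n → Type u} {s t : Twist Λ P} (hg : s.g = t.g)
    (hf : ∀ i h, s.f i (s.tgt i) rfl = t.f i (s.tgt i) h) : s = t := by
  refine ext' hg fun i j h h' => ?_
  obtain rfl : j = s.tgt i := Fin.ext h
  exact hf i h'

/-- Elements with trivial group element are determined by their diagonal components. -/
lemma ext_diag {P : Fin n → Fin n → Type u} {s t : Twist Λ P} (hs : s.g = 1) (ht : t.g = 1)
    (hf : ∀ i h h', s.f i i h = t.f i i h') : s = t := by
  refine ext' (hs.trans ht.symm) fun i j h h' => ?_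
  obtain rfl : j = i := Fin.ext (by simpa [hs] using h)
  exact hf _ _ _

/-- The element of `∐_{g ∈ Λ(n)} ∏_i P i (π(g)(i))` given by a group element and components. -/
def ofSigma {P : Fin n → Fin n → Type u} (g : Λ.gp n) (f : ∀ i, P i (Λ.π n g i)) : Twist Λ P :=
  (equivSigma P).symm ⟨g, f⟩

lemma ofSigma_self {P : Fin n → Fin n → Type u} (t : Twist Λ P) :
    ofSigma t.g (fun i => t.f i _ rfl) = t :=
  (equivSigma P).symm_apply_apply t

lemma ofSigma_injective {P : Fin n → Fin n → Type u} {g g' : Λ.gp n}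
    {f : ∀ i, P i (Λ.π n g i)} {f' : ∀ i, P i (Λ.π n g' i)}
    (h : ofSigma (P := P) g f = ofSigma g' f') :
    (⟨g, f⟩ : Σ g : Λ.gp n, ∀ i, P i (Λ.π n g i)) = ⟨g', f'⟩ :=
  (equivSigma P).symm.injective h

end Twist

namespace Profunctor

variable {C D : Type u} [SmallCategory C] [SmallCategory D]

/-- A transformation all of whose components are bijections is invertible. -/
noncomputable def isoOfBijective {F G : Profunctor.{u} C D} (α : F ⟶ G)
    (h : ∀ y x, Function.Bijective (fun p : El F y x => ap α p)) : F ≅ G :=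
  isoOfMaps α (fun y x => (Equiv.ofBijective _ (h y x)).symm)
    (fun p => (Equiv.ofBijective _ (h _ _)).symm_apply_apply p)
    (fun q => (Equiv.ofBijective _ (h _ _)).apply_symm_apply q)

end Profunctor

/-! ### The comparison of `T̃(G ∘ F)` with `T̃ G ∘ T̃ F` -/

namespace BorelCat

open Profunctor

variable {Λ : ActionOperad.{u}} {X Y Z : Type u} [SmallCategory X] [SmallCategory Y]
  [SmallCategory Z]

/-- The map `T̃G(c, b) × T̃F(b, a) → T̃(G ∘ F)(c, a)` which multiplies group elements and pairs
components. -/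
abbrev pairArr {F : Profunctor.{u} X Y} {G : Profunctor.{u} Y Z} {c : BorelCat Λ Z}
    {b : BorelCat Λ Y} {a : BorelCat Λ X} (l : ProfArr G c b) (r : ProfArr F b a) :
    ProfArr (comp F G) c a :=
  Arr.comp (P := fun z y => El G z y) (Q := fun y x => El F y x)
    (R := fun z x => El (comp F G) z x) (fun _ _ _ l r => Comp.mk l r) l r

variable (Λ) in
/-- The transformation `T̃G ∘ T̃F ⟶ T̃(G ∘ F)`. -/
def mapCompInv (F : Profunctor.{u} X Y) (G : Profunctor.{u} Y Z) :
    comp (mapProf Λ F) (mapProf Λ G) ⟶ mapProf Λ (comp F G) :=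
  ofMaps (fun c a => Comp.lift (fun b (l : ProfArr G c b) (r : ProfArr F b a) => pairArr l r)
      (fun {b b'} f l r => by
        refine (Twist.comp_assoc (P₁ := fun i j => El G (c.letter i) (b.letter j))
          (P₂ := fun i j => b.letter i ⟶ b'.letter j)
          (P₃ := fun i j => El F (b'.letter i) (a.letter j))
          (Q₁ := fun i j => El G (c.letter i) (b'.letter j))
          (Q₂ := fun i j => El F (b.letter i) (a.letter j))
          (R := fun i j => El (comp F G) (c.letter i) (a.letter j))
          (fun _ _ _ l f => post G f l) (fun _ _ _ l r => Comp.mk l r)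
          (fun _ _ _ f r => pre F f r) (fun _ _ _ l r => Comp.mk l r)
          (fun _ _ _ _ l f r => (Comp.sound f l r).symm) l (toArr f) r).symm))
    (fun {c c' a} f p => by
      induction p using Comp.ind with | h b l r =>
      exact Twist.comp_assoc (P₁ := fun i j => c'.letter i ⟶ c.letter j)
        (P₂ := fun i j => El G (c.letter i) (b.letter j))
        (P₃ := fun i j => El F (b.letter i) (a.letter j))
        (Q₁ := fun i j => El G (c'.letter i) (b.letter j))
        (Q₂ := fun i j => El (comp F G) (c.letter i) (a.letter j))
        (R := fun i j => El (comp F G) (c'.letter i) (a.letter j))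
        (fun _ _ _ f l => pre G f l) (fun _ _ _ l r => Comp.mk l r)
        (fun _ _ _ l r => Comp.mk l r) (fun _ _ _ f r => pre (comp F G) f r)
        (fun _ _ _ _ _ _ _ => rfl) (toArr f) l r)
    (fun {c a a'} f p => by
      induction p using Comp.ind with | h b l r =>
      exact (Twist.comp_assoc (P₁ := fun i j => El G (c.letter i) (b.letter j))
        (P₂ := fun i j => El F (b.letter i) (a.letter j))
        (P₃ := fun i j => a.letter i ⟶ a'.letter j)
        (Q₁ := fun i j => El (comp F G) (c.letter i) (a.letter j))
        (Q₂ := fun i j => El F (b.letter i) (a'.letter j))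
        (R := fun i j => El (comp F G) (c.letter i) (a'.letter j))
        (fun _ _ _ l r => Comp.mk l r) (fun _ _ _ r f => post (comp F G) f r)
        (fun _ _ _ r f => post F f r) (fun _ _ _ l r => Comp.mk l r)
        (fun _ _ _ _ _ _ _ => rfl) l r (toArr f)).symm)

section

variable {n : ℕ} {z : Fin n → Z} {x : Fin n → X}

/-- The class in `(T̃G ∘ T̃F)([e; z], [e; x])` of a group element `g` and of pairs in
`∐_y G(z_i, y) × F(y, x_{π(g)(i)})`: the left component has trivial group element. -/
def compNormal (F : Profunctor.{u} X Y) (G : Profunctor.{u} Y Z)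
    (g : Λ.gp n) (p : ∀ i, CompPre F G (z i) (x (Λ.π n g i))) :
    El (comp (mapProf Λ F) (mapProf Λ G)) ⟨n, z⟩ ⟨n, x⟩ :=
  Comp.mk (F := mapProf Λ F) (G := mapProf Λ G) (y := ⟨n, fun i => (p i).mid⟩)
    (Twist.diag (P := fun i j => El G (z i) (p j).mid) fun i => (p i).left)
    (Twist.ofSigma (P := fun i j => El F (p i).mid (x j)) g fun i => (p i).right)

lemma mapCompInv_compNormal (F : Profunctor.{u} X Y) (G : Profunctor.{u} Y Z)
    (g : Λ.gp n) (p : ∀ i, CompPre F G (z i) (x (Λ.π n g i))) :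
    ap (mapCompInv Λ F G) (compNormal F G g p) =
      Twist.ofSigma (P := fun i j => El (comp F G) (z i) (x j)) g
        fun i => Quot.mk _ (p i) := by
  refine (Twist.diag_comp (P := fun i j => El G (z i) (p j).mid)
    (Q := fun i j => El F (p i).mid (x j)) (R := fun i j => El (comp F G) (z i) (x j))
    (fun _ _ _ l r => Comp.mk l r) _ _).trans ?_
  refine Twist.ext_tgt rfl fun i h => ?_
  rfl

lemma compNormal_congr (F : Profunctor.{u} X Y) (G : Profunctor.{u} Y Z)
    (g : Λ.gp n) {p q : ∀ i, CompPre F G (z i) (x (Λ.π n g i))}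
    (h : ∀ i, CompPre.Rel F G _ _ (p i) (q i)) :
    compNormal F G g p = compNormal F G g q := by
  choose f h₁ h₂ using h
  have e₁ : Twist.diag (P := fun i j => El G (z i) (q j).mid) (fun i => (q i).left) =
      post (mapProf Λ G) (y := ⟨n, z⟩) (diagHom f)
        (Twist.diag (P := fun i j => El G (z i) (p j).mid) fun i => (p i).left) := by
    refine Eq.trans ?_ (Twist.diag_comp (P := fun i j => El G (z i) (p j).mid)
      (Q := fun i j => (p i).mid ⟶ (q j).mid) (R := fun i j => El G (z i) (q j).mid)
      (fun _ _ _ l f => post G f l) _ _).symm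
    exact Twist.ext_diag rfl rfl fun i _ _ => h₁ i
  have e₂ : Twist.ofSigma (P := fun i j => El F (p i).mid (x j)) g (fun i => (p i).right) =
      pre (mapProf Λ F) (x := ⟨n, x⟩) (diagHom f)
        (Twist.ofSigma (P := fun i j => El F (q i).mid (x j)) g fun i => (q i).right) := by
    refine Eq.trans ?_ (Twist.diag_comp (P := fun i j => (p i).mid ⟶ (q j).mid)
      (Q := fun i j => El F (q i).mid (x j)) (R := fun i j => El F (p i).mid (x j))
      (fun _ _ _ f r => pre F f r) _ _).symm
    exact Twist.ext_tgt rfl fun i _ => h₂ i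
  unfold compNormal
  rw [e₁, e₂]
  exact Comp.sound (F := mapProf Λ F) (G := mapProf Λ G) _ _ _

lemma exists_eq_compNormal (F : Profunctor.{u} X Y) (G : Profunctor.{u} Y Z)
    (q : El (comp (mapProf Λ F) (mapProf Λ G)) ⟨n, z⟩ ⟨n, x⟩) :
    ∃ g p, q = compNormal F G g p := by
  induction q using Comp.ind with | h b l r =>
  obtain ⟨m, y⟩ := b
  have e : n = m := Twist.len l
  subst e
  -- Move the group element of `l` across the tensor sign, by a rearrangement `σ` of the word `y`.
  let σ : (⟨n, fun i => y (Λ.π n (Twist.g l) i)⟩ : BorelCat Λ Y) ⟶ ⟨n, y⟩ :=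
    Twist.ofSigma (P := fun i j => y (Λ.π n (Twist.g l) i) ⟶ y j) (Twist.g l) fun _ => 𝟙 _
  let l' : ProfArr (Λ := Λ) G ⟨n, z⟩ ⟨n, fun i => y (Λ.π n (Twist.g l) i)⟩ :=
    Twist.diag (P := fun i j => El G (z i) (y (Λ.π n (Twist.g l) j)))
      fun i => Twist.f l i _ rfl
  have e : l = post (mapProf Λ G) σ l' := by
    refine Eq.trans ?_ (Twist.diag_comp
      (P := fun i j => El G (z i) (y (Λ.π n (Twist.g l) j)))
      (Q := fun i j => y (Λ.π n (Twist.g l) i) ⟶ y j) (R := fun i j => El G (z i) (y j))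
      (fun _ _ _ l f => post G f l) _ _).symm
    exact Twist.ext_tgt rfl fun i _ => (post_id G _).symm
  refine ⟨Twist.g (pre (mapProf Λ F) σ r), fun i =>
    ⟨y (Λ.π n (Twist.g l) i), Twist.f l i _ rfl, Twist.f (pre (mapProf Λ F) σ r) i _ rfl⟩, ?_⟩
  refine (congrArg (fun t => Comp.mk (F := mapProf Λ F) (G := mapProf Λ G) t r) e).trans ?_
  refine (Comp.sound (F := mapProf Λ F) (G := mapProf Λ G) σ l' r).symm.trans ?_
  exact congrArg (Comp.mk (F := mapProf Λ F) (G := mapProf Λ G) l')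
    (Twist.ofSigma_self (pre (mapProf Λ F) σ r)).symm

end

lemma mapCompInv_bijective (F : Profunctor.{u} X Y) (G : Profunctor.{u} Y Z) (c : BorelCat Λ Z)
    (a : BorelCat Λ X) : Function.Bijective
      (fun p : El (comp (mapProf Λ F) (mapProf Λ G)) c a => ap (mapCompInv Λ F G) p) := by
  obtain ⟨n, z⟩ := c
  obtain ⟨n', x⟩ := a
  constructor
  · intro p q h
    obtain rfl : n = n' := by
      induction p using Comp.ind with | h b l r =>
      exact (Twist.len l).trans (Twist.len r)
    obtain ⟨g, p, rfl⟩ := exists_eq_compNormal F G p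
    obtain ⟨g', q, rfl⟩ := exists_eq_compNormal F G q
    replace h : ap (mapCompInv Λ F G) (compNormal F G g p) =
      ap (mapCompInv Λ F G) (compNormal F G g' q) := h
    rw [mapCompInv_compNormal, mapCompInv_compNormal] at h
    replace h := Twist.ofSigma_injective h
    obtain rfl : g = g' := congrArg Sigma.fst h
    -- Equal images have equal classes in each component, which are connected by zigzags; these are
    -- combined one component at a time.
    refine Quot.eq_of_forall_mk_eq (r := fun i => CompPre.Rel F G (z i) (x (Λ.π n g i)))
      (fun i a => ⟨𝟙 _, (post_id G _).symm, (pre_id F _).symm⟩) (compNormal F G g)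
      (fun p q h => compNormal_congr F G g h) fun i => ?_
    exact congrFun (eq_of_heq (Sigma.mk.inj h).2) i
  · intro t
    obtain rfl : n = n' := Twist.len t
    have h : ∀ i, ∃ p, Quot.mk (CompPre.Rel F G (z i) (x (Λ.π n (Twist.g t) i))) p =
        Twist.f t i _ rfl := fun i => Quot.exists_rep _
    choose p hp using h
    refine ⟨compNormal F G (Twist.g t) p, (mapCompInv_compNormal F G (Twist.g t) p).trans ?_⟩
    simp only [hp]
    exact Twist.ofSigma_self (P := fun i j => El (comp F G) (z i) (x j)) t

variable (Λ) in
/-- The comparison `T̃(G ∘ F) ≅ T̃G ∘ T̃F`. -/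
noncomputable def mapCompIso (F : Profunctor.{u} X Y) (G : Profunctor.{u} Y Z) :
    mapProf Λ (comp F G) ≅ comp (mapProf Λ F) (mapProf Λ G) :=
  (isoOfBijective (mapCompInv Λ F G) (mapCompInv_bijective F G)).symm

end BorelCat

/-! ### Composites with representable profunctors -/

namespace Profunctor

variable {B C D : Type u} [SmallCategory B] [SmallCategory C] [SmallCategory D]

lemma mk_toProfunctor (H : B ⥤ C) (K : Profunctor.{u} C D) {z : D} {x : B} {y : C} (k : El K z y)
    (r : y ⟶ H.obj x) : Comp.mk (F := H.toProfunctor) k r =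
      Comp.mk (F := H.toProfunctor) (post K r k) (𝟙 (H.obj x)) := by
  refine Eq.trans ?_ (Comp.sound (F := H.toProfunctor) r k (𝟙 (H.obj x)))
  exact congrArg (Comp.mk (F := H.toProfunctor) k) (Category.comp_id r).symm

/-- By the co-Yoneda lemma, `(K ∘ H⁺)(z, x)` is `K(z, H x)`. -/
lemma mk_id_bijective (H : B ⥤ C) (K : Profunctor.{u} C D) (z : D) (x : B) :
    Function.Bijective (fun k : El K z (H.obj x) =>
      Comp.mk (F := H.toProfunctor) k (𝟙 (H.obj x))) := by
  constructor
  · intro k k' h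
    have := congrArg (Comp.lift (F := H.toProfunctor) (G := K) (T := El K z (H.obj x))
      (fun _ k (r : _ ⟶ _) => post K r k) fun f k r => post_comp K f r k) h
    exact ((post_id K k).symm.trans this).trans (post_id K k')
  · intro q
    induction q using Comp.ind with | h y k r =>
    exact ⟨post K r k, (mk_toProfunctor H K k r).symm⟩

/-- A transformation `F ⟶ K ∘ H⁺` from a natural family of maps `F(z, x) → K(z, H x)`. -/
def toCompPlus {F : Profunctor.{u} B D} (H : B ⥤ C) (K : Profunctor.{u} C D)
    (a : ∀ z x, El F z x → El K z (H.obj x))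
    (a_pre : ∀ {z z' x} (f : z' ⟶ z) (p : El F z x), a z' x (pre F f p) = pre K f (a z x p))
    (a_post : ∀ {z x x'} (g : x ⟶ x') (p : El F z x),
      a z x' (post F g p) = post K (H.map g) (a z x p)) :
    F ⟶ comp H.toProfunctor K :=
  ofMaps (fun z x p => Comp.mk (F := H.toProfunctor) (a z x p) (𝟙 (H.obj x)))
    (fun f p => congrArg (Comp.mk (F := H.toProfunctor) · (𝟙 _)) (a_pre f p))
    (fun {z x x'} g p => by
      refine (congrArg (Comp.mk (F := H.toProfunctor) · (𝟙 _)) (a_post g p)).trans ?_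
      refine (mk_toProfunctor H K (a z x p) (H.map g)).symm.trans ?_
      exact congrArg (Comp.mk (F := H.toProfunctor) (a z x p)) (Category.id_comp (H.map g)).symm)

end Profunctor

/-! ### Words and their rearrangements -/

/-- A family indexed by `Fin (∑ i, k i)` is a family of families indexed by the `Fin (k i)`. -/
lemma exists_curry {n : ℕ} {k : Fin n → ℕ} {P : ∀ i, Fin (k i) → Sort*}
    (f : ∀ l : Fin (∑ i, k i), P (finSigmaFinEquiv.symm l).1 (finSigmaFinEquiv.symm l).2) :
    ∃ g : ∀ i j, P i j, f = fun l => g (finSigmaFinEquiv.symm l).1 (finSigmaFinEquiv.symm l).2 := by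
  obtain ⟨g, rfl⟩ := (Equiv.piCongrLeft' (fun s : (i : Fin n) × Fin (k i) => P s.1 s.2)
    finSigmaFinEquiv).surjective f
  exact ⟨fun i j => g ⟨i, j⟩, rfl⟩

lemma forall_of_forall_finSigma {n : ℕ} {k : Fin n → ℕ} {P : ∀ i, Fin (k i) → Prop}
    (h : ∀ l : Fin (∑ i, k i), P (finSigmaFinEquiv.symm l).1 (finSigmaFinEquiv.symm l).2)
    (i : Fin n) (j : Fin (k i)) : P i j :=
  (finSigmaFinEquiv.symm.surjective.forall
    (p := fun s : (i : Fin n) × Fin (k i) => P s.1 s.2)).2 h ⟨i, j⟩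

namespace BorelCat

open Profunctor

variable {Λ : ActionOperad.{u}} {X Y Z : Type u} [SmallCategory X] [SmallCategory Y]
  [SmallCategory Z]

/-- The elements of `T̃F([e; y], [e; x])` with trivial group element. -/
def diagArr (F : Profunctor.{u} X Y) {n : ℕ} {y : Fin n → Y} {x : Fin n → X}
    (p : ∀ i, El F (y i) (x i)) : El (mapProf Λ F) ⟨n, y⟩ ⟨n, x⟩ :=
  Twist.diag (P := fun i j => El F (y i) (x j)) p

lemma pre_diagArr (F : Profunctor.{u} X Y) {n : ℕ} {y y' : Fin n → Y} {x : Fin n → X}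
    (f : ∀ i, y' i ⟶ y i) (p : ∀ i, El F (y i) (x i)) :
    pre (mapProf Λ F) (diagHom f) (diagArr F p) = diagArr F fun i => pre F (f i) (p i) := by
  refine (Twist.diag_comp (P := fun i j => y' i ⟶ y j) (Q := fun i j => El F (y i) (x j))
    (R := fun i j => El F (y' i) (x j)) (fun _ _ _ f r => pre F f r) _ _).trans ?_
  exact Twist.ext_diag rfl rfl fun i _ _ => rfl

lemma post_diagArr (F : Profunctor.{u} X Y) {n : ℕ} {y : Fin n → Y} {x x' : Fin n → X}
    (f : ∀ i, x i ⟶ x' i) (p : ∀ i, El F (y i) (x i)) :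
    post (mapProf Λ F) (diagHom f) (diagArr F p) = diagArr F fun i => post F (f i) (p i) := by
  refine (Twist.diag_comp (P := fun i j => El F (y i) (x j)) (Q := fun i j => x i ⟶ x' j)
    (R := fun i j => El F (y i) (x' j)) (fun _ _ _ r f => post F f r) _ _).trans ?_
  exact Twist.ext_diag rfl rfl fun i _ _ => rfl

/-- Every element of `T̃F(b, [e; x])` is a diagonal element, up to a rearrangement of `b`. -/
lemma exists_eq_pre_diagArr (F : Profunctor.{u} X Y) {b : BorelCat Λ Y} {n : ℕ} {x : Fin n → X}
    (t : El (mapProf Λ F) b ⟨n, x⟩) :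
    ∃ (y : Fin n → Y) (σ : b ⟶ ⟨n, y⟩) (p : ∀ i, El F (y i) (x i)),
      t = pre (mapProf Λ F) σ (diagArr F p) := by
  obtain ⟨m, y⟩ := b
  obtain rfl : m = n := Twist.len t
  refine ⟨fun j => y ((Λ.π m (Twist.g t))⁻¹ j),
    ⟨rfl, Twist.g t, fun i j h => eqToHom (congrArg y ?_)⟩,
    fun j => Twist.f t ((Λ.π m (Twist.g t))⁻¹ j) j ?_, ?_⟩
  · rw [show j = Λ.π m (Twist.g t) i from Fin.ext h]
    simp
  · simp
  · refine Eq.trans ?_ (Twist.comp_diag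
      (P := fun i j => y i ⟶ y ((Λ.π m (Twist.g t))⁻¹ j))
      (Q := fun i j => El F (y ((Λ.π m (Twist.g t))⁻¹ i)) (x j))
      (R := fun i j => El F (y i) (x j)) (fun _ _ _ f r => pre F f r) _ _).symm
    refine Twist.ext' rfl fun i j h h' => ?_
    have gen : ∀ (i' : Fin m) (e : i = i') (h'' : (j : ℕ) = Λ.π m (Twist.g t) i'),
        Twist.f t i j h = pre F (eqToHom (congrArg y e)) (Twist.f t i' j h'') := by
      rintro _ rfl _
      exact (pre_id F _).symm
    refine gen _ ?_ _
    rw [show j = Λ.π m (Twist.g t) i from Fin.ext h]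
    simp

/-- Two factorizations of an element through diagonal elements are connected through a third one,
in which the letters are rearranged but not changed. -/
lemma exists_common_factorization (F : Profunctor.{u} X Y) {b : BorelCat Λ Y} {n : ℕ}
    {y y' : Fin n → Y} {x : Fin n → X} (l : b ⟶ ⟨n, y⟩) (p : ∀ i, El F (y i) (x i))
    (l' : b ⟶ ⟨n, y'⟩) (p' : ∀ i, El F (y' i) (x i))
    (e : pre (mapProf Λ F) l (diagArr F p) = pre (mapProf Λ F) l' (diagArr F p')) :
    ∃ (y'' : Fin n → Y) (σ : b ⟶ ⟨n, y''⟩) (f : ∀ i, y'' i ⟶ y i) (f' : ∀ i, y'' i ⟶ y' i),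
      l = σ ≫ diagHom f ∧ l' = σ ≫ diagHom f' ∧ ∀ i, pre F (f i) (p i) = pre F (f' i) (p' i) := by
  obtain ⟨m, z⟩ := b
  obtain rfl : m = n := Twist.len l
  have e₀ : ∀ (y : Fin m → Y) (l : (⟨m, z⟩ : BorelCat Λ Y) ⟶ ⟨m, y⟩) (p : ∀ i, El F (y i) (x i)),
      pre (mapProf Λ F) l (diagArr F p) = Twist.map (P := fun i j => z i ⟶ y j)
        (Q := fun i j => El F (z i) (x j)) (fun i j f => pre F f (p j)) (toArr l) := fun y l p =>
    Twist.comp_diag (P := fun i j => z i ⟶ y j) (Q := fun i j => El F (y i) (x j))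
      (R := fun i j => El F (z i) (x j)) (fun _ _ _ f r => pre F f r) _ _
  rw [e₀, e₀] at e
  -- `y''` is `z` rearranged by the common group element of `l` and `l'`, and `σ` the rearrangement.
  have hg : (toArr l).g = (toArr l').g := congrArg Twist.g e
  have hs : ∀ j : Fin m, (j : ℕ) = Λ.π m (toArr l).g ((Λ.π m (toArr l).g)⁻¹ j) := fun j => by simp
  have hs' : ∀ j : Fin m, (j : ℕ) = Λ.π m (toArr l').g ((Λ.π m (toArr l).g)⁻¹ j) :=
    fun j => by simp [hg]
  have hi : ∀ (i j : Fin m) (_ : (j : ℕ) = Λ.π m (toArr l).g i), i = (Λ.π m (toArr l).g)⁻¹ j := by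
    intro i j h
    rw [show j = Λ.π m (toArr l).g i from Fin.ext h]
    simp
  refine ⟨fun j => z ((Λ.π m (toArr l).g)⁻¹ j),
    ⟨rfl, (toArr l).g, fun i j h => eqToHom (congrArg z (hi i j h))⟩,
    fun j => (toArr l).f _ j (hs j), fun j => (toArr l').f _ j (hs' j), ?_, ?_, fun j => ?_⟩
  · refine Eq.trans ?_ (comp_diagHom _ _).symm
    refine Twist.ext' rfl fun i j h h' => ?_
    have gen : ∀ (i' : Fin m) (e : i = i') (h''),
        (toArr l).f i j h = eqToHom (congrArg z e) ≫ (toArr l).f i' j h'' := by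
      rintro _ rfl _
      exact (Category.id_comp _).symm
    exact gen _ (hi i j h) _
  · refine Eq.trans ?_ (comp_diagHom _ _).symm
    refine Twist.ext' hg.symm fun i j h h' => ?_
    have gen : ∀ (i' : Fin m) (e : i = i') (h''),
        (toArr l').f i j h = eqToHom (congrArg z e) ≫ (toArr l').f i' j h'' := by
      rintro _ rfl _
      exact (Category.id_comp _).symm
    exact gen _ (hi i j h') _
  · exact f_eq_of_eq e _ j (hs j) (hs' j)

/-! ### The naturality squares of the unit -/

/-- The value of the unit at an element of a profunctor. -/
abbrev unitArr (F : Profunctor.{u} X Y) {y : Y} {x : X} (p : El F y x) :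
    El (mapProf Λ F) ((unit Λ Y).obj y) ((unit Λ X).obj x) :=
  diagArr F fun _ => p

/-- The map `(η⁺ ∘ F)(b, x) → T̃F(b, [e; x])` which acts on `F(y, x)` by the unit. -/
def unitSqMap (F : Profunctor.{u} X Y) (b : BorelCat Λ Y) (x : X) :
    El (comp F (unit Λ Y).toProfunctor) b x → El (mapProf Λ F) b ((unit Λ X).obj x) :=
  Comp.lift (G := (unit Λ Y).toProfunctor)
    (fun y (l : b ⟶ (unit Λ Y).obj y) r => pre (mapProf Λ F) l (unitArr F r))
    (fun f l r => by
      refine Eq.trans ?_ (pre_comp (mapProf Λ F) ((unit Λ Y).map f) l (unitArr F r)).symm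
      exact congrArg (pre (mapProf Λ F) l) (pre_diagArr F (fun _ => f) fun _ => r).symm)

variable (Λ) in
/-- The transformation `η⁺ ∘ F ⟶ T̃F ∘ η⁺`. -/
def unitSq (F : Profunctor.{u} X Y) :
    comp F (unit Λ Y).toProfunctor ⟶ comp (unit Λ X).toProfunctor (mapProf Λ F) :=
  toCompPlus (unit Λ X) (mapProf Λ F) (unitSqMap F)
    (fun f p => by
      induction p using Comp.ind with | h y l r =>
      exact pre_comp (mapProf Λ F) l f (unitArr F r))
    (fun g p => by
      induction p using Comp.ind with | h y l r =>
      refine Eq.trans ?_ (post_pre (mapProf Λ F) l ((unit Λ X).map g) (unitArr F r)).symm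
      exact congrArg (pre (mapProf Λ F) l) (post_diagArr F (fun _ => g) fun _ => r).symm)

lemma unitSq_bijective (F : Profunctor.{u} X Y) (b : BorelCat Λ Y) (x : X) :
    Function.Bijective (fun p : El (comp F (unit Λ Y).toProfunctor) b x => ap (unitSq Λ F) p) := by
  refine (mk_id_bijective (unit Λ X) (mapProf Λ F) b x).comp ⟨?_, fun t => ?_⟩
  · intro p q e
    induction p using Comp.ind with | h y l r =>
    induction q using Comp.ind with | h y' l' r' =>
    obtain ⟨y'', σ, f, f', h, h', e'⟩ := exists_common_factorization F l (fun _ => r) l'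
      (fun _ => r') e
    -- Words of length one, and families of elements indexed by their letters, are constant.
    obtain ⟨z, rfl⟩ : ∃ z, y'' = fun _ : Fin 1 => z :=
      ⟨y'' 0, funext fun i => by rw [Subsingleton.elim i 0]⟩
    have key : ∀ {y : Y} (l : b ⟶ (unit Λ Y).obj y) (r : El F y x) (f : ∀ _ : Fin 1, z ⟶ y)
        (_ : l = σ ≫ diagHom f), Comp.mk (G := (unit Λ Y).toProfunctor) l r =
          Comp.mk (G := (unit Λ Y).toProfunctor) (y := z) σ (pre F (f 0) r) := by
      intro y l r f h
      have hf : f = fun _ => f 0 := funext fun i => by rw [Subsingleton.elim i 0]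
      refine Eq.trans ?_ (Comp.sound (G := (unit Λ Y).toProfunctor) (f 0) σ r).symm
      refine congrArg (Comp.mk (G := (unit Λ Y).toProfunctor) · r) ?_
      rw [h, hf]
      rfl
    rw [key l r f h, key l' r' f' h', e' 0]
  · obtain ⟨y, σ, p, e⟩ := exists_eq_pre_diagArr F (x := fun _ : Fin 1 => x) t
    obtain ⟨z, rfl⟩ : ∃ z, y = fun _ : Fin 1 => z :=
      ⟨y 0, funext fun i => by rw [Subsingleton.elim i 0]⟩
    obtain ⟨r, rfl⟩ : ∃ r, p = fun _ => r :=
      ⟨p 0, funext fun i => by rw [Subsingleton.elim i 0]⟩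
    exact ⟨Comp.mk (G := (unit Λ Y).toProfunctor) (y := z) σ r, e.symm⟩

/-! ### The naturality squares of the multiplication -/

/-- The value of the multiplication at an element of `T̃T̃F`. -/
abbrev multArr (F : Profunctor.{u} X Y) {v : BorelCat Λ (BorelCat Λ Y)}
    {w : BorelCat Λ (BorelCat Λ X)} (p : El (mapProf Λ (mapProf Λ F)) v w) :
    El (mapProf Λ F) ((mult Λ Y).obj v) ((mult Λ X).obj w) :=
  Twist.flatten (P := fun i i' j j' => El F ((v.letter i).letter j) ((w.letter i').letter j')) p

lemma multArr_pre (F : Profunctor.{u} X Y) {v v' : BorelCat Λ (BorelCat Λ Y)}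
    {w : BorelCat Λ (BorelCat Λ X)} (f : v' ⟶ v) (p : El (mapProf Λ (mapProf Λ F)) v w) :
    multArr F (pre (mapProf Λ (mapProf Λ F)) f p) =
      pre (mapProf Λ F) ((mult Λ Y).map f) (multArr F p) :=
  Twist.flatten_comp (P := fun i i' j j' => (v'.letter i).letter j ⟶ (v.letter i').letter j')
    (Q := fun i i' j j' => El F ((v.letter i).letter j) ((w.letter i').letter j'))
    (R := fun i i' j j' => El F ((v'.letter i).letter j) ((w.letter i').letter j'))
    (fun _ _ _ _ _ _ a b => pre F a b) (toArr f) p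

lemma multArr_post (F : Profunctor.{u} X Y) {v : BorelCat Λ (BorelCat Λ Y)}
    {w w' : BorelCat Λ (BorelCat Λ X)} (f : w ⟶ w') (p : El (mapProf Λ (mapProf Λ F)) v w) :
    multArr F (post (mapProf Λ (mapProf Λ F)) f p) =
      post (mapProf Λ F) ((mult Λ X).map f) (multArr F p) :=
  Twist.flatten_comp
    (P := fun i i' j j' => El F ((v.letter i).letter j) ((w.letter i').letter j'))
    (Q := fun i i' j j' => (w.letter i).letter j ⟶ (w'.letter i').letter j')
    (R := fun i i' j j' => El F ((v.letter i).letter j) ((w'.letter i').letter j'))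
    (fun _ _ _ _ _ _ a b => post F b a) p (toArr f)

lemma multArr_diagArr (F : Profunctor.{u} X Y) {n : ℕ} {k : Fin n → ℕ} {y : ∀ i, Fin (k i) → Y}
    {x : ∀ i, Fin (k i) → X} (p : ∀ i j, El F (y i j) (x i j)) :
    multArr F (diagArr (Λ := Λ) (mapProf Λ F) (y := fun i => ⟨k i, y i⟩) (x := fun i => ⟨k i, x i⟩)
      fun i => diagArr F (p i)) =
    diagArr F fun l => p (finSigmaFinEquiv.symm l).1 (finSigmaFinEquiv.symm l).2 :=
  Twist.flatten_diag (P := fun i i' j j' => El F (y i j) (x i' j')) p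

/-- The map `(μ⁺ ∘ T̃T̃F)(b, w) → T̃F(b, μ w)` which acts on `T̃T̃F(v, w)` by the multiplication. -/
def multSqMap (F : Profunctor.{u} X Y) (b : BorelCat Λ Y) (w : BorelCat Λ (BorelCat Λ X)) :
    El (comp (mapProf Λ (mapProf Λ F)) (mult Λ Y).toProfunctor) b w →
      El (mapProf Λ F) b ((mult Λ X).obj w) :=
  Comp.lift (F := mapProf Λ (mapProf Λ F)) (G := (mult Λ Y).toProfunctor)
    (fun v (l : b ⟶ (mult Λ Y).obj v) r => pre (mapProf Λ F) l (multArr F r))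
    (fun f l r => by
      refine Eq.trans ?_ (pre_comp (mapProf Λ F) ((mult Λ Y).map f) l (multArr F r)).symm
      exact congrArg (pre (mapProf Λ F) l) (multArr_pre F f r))

variable (Λ) in
/-- The transformation `μ⁺ ∘ T̃T̃F ⟶ T̃F ∘ μ⁺`. -/
def multSq (F : Profunctor.{u} X Y) :
    comp (mapProf Λ (mapProf Λ F)) (mult Λ Y).toProfunctor ⟶
      comp (mult Λ X).toProfunctor (mapProf Λ F) :=
  toCompPlus (mult Λ X) (mapProf Λ F) (multSqMap F)
    (fun f p => by
      induction p using Comp.ind with | h y l r =>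
      exact pre_comp (mapProf Λ F) l f (multArr F r))
    (fun g p => by
      induction p using Comp.ind with | h y l r =>
      refine Eq.trans ?_ (post_pre (mapProf Λ F) l ((mult Λ X).map g) (multArr F r)).symm
      exact congrArg (pre (mapProf Λ F) l) (multArr_post F g r))

section

variable {n : ℕ} {k : Fin n → ℕ} {b : BorelCat Λ Y} {x : ∀ i, Fin (k i) → X}

/-- The class in `(μ⁺ ∘ T̃T̃F)(b, [e; [e; x₁], …, [e; xₙ]])` of a pair whose right component is
diagonal on both levels. -/
def multNormal (F : Profunctor.{u} X Y) {y : ∀ i, Fin (k i) → Y}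
    (l : b ⟶ (mult Λ Y).obj ⟨n, fun i => ⟨k i, y i⟩⟩) (p : ∀ i j, El F (y i j) (x i j)) :
    El (comp (mapProf Λ (mapProf Λ F)) (mult Λ Y).toProfunctor) b ⟨n, fun i => ⟨k i, x i⟩⟩ :=
  Comp.mk (F := mapProf Λ (mapProf Λ F)) (G := (mult Λ Y).toProfunctor)
    (y := ⟨n, fun i => ⟨k i, y i⟩⟩) l (diagArr (mapProf Λ F) fun i => diagArr F (p i))

lemma multNormal_comp (F : Profunctor.{u} X Y) {y y' : ∀ i, Fin (k i) → Y}
    (l : b ⟶ (mult Λ Y).obj ⟨n, fun i => ⟨k i, y' i⟩⟩) (f : ∀ i j, y' i j ⟶ y i j)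
    (p : ∀ i j, El F (y i j) (x i j)) :
    multNormal F (y := y) (l ≫ diagHom
      fun m => f (finSigmaFinEquiv.symm m).1 (finSigmaFinEquiv.symm m).2) p =
      multNormal F l fun i j => pre F (f i j) (p i j) := by
  refine Eq.trans ?_ (Eq.trans (Comp.sound (F := mapProf Λ (mapProf Λ F))
    (G := (mult Λ Y).toProfunctor) (diagHom fun i => diagHom (f i)) l
    (diagArr (mapProf Λ F) fun i => diagArr F (p i))).symm ?_)
  · refine congrArg (fun t => Comp.mk (F := mapProf Λ (mapProf Λ F))
      (G := (mult Λ Y).toProfunctor) (l ≫ t) _) ?_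
    exact (flatten_diagHom f).symm
  · refine congrArg (Comp.mk (F := mapProf Λ (mapProf Λ F)) (G := (mult Λ Y).toProfunctor) l) ?_
    rw [pre_diagArr]
    simp only [pre_diagArr]

lemma exists_eq_multNormal (F : Profunctor.{u} X Y)
    (q : El (comp (mapProf Λ (mapProf Λ F)) (mult Λ Y).toProfunctor) b
      ⟨n, fun i => ⟨k i, x i⟩⟩) :
    ∃ (y : ∀ i, Fin (k i) → Y) (l : b ⟶ (mult Λ Y).obj ⟨n, fun i => ⟨k i, y i⟩⟩)
      (p : ∀ i j, El F (y i j) (x i j)), q = multNormal F l p := by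
  induction q using Comp.ind with | h v l r =>
  obtain ⟨v', σ, p, rfl⟩ := exists_eq_pre_diagArr (mapProf Λ F) r
  choose y τ p' hp using fun i => exists_eq_pre_diagArr F (p i)
  obtain rfl : p = fun i => pre (mapProf Λ F) (τ i) (diagArr F (p' i)) := funext hp
  rw [← pre_diagArr, ← pre_comp]
  refine ⟨y, l ≫ (mult Λ Y).map (σ ≫ diagHom τ), p', ?_⟩
  exact Comp.sound (F := mapProf Λ (mapProf Λ F)) (G := (mult Λ Y).toProfunctor) _ l _

end

lemma multSq_bijective (F : Profunctor.{u} X Y) (b : BorelCat Λ Y)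
    (w : BorelCat Λ (BorelCat Λ X)) : Function.Bijective
      (fun p : El (comp (mapProf Λ (mapProf Λ F)) (mult Λ Y).toProfunctor) b w =>
        ap (multSq Λ F) p) := by
  refine (mk_id_bijective (mult Λ X) (mapProf Λ F) b w).comp ⟨?_, fun t => ?_⟩
  · intro p q e
    obtain ⟨y, l, p, rfl⟩ := exists_eq_multNormal (k := fun i => (w.letter i).len)
      (x := fun i => (w.letter i).letter) F p
    obtain ⟨y', l', p', rfl⟩ := exists_eq_multNormal (k := fun i => (w.letter i).len)
      (x := fun i => (w.letter i).letter) F q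
    replace e : pre (mapProf Λ F) l (multArr F (diagArr (mapProf Λ F) fun i => diagArr F (p i))) =
      pre (mapProf Λ F) l' (multArr F (diagArr (mapProf Λ F) fun i => diagArr F (p' i))) := e
    rw [multArr_diagArr, multArr_diagArr] at e
    obtain ⟨y'', σ, f, f', h, h', e'⟩ := exists_common_factorization F l _ l' _ e
    obtain ⟨y'', rfl⟩ := exists_curry (k := fun i => (w.letter i).len) (P := fun _ _ => Y) y''
    obtain ⟨f, rfl⟩ := exists_curry (P := fun i j => y'' i j ⟶ y i j) f
    obtain ⟨f', rfl⟩ := exists_curry (P := fun i j => y'' i j ⟶ y' i j) f'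
    subst h h'
    refine (multNormal_comp F σ f p).trans (Eq.trans ?_ (multNormal_comp F σ f' p').symm)
    congr 1
    funext i j
    exact forall_of_forall_finSigma
      (P := fun i j => pre F (f i j) (p i j) = pre F (f' i j) (p' i j)) e' i j
  · obtain ⟨y, σ, p, e⟩ := exists_eq_pre_diagArr F (n := ∑ i, (w.letter i).len)
      (x := ((mult Λ X).obj w).letter) t
    obtain ⟨y, rfl⟩ := exists_curry (k := fun i => (w.letter i).len) (P := fun _ _ => Y) y
    obtain ⟨p, rfl⟩ := exists_curry (P := fun i j => El F (y i j) ((w.letter i).letter j)) p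
    refine ⟨multNormal F (k := fun i => (w.letter i).len)
      (x := fun i => (w.letter i).letter) σ p, ?_⟩
    rw [e]
    exact congrArg (pre (mapProf Λ F) σ) (multArr_diagArr F p)

end BorelCat

/-! ### The pseudofunctor, the unit and the multiplication -/

namespace CategoryTheory

variable {C : Type*} [Category C]

lemma comp_iso_eq_of_inv_comp {A A' B B' : C} {f : A ⟶ B} {e : B ≅ B'} {e' : A ≅ A'}
    {g : A' ⟶ B'} (h : e'.inv ≫ f = g ≫ e.inv) : f ≫ e.hom = e'.hom ≫ g :=
  (Iso.eq_comp_inv e).1 (((Iso.inv_comp_eq e').1 h).trans (Category.assoc _ _ _).symm)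

lemma eq_comp_inv_of_comp_hom {A B D E : C} {f : A ⟶ E} {g : A ⟶ B} {h : B ⟶ D} {e : E ≅ D}
    (w : f ≫ e.hom = g ≫ h) : f = g ≫ h ≫ e.inv :=
  ((Iso.eq_comp_inv e).2 w).trans (Category.assoc _ _ _)

end CategoryTheory

namespace BorelCat

open Profunctor

variable {Λ : ActionOperad.{u}} {X Y Z : Type u} [SmallCategory X] [SmallCategory Y]
  [SmallCategory Z] {F : Profunctor.{u} X Y} {G : Profunctor.{u} Y Z}

lemma pairArr_diagArr {n : ℕ} {z : Fin n → Z} {y : Fin n → Y} {x : Fin n → X}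
    (l : ∀ i, El G (z i) (y i)) (r : ∀ i, El F (y i) (x i)) :
    pairArr (Λ := Λ) (diagArr G l) (diagArr F r) =
      diagArr (comp F G) fun i => Comp.mk (l i) (r i) := by
  refine (Twist.diag_comp (P := fun i j => El G (z i) (y j)) (Q := fun i j => El F (y i) (x j))
    (R := fun i j => El (comp F G) (z i) (x j)) (fun _ _ _ l r => Comp.mk l r) _ _).trans ?_
  exact Twist.ext_diag rfl rfl fun _ _ _ => rfl

lemma mapProf₂_diagArr {F' : Profunctor.{u} X Y} (α : F ⟶ F') {n : ℕ} {y : Fin n → Y}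
    {x : Fin n → X} (r : ∀ i, El F (y i) (x i)) :
    ap (mapProf₂ Λ α) (diagArr F r) = diagArr F' fun i => ap α (r i) :=
  Twist.ext_diag rfl rfl fun _ _ _ => rfl

/-- Multiplication commutes with the pairing of components. -/
lemma multArr_pairArr {u : BorelCat Λ (BorelCat Λ Z)} {v : BorelCat Λ (BorelCat Λ Y)}
    {w : BorelCat Λ (BorelCat Λ X)} (l : El (mapProf Λ (mapProf Λ G)) u v)
    (r : El (mapProf Λ (mapProf Λ F)) v w) :
    multArr (comp F G) (ap (mapProf₂ Λ (mapCompInv Λ F G))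
      (pairArr (F := mapProf Λ F) (G := mapProf Λ G) l r)) =
      pairArr (multArr G l) (multArr F r) :=
  Twist.flatten_comp
    (P := fun i i' j j' => El G ((u.letter i).letter j) ((v.letter i').letter j'))
    (Q := fun i i' j j' => El F ((v.letter i).letter j) ((w.letter i').letter j'))
    (R := fun i i' j j' => El (comp F G) ((u.letter i).letter j) ((w.letter i').letter j'))
    (fun _ _ _ _ _ _ a b => Comp.mk a b) l r

end BorelCat

namespace ActionOperad

open Profunctor BorelCat

variable (Λ : ActionOperad.{u})

/-- The comparison `mapCompIso`, as a 2-cell of `Prof`. -/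
noncomputable def tildeMapComp {X Y Z : Prof.{u}} (F : X ⟶ Y) (G : Y ⟶ Z) :
    Λ.tilde.map (F ≫ G) ≅ Λ.tilde.map F ≫ Λ.tilde.map G :=
  mapCompIso Λ F G

/-- The pseudofunctor structure of `T̃`. -/
noncomputable def tildeOn : PseudofunctorOn Λ.tilde where
  mapId X := Iso.refl (Profunctor.id (C := BorelCat Λ X.cat))
  mapComp F G := Λ.tildeMapComp F G
  map₂_whisker_left F G H α := by
    refine (Iso.inv_comp_eq _).1 (Profunctor.hom_ext fun c a p => ?_)
    induction p using Comp.ind with | h b l r =>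
    rfl
  map₂_whisker_right α H := by
    refine (Iso.inv_comp_eq _).1 (Profunctor.hom_ext fun c a p => ?_)
    induction p using Comp.ind with | h b l r =>
    rfl
  map₂_associator {A B C D} F G H := by
    refine (Iso.inv_comp_eq _).1 ?_
    rw [← whiskerRightIso_hom]
    refine (Iso.inv_comp_eq _).1 (Profunctor.hom_ext fun c a p => ?_)
    induction p using Comp.ind with | h b l r =>
    induction r using Comp.ind with | h b' m r =>
    refine (Twist.comp_assoc
      (P₁ := fun i j => El H (c.letter i) (b.letter j))
      (P₂ := fun i j => El G (b.letter i) (b'.letter j))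
      (P₃ := fun i j => El F (b'.letter i) (a.letter j))
      (Q₁ := fun i j => El (comp G H) (c.letter i) (b'.letter j))
      (Q₂ := fun i j => El (comp F G) (b.letter i) (a.letter j))
      (R := fun i j => El (comp F (comp G H)) (c.letter i) (a.letter j))
      (fun _ _ _ l m => Comp.mk l m) (fun _ _ _ q r => Comp.mk (G := comp G H) q r)
      (fun _ _ _ m r => Comp.mk m r)
      (fun _ _ _ l q => ap (assoc F G H).hom (Comp.mk (F := comp F G) l q))
      (fun _ _ _ _ _ _ _ => rfl) l m r).symm
  map₂_left_unitor {A B} F := by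
    refine (Iso.inv_comp_eq _).1 (Profunctor.hom_ext fun c a p => ?_)
    induction p using Comp.ind with | h b l r =>
    rfl
  map₂_right_unitor F := by
    refine (Iso.inv_comp_eq _).1 (Profunctor.hom_ext fun c a p => ?_)
    induction p using Comp.ind with | h b l r =>
    rfl

/-- The comparison 2-cell has no explicit formula in general, but it does when the first profunctor
comes from a functor. -/
lemma tildeMapComp_hom_mk_id {X Y : Cat.{u, u}} {Z : Prof.{u}} (H : X ⟶ Y)
    (K : plus.obj Y ⟶ Z) {c : BorelCat Λ Z.cat} {a : BorelCat Λ X}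
    (t : ProfArr (Λ := Λ) (X := Y) (Y := Z.cat) K c ((BorelCat.map H.toFunctor).obj a)) :
    ap (Λ.tildeMapComp (plus.map H) K).hom
      (Twist.map (P := fun i j => El K (c.letter i) (H.toFunctor.obj (a.letter j)))
        (Q := fun i j => El (comp H.toFunctor.toProfunctor K) (c.letter i) (a.letter j))
        (fun _ _ k => Comp.mk (F := H.toFunctor.toProfunctor) k (𝟙 _)) t) =
      Comp.mk (F := (BorelCat.map H.toFunctor).toProfunctor) (G := mapProf Λ K) t (𝟙 _) := by
  refine ((mapCompInv_bijective (plus.map H) K c a).1 ?_)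
  refine (congrArg (fun α : _ ⟶ _ => ap α _) (Λ.tildeMapComp (plus.map H) K).hom_inv_id).trans ?_
  exact (Twist.comp_diag (P := fun i j => El K (c.letter i) (H.toFunctor.obj (a.letter j)))
    (Q := fun i j => H.toFunctor.obj (a.letter i) ⟶ H.toFunctor.obj (a.letter j))
    (R := fun i j => El (comp H.toFunctor.toProfunctor K) (c.letter i) (a.letter j))
    (fun _ _ _ k r => Comp.mk (F := H.toFunctor.toProfunctor) k r) (fun _ => 𝟙 _) t).symm

/-- The 2-cell `η⁺ ∘ F ≅ T̃F ∘ η⁺` of `Prof`. -/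
noncomputable def tildeUnitNat {X Y : Prof.{u}} (F : X ⟶ Y) :
    F ≫ Λ.tildeUnit Y ≅ Λ.tildeUnit X ≫ Λ.tilde.map F :=
  isoOfBijective (unitSq Λ F) (unitSq_bijective F)

/-- The 2-cell `μ⁺ ∘ T̃T̃F ≅ T̃F ∘ μ⁺` of `Prof`. -/
noncomputable def tildeMultNat {X Y : Prof.{u}} (F : X ⟶ Y) :
    Λ.tilde.map (Λ.tilde.map F) ≫ Λ.tildeMult Y ≅ Λ.tildeMult X ≫ Λ.tilde.map F :=
  isoOfBijective (multSq Λ F) (multSq_bijective F)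

/-- The pseudonaturality of the unit. -/
noncomputable def tildeUnitOn :
    StrongTransOn (Pseudofunctor.id Prof.{u}) Λ.tildeOn.toPseudofunctor Λ.tildeUnit where
  naturality F := Λ.tildeUnitNat F
  naturality_naturality {X Y F G} α := by
    refine Profunctor.hom_ext fun c a p => ?_
    induction p using Comp.ind with | h b l r =>
    refine congrArg (Comp.mk (F := (BorelCat.unit Λ X.cat).toProfunctor) (G := mapProf Λ G) · (𝟙 _))
      (Eq.trans ?_ (ap_pre (mapProf₂ Λ α) l (unitArr F r)).symm)
    exact congrArg (pre (mapProf Λ G) l) (mapProf₂_diagArr α fun _ => r).symm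
  naturality_id X := by
    refine eq_comp_inv_of_comp_hom (Profunctor.hom_ext fun c a p => ?_)
    induction p using Comp.ind with | h b l r =>
    exact Category.comp_id (obj := BorelCat Λ X.cat) (X := c)
      (pre (mapProf Λ (Profunctor.id (C := X.cat))) l (unitArr _ r))
  naturality_comp {X Y Z} F G := by
    refine (Iso.eq_comp_inv (whiskerLeftIso _ (Λ.tildeMapComp F G))).1
      (Profunctor.hom_ext fun c a p => ?_)
    induction p using Comp.ind with | h b l r =>
    induction r using Comp.ind with | h b' m r =>
    refine congrArg (Comp.mk (F := (BorelCat.unit Λ X.cat).toProfunctor)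
      (G := mapProf Λ (comp F G)) · (𝟙 _)) ?_
    refine Eq.trans (congrArg (pre (mapProf Λ (comp F G)) l)
      (pairArr_diagArr (fun _ => m) fun _ => r).symm) ?_
    refine Eq.trans (ap_pre (mapCompInv Λ F G) l
      (Comp.mk (F := mapProf Λ F) (G := mapProf Λ G) (unitArr G m) (unitArr F r))).symm ?_
    exact congrArg (ap (mapCompInv Λ F G)) (congrArg (Comp.mk (F := mapProf Λ F) (G := mapProf Λ G)
      (pre (mapProf Λ G) l (unitArr G m))) (pre_id (mapProf Λ F) (unitArr F r)).symm)

/-- The pseudonaturality of the multiplication. -/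
noncomputable def tildeMultOn :
    StrongTransOn (Λ.tildeOn.toPseudofunctor.comp Λ.tildeOn.toPseudofunctor)
      Λ.tildeOn.toPseudofunctor Λ.tildeMult where
  naturality F := Λ.tildeMultNat F
  naturality_naturality {X Y F G} α := by
    refine Profunctor.hom_ext fun c a p => ?_
    induction p using Comp.ind with | h b l r =>
    exact congrArg (Comp.mk (F := (BorelCat.mult Λ X.cat).toProfunctor) (G := mapProf Λ G) · (𝟙 _))
      (ap_pre (mapProf₂ Λ α) l (multArr F r)).symm
  naturality_id X := by
    refine eq_comp_inv_of_comp_hom (Profunctor.hom_ext fun c a p => ?_)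
    induction p using Comp.ind with | h b l r =>
    exact Category.comp_id (obj := BorelCat Λ X.cat) (X := c)
      (pre (mapProf Λ (Profunctor.id (C := X.cat))) l (multArr _ r))
  naturality_comp {X Y Z} F G := by
    refine comp_iso_eq_of_inv_comp (e := whiskerLeftIso _ (Λ.tildeMapComp F G))
      (e' := whiskerRightIso ((Λ.tildeOn.toPseudofunctor.comp
        Λ.tildeOn.toPseudofunctor).mapComp F G) (Λ.tildeMult Z))
      (Profunctor.hom_ext fun c a p => ?_)
    induction p using Comp.ind with | h b l r =>
    induction r using Comp.ind with | h b' m r =>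
    refine congrArg (Comp.mk (F := (BorelCat.mult Λ X.cat).toProfunctor)
      (G := mapProf Λ (comp F G)) · (𝟙 _)) ?_
    refine Eq.trans (congrArg (pre (mapProf Λ (comp F G)) l) (multArr_pairArr m r)) ?_
    refine Eq.trans (ap_pre (mapCompInv Λ F G) l
      (Comp.mk (F := mapProf Λ F) (G := mapProf Λ G) (multArr G m) (multArr F r))).symm ?_
    exact congrArg (ap (mapCompInv Λ F G)) (congrArg (Comp.mk (F := mapProf Λ F) (G := mapProf Λ G)
      (pre (mapProf Λ G) l (multArr G m))) (pre_id (mapProf Λ F) (multArr F r)).symm)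

end ActionOperad

/-! ### The collage of a profunctor -/

/-- The objects of the collage of a profunctor `F : X ⇸ Y`, a category which contains `Y` and `X`
and whose morphisms from `y` to `x` are the elements of `F(y, x)`. -/
inductive Collage {X Y : Type u} [SmallCategory X] [SmallCategory Y] (F : Profunctor.{u} X Y) :
    Type u
  | inl (y : Y) : Collage F
  | inr (x : X) : Collage F

namespace Collage

open Profunctor

variable {X Y : Type u} [SmallCategory X] [SmallCategory Y] (F : Profunctor.{u} X Y)

instance : SmallCategory (Collage F) where
  Hom
    | inl y, inl y' => y ⟶ y'
    | inl y, inr x => El F y x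
    | inr x, inr x' => x ⟶ x'
    | inr _, inl _ => PEmpty
  id
    | inl y => 𝟙 y
    | inr x => 𝟙 x
  comp {a b c} := match a, b, c with
    | inl _, inl _, inl _ => fun f g => f ≫ g
    | inl _, inl _, inr _ => fun f p => pre F f p
    | inl _, inr _, inr _ => fun p g => post F g p
    | inr _, inr _, inr _ => fun f g => f ≫ g
    | _, inr _, inl _ => fun _ g => g.elim
    | inr _, inl _, _ => fun f _ => f.elim
  id_comp {a b} f := match a, b with
    | inl _, inl _ => Category.id_comp (obj := Y) f
    | inl _, inr _ => pre_id F f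
    | inr _, inr _ => Category.id_comp (obj := X) f
    | inr _, inl _ => f.elim
  comp_id {a b} f := match a, b with
    | inl _, inl _ => Category.comp_id (obj := Y) f
    | inl _, inr _ => post_id F f
    | inr _, inr _ => Category.comp_id (obj := X) f
    | inr _, inl _ => f.elim
  assoc {a b c d} f g h := match a, b, c, d with
    | inl _, inl _, inl _, inl _ => Category.assoc (obj := Y) f g h
    | inl _, inl _, inl _, inr _ => pre_comp F g f h
    | inl _, inl _, inr _, inr _ => post_pre F f h g
    | inl _, inr _, inr _, inr _ => (post_comp F g h f).symm
    | inr _, inr _, inr _, inr _ => Category.assoc (obj := X) f g h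
    | _, _, inr _, inl _ => h.elim
    | _, inr _, inl _, _ => g.elim
    | inr _, inl _, _, _ => f.elim

/-- The inclusion of `Y`. -/
def inlFunctor : Y ⥤ Collage F where
  obj := inl
  map f := f

/-- The inclusion of `X`. -/
def inrFunctor : X ⥤ Collage F where
  obj := inr
  map f := f

end Collage

namespace BorelCat

open Profunctor

variable {Λ : ActionOperad.{u}} {X Y : Type u} [SmallCategory X] [SmallCategory Y]
  {F : Profunctor.{u} X Y}

/-- An element of `T̃F`, as a morphism of words in the collage of `F`. -/
def collageHom {b : BorelCat Λ Y} {a : BorelCat Λ X} (p : El (mapProf Λ F) b a) :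
    (map (Collage.inlFunctor F)).obj b ⟶ (map (Collage.inrFunctor F)).obj a :=
  p

/-- An equation between elements of `T̃F` over equalities of words may be checked in the collage. -/
lemma collageHom_eq {b b' : BorelCat Λ Y} {a a' : BorelCat Λ X} (hb : b = b') (ha : a' = a)
    (p : El (mapProf Λ F) b a) (p' : El (mapProf Λ F) b' a')
    (e : collageHom p = eqToHom (congrArg (map (Collage.inlFunctor F)).obj hb) ≫
      collageHom p' ≫ eqToHom (congrArg (map (Collage.inrFunctor F)).obj ha)) :
    post (mapProf Λ F) (eqToHom ha.symm) p = pre (mapProf Λ F) (eqToHom hb) p' := by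
  subst hb ha
  rw [eqToHom_refl, eqToHom_refl, Category.comp_id, Category.id_comp] at e
  rw [eqToHom_refl, eqToHom_refl, pre_id, post_id]
  exact e

lemma pre_multArr_pre (F : Profunctor.{u} X Y) {c : BorelCat Λ Y}
    {v v' : BorelCat Λ (BorelCat Λ Y)} {w : BorelCat Λ (BorelCat Λ X)}
    (l : c ⟶ (mult Λ Y).obj v') (m : v' ⟶ v) (p : El (mapProf Λ (mapProf Λ F)) v w) :
    pre (mapProf Λ F) l (multArr F (pre (mapProf Λ (mapProf Λ F)) m p)) =
      pre (mapProf Λ F) (l ≫ (mult Λ Y).map m) (multArr F p) := by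
  rw [multArr_pre]
  exact (pre_comp (mapProf Λ F) ((mult Λ Y).map m) l (multArr F p)).symm

/-- The unit law `μ ∘ ηT = 1` for elements of `T̃F`, an instance of that for morphisms of words in
the collage of `F`. -/
lemma multArr_unitArr {b : BorelCat Λ Y} {a : BorelCat Λ X} (p : El (mapProf Λ F) b a)
    (hb : (mult Λ Y).obj ((unit Λ (BorelCat Λ Y)).obj b) = b)
    (ha : (mult Λ X).obj ((unit Λ (BorelCat Λ X)).obj a) = a) :
    post (mapProf Λ F) (eqToHom ha) (multArr F (unitArr (mapProf Λ F) p)) =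
      pre (mapProf Λ F) (eqToHom hb) p :=
  collageHom_eq hb ha.symm _ p
    (Functor.congr_hom (unit_mult (Λ := Λ) (X := Collage F)) (collageHom p))

/-- The value of `T̃η` at an element of `T̃F`. -/
abbrev mapUnitArr (F : Profunctor.{u} X Y) {b : BorelCat Λ Y} {a : BorelCat Λ X}
    (p : El (mapProf Λ F) b a) :
    El (mapProf Λ (mapProf Λ F)) ((map (unit Λ Y)).obj b) ((map (unit Λ X)).obj a) :=
  Twist.map (P := fun i j => El F (b.letter i) (a.letter j)) (Q := fun i j => El (mapProf Λ F)
    ((unit Λ Y).obj (b.letter i)) ((unit Λ X).obj (a.letter j))) (fun _ _ q => unitArr F q) p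

/-- The unit law `μ ∘ Tη = 1` for elements of `T̃F`. -/
lemma multArr_mapUnitArr {b : BorelCat Λ Y} {a : BorelCat Λ X} (p : El (mapProf Λ F) b a)
    (hb : (mult Λ Y).obj ((map (unit Λ Y)).obj b) = b)
    (ha : (mult Λ X).obj ((map (unit Λ X)).obj a) = a) :
    post (mapProf Λ F) (eqToHom ha) (multArr F (mapUnitArr F p)) =
      pre (mapProf Λ F) (eqToHom hb) p :=
  collageHom_eq hb ha.symm _ p
    (Functor.congr_hom (map_unit_mult (Λ := Λ) (X := Collage F)) (collageHom p))

/-- The value of `T̃μ` at an element of `T̃T̃T̃F`. -/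
abbrev mapMultArr (F : Profunctor.{u} X Y) {u : BorelCat Λ (BorelCat Λ (BorelCat Λ Y))}
    {w : BorelCat Λ (BorelCat Λ (BorelCat Λ X))}
    (p : El (mapProf Λ (mapProf Λ (mapProf Λ F))) u w) :
    El (mapProf Λ (mapProf Λ F)) ((map (mult Λ Y)).obj u) ((map (mult Λ X)).obj w) :=
  Twist.map (P := fun i j => El (mapProf Λ (mapProf Λ F)) (u.letter i) (w.letter j))
    (Q := fun i j => El (mapProf Λ F) ((mult Λ Y).obj (u.letter i))
      ((mult Λ X).obj (w.letter j))) (fun _ _ q => multArr F q) p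

/-- The associativity law for elements of `T̃T̃T̃F`. -/
lemma multArr_mapMultArr {u : BorelCat Λ (BorelCat Λ (BorelCat Λ Y))}
    {w : BorelCat Λ (BorelCat Λ (BorelCat Λ X))}
    (p : El (mapProf Λ (mapProf Λ (mapProf Λ F))) u w)
    (hu : (mult Λ Y).obj ((map (mult Λ Y)).obj u) =
      (mult Λ Y).obj ((mult Λ (BorelCat Λ Y)).obj u))
    (hw : (mult Λ X).obj ((map (mult Λ X)).obj w) =
      (mult Λ X).obj ((mult Λ (BorelCat Λ X)).obj w)) :
    post (mapProf Λ F) (eqToHom hw) (multArr F (mapMultArr F p)) =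
      pre (mapProf Λ F) (eqToHom hu) (multArr F (multArr (mapProf Λ F) p)) :=
  collageHom_eq hu hw.symm _ _
    (Functor.congr_hom (mult_mult (Λ := Λ) (X := Collage F))
      (X := (map (map (map (Collage.inlFunctor F)))).obj u)
      (Y := (map (map (map (Collage.inrFunctor F)))).obj w) p)

end BorelCat

/-! ### The modifications -/

section

open Profunctor

/-- The value of a pasting of two squares, from the values of the squares. -/
lemma ap_pasteSq {A₀ A₁ A₂ B₀ B₁ B₂ : Prof.{u}} {a : A₀ ⟶ A₁} {a' : A₁ ⟶ A₂} {b : B₀ ⟶ B₁}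
    {b' : B₁ ⟶ B₂} {p : A₀ ⟶ B₀} {q : A₁ ⟶ B₁} {r : A₂ ⟶ B₂} (σ : p ≫ b ⟶ a ≫ q)
    (τ : q ≫ b' ⟶ a' ≫ r) {z : B₂.cat} {y : B₁.cat} {x : B₀.cat} {w : A₀.cat} {v : A₁.cat}
    {v' : A₂.cat} (l : El b' z y) (m : El b y x) (n : El p x w) (s : El q y v) (t : El a v w)
    (s' : El r z v') (t' : El a' v' v)
    (hσ : ap σ (Comp.mk m n) = Comp.mk (F := a) (G := q) s t)
    (hτ : ap τ (Comp.mk l s) = Comp.mk (F := a') (G := r) s' t') :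
    ap (pasteSq σ τ) (Comp.mk (G := comp b b') (Comp.mk l m) n) =
      Comp.mk (F := comp a a') s' (Comp.mk t' t) := by
  change ap (α_ a a' r).inv (ap (a ◁ τ) (ap (α_ a q b').hom
    (Comp.mk (F := comp a q) l (ap σ (Comp.mk m n))))) = _
  rw [hσ]
  change ap (α_ a a' r).inv (Comp.mk (F := a) (G := comp a' r) (ap τ (Comp.mk l s)) t) = _
  rw [hτ]
  rfl

lemma Profunctor.mk_mk_toProfunctor {A B C D : Type u} [SmallCategory A] [SmallCategory B]
    [SmallCategory C] [SmallCategory D] (F : Profunctor.{u} A B) (H : B ⥤ C)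
    (K : Profunctor.{u} C D) {z : D} {y : C} {x : B} {w : A} (k : El K z y) (e : y ⟶ H.obj x)
    (r : El F x w) :
    Comp.mk (F := comp F H.toProfunctor) k (Comp.mk (G := H.toProfunctor) e r) =
      Comp.mk (F := comp F H.toProfunctor) (post K e k)
        (Comp.mk (G := H.toProfunctor) (𝟙 (H.obj x)) r) := by
  refine Eq.trans ?_ (Comp.sound (F := comp F H.toProfunctor) e k
    (Comp.mk (G := H.toProfunctor) (𝟙 (H.obj x)) r))
  exact congrArg (fun t => Comp.mk (F := comp F H.toProfunctor) k
    (Comp.mk (G := H.toProfunctor) t r)) (Category.comp_id e).symm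

lemma Profunctor.post_pre_eq {A B : Type u} [SmallCategory A] [SmallCategory B]
    (P : Profunctor.{u} A B) {b c d : B} {a a' : A} {e : c ⟶ d} {e' : a ⟶ a'} {t : El P c a}
    {t' : El P d a'} (h : post P e' t = pre P e t') (k : b ⟶ c) :
    post P e' (pre P k t) = pre P (k ≫ e) t' := by
  rw [post_pre, h, pre_comp]

lemma comp_eqToHom_comp_map_eqToHom {C D : Type*} [Category C] [Category D] (K : C ⥤ D)
    {x y z : C} {d : D} (l : d ⟶ K.obj x) (e : K.obj x = K.obj y) (e' : y = z) (e'' : x = z) :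
    ((l ≫ K.map (𝟙 x)) ≫ eqToHom e) ≫ K.map (eqToHom e') = l ≫ K.map (eqToHom e'') := by
  simp [eqToHom_map]

lemma comp_eqToHoms_eq {C D : Type*} [Category C] [Category D] (K : C ⥤ D)
    {x y z w v t : C} {d : D} (l : d ⟶ K.obj x) (e₁ : K.obj x = K.obj y) (e₂ : y = z)
    (e₃ : K.obj z = K.obj w) (e₄ : x = v) (e₅ : K.obj v = K.obj t) (e₆ : t = w) :
    (((l ≫ K.map (𝟙 x)) ≫ eqToHom e₁) ≫ K.map (eqToHom e₂)) ≫ eqToHom e₃ =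
      ((l ≫ K.map (eqToHom e₄)) ≫ eqToHom e₅) ≫ K.map (eqToHom e₆) := by
  simp [eqToHom_map]

lemma id_comp_map_id_comp {C D : Type*} [Category C] [Category D] (G : C ⥤ D) {x : C} {y : D}
    (e : G.obj x ⟶ y) : (𝟙 (G.obj x) ≫ G.map (𝟙 x)) ≫ e = e := by
  simp

lemma cat_eqToHom_app {X Y : Cat.{u, u}} {F G : X ⟶ Y} (h : F = G) (x : X) :
    (eqToHom h).toNatTrans.app x =
      eqToHom (congrArg (fun F : X ⟶ Y => F.toFunctor.obj x) h) := by
  subst h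
  rfl

end

namespace ActionOperad

open Profunctor BorelCat

variable {Λ : ActionOperad.{u}}

section

variable {X Y Y' Z : Cat.{u, u}} {F : X ⟶ Y} {G : Y ⟶ Z} {H : X ⟶ Y'} {K : Y' ⟶ Z}

/-- The 2-cell `plusSq h` is invertible. -/
def plusSqIso (h : F ≫ G = H ≫ K) :
    plus.map F ≫ plus.map G ≅ plus.map H ≫ plus.map K :=
  (plus.mapComp F G).symm ≪≫ plus.map₂Iso (eqToIso h) ≪≫ plus.mapComp H K

lemma ap_plusSq (h : F ≫ G = H ≫ K) {z : Z} {y : Y} {x : X} (l : z ⟶ G.toFunctor.obj y)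
    (r : y ⟶ F.toFunctor.obj x) :
    ap (plusSq h) (Comp.mk (F := F.toFunctor.toProfunctor) (G := G.toFunctor.toProfunctor) l r) =
      Comp.mk (F := H.toFunctor.toProfunctor) (G := K.toFunctor.toProfunctor)
        (y := H.toFunctor.obj x) ((l ≫ G.toFunctor.map r) ≫
          eqToHom (congrArg (fun F : X ⟶ Z => F.toFunctor.obj x) h)) (𝟙 _) := by
  rw [← cat_eqToHom_app h]
  rfl

lemma ap_plusSq_id (h : F ≫ G = H ≫ K) (x : X) :
    ap (plusSq h) (Comp.mk (F := F.toFunctor.toProfunctor) (G := G.toFunctor.toProfunctor)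
        (𝟙 (G.toFunctor.obj (F.toFunctor.obj x))) (𝟙 (F.toFunctor.obj x))) =
      Comp.mk (F := H.toFunctor.toProfunctor) (G := K.toFunctor.toProfunctor)
        (y := H.toFunctor.obj x) (eqToHom (congrArg (fun F : X ⟶ Z => F.toFunctor.obj x) h))
        (𝟙 _) := by
  exact (ap_plusSq h _ _).trans (congrArg (Comp.mk (F := H.toFunctor.toProfunctor)
    (G := K.toFunctor.toProfunctor) · (𝟙 _)) (id_comp_map_id_comp G.toFunctor _))

end

section

variable {X Y : Cat.{u, u}} {F : X ⟶ Y} {G : Y ⟶ X}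

/-- The 2-cell `plusTri h` is invertible. -/
def plusTriIso (h : F ≫ G = 𝟙 X) :
    plus.map F ≫ plus.map G ≅ 𝟙 (plus.obj X) :=
  (plus.mapComp F G).symm ≪≫ plus.map₂Iso (eqToIso h) ≪≫ plus.mapId X

lemma ap_plusTri (h : F ≫ G = 𝟙 X) {z : X} {y : Y} {x : X} (l : z ⟶ G.toFunctor.obj y)
    (r : y ⟶ F.toFunctor.obj x) :
    ap (plusTri h) (Comp.mk (F := F.toFunctor.toProfunctor) (G := G.toFunctor.toProfunctor) l r) =
      (l ≫ G.toFunctor.map r) ≫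
        eqToHom (congrArg (fun F : X ⟶ X => F.toFunctor.obj x) h) := by
  rw [← cat_eqToHom_app h]
  rfl

lemma ap_plusTri_id (h : F ≫ G = 𝟙 X) (x : X) :
    ap (plusTri h) (Comp.mk (F := F.toFunctor.toProfunctor) (G := G.toFunctor.toProfunctor)
        (𝟙 (G.toFunctor.obj (F.toFunctor.obj x))) (𝟙 (F.toFunctor.obj x))) =
      eqToHom (congrArg (fun F : X ⟶ X => F.toFunctor.obj x) h) := by
  exact (ap_plusTri h _ _).trans (id_comp_map_id_comp G.toFunctor _)

end

lemma exists_eq_mk_mk_id {A B C D : Type u} [SmallCategory A] [SmallCategory B]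
    [SmallCategory C] [SmallCategory D] (F : A ⥤ B) (G : B ⥤ C) (P : Profunctor.{u} C D) {d : D}
    {a : A} (p : El (comp F.toProfunctor (comp G.toProfunctor P)) d a) :
    ∃ l : El P d (G.obj (F.obj a)), p = Comp.mk (F := F.toProfunctor)
      (G := comp G.toProfunctor P) (Comp.mk (F := G.toProfunctor) l (𝟙 (G.obj (F.obj a))))
      (𝟙 (F.obj a)) := by
  obtain ⟨k, rfl⟩ := (mk_id_bijective F (comp G.toProfunctor P) d a).2 p
  obtain ⟨l, rfl⟩ := (mk_id_bijective G P d (F.obj a)).2 k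
  exact ⟨l, rfl⟩

/-- In the first coherence axiom, all 2-cells between composites of functors come from equalities
of functors. -/
lemma plus_unit_coherence {A B D : Cat.{u, u}} {F : A ⟶ B} {G H : B ⟶ A} {K : A ⟶ D}
    (h : G ≫ K = H ≫ K) (h₁ : F ≫ H = 𝟙 A) (τ : plus.map F ≫ plus.map G ⟶ 𝟙 (plus.obj A))
    (e : ∀ a : A, G.toFunctor.obj (F.toFunctor.obj a) = a)
    (hτ : ∀ a : A, ap τ (Comp.mk (F := F.toFunctor.toProfunctor) (G := G.toFunctor.toProfunctor)
      (𝟙 (G.toFunctor.obj (F.toFunctor.obj a))) (𝟙 (F.toFunctor.obj a))) = eqToHom (e a)) :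
    plus.map F ◁ plusSq h ≫ (α_ _ _ _).inv ≫ plusTri h₁ ▷ plus.map K ≫ (λ_ (plus.map K)).hom =
      (α_ _ _ _).inv ≫ τ ▷ plus.map K ≫ (λ_ (plus.map K)).hom := by
  refine Profunctor.hom_ext fun d a p => ?_
  obtain ⟨(l : d ⟶ _), rfl⟩ := exists_eq_mk_mk_id F.toFunctor G.toFunctor
    K.toFunctor.toProfunctor p
  refine (congrArg (fun q => ap ((α_ (plus.map F) (plus.map H) (plus.map K)).inv ≫
    plusTri h₁ ▷ plus.map K ≫ (λ_ (plus.map K)).hom)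
      (Comp.mk (F := F.toFunctor.toProfunctor)
        (G := comp H.toFunctor.toProfunctor K.toFunctor.toProfunctor) q (𝟙 _)))
    (ap_plusSq h l (𝟙 _))).trans ?_
  refine (congrArg (post K.toFunctor.toProfunctor · ((l ≫ K.toFunctor.map (𝟙 _)) ≫ eqToHom _))
    (ap_plusTri_id h₁ a)).trans ?_
  refine Eq.trans ?_ (congrArg (post K.toFunctor.toProfunctor · l) (hτ a)).symm
  exact comp_eqToHom_comp_map_eqToHom K.toFunctor l _ _ _

/-- In the second coherence axiom, all 2-cells between composites of functors come from equalities
of functors. -/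
lemma plus_assoc_coherence {A B C D : Cat.{u, u}} {F M N : A ⟶ B} {G H : B ⟶ C} {K : C ⟶ D}
    (h : G ≫ K = H ≫ K) (h' : N ≫ H = M ≫ H)
    (ν : plus.map F ≫ plus.map H ⟶ plus.map M ≫ plus.map G)
    (θ : plus.map F ≫ plus.map G ⟶ plus.map N ≫ plus.map G)
    (e : ∀ a : A, H.toFunctor.obj (F.toFunctor.obj a) = G.toFunctor.obj (M.toFunctor.obj a))
    (e' : ∀ a : A, G.toFunctor.obj (F.toFunctor.obj a) = G.toFunctor.obj (N.toFunctor.obj a))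
    (hν : ∀ a : A, ap ν (Comp.mk (F := F.toFunctor.toProfunctor) (G := H.toFunctor.toProfunctor)
      (𝟙 (H.toFunctor.obj (F.toFunctor.obj a))) (𝟙 (F.toFunctor.obj a))) =
        Comp.mk (F := M.toFunctor.toProfunctor) (G := G.toFunctor.toProfunctor) (eqToHom (e a))
          (𝟙 (M.toFunctor.obj a)))
    (hθ : ∀ a : A, ap θ (Comp.mk (F := F.toFunctor.toProfunctor) (G := G.toFunctor.toProfunctor)
      (𝟙 (G.toFunctor.obj (F.toFunctor.obj a))) (𝟙 (F.toFunctor.obj a))) =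
        Comp.mk (F := N.toFunctor.toProfunctor) (G := G.toFunctor.toProfunctor) (eqToHom (e' a))
          (𝟙 (N.toFunctor.obj a))) :
    plus.map F ◁ plusSq h ≫ (α_ _ _ _).inv ≫ ν ▷ plus.map K ≫ (α_ _ _ _).hom ≫
        plus.map M ◁ plusSq h ≫ (α_ _ _ _).inv =
      (α_ _ _ _).inv ≫ θ ▷ plus.map K ≫ (α_ _ _ _).hom ≫ plus.map N ◁ plusSq h ≫
        (α_ _ _ _).inv ≫ plusSq h' ▷ plus.map K := by
  refine Profunctor.hom_ext fun d a p => ?_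
  obtain ⟨(l : d ⟶ _), rfl⟩ := exists_eq_mk_mk_id F.toFunctor G.toFunctor
    K.toFunctor.toProfunctor p
  refine (congrArg (fun q => ap ((α_ (plus.map F) (plus.map H) (plus.map K)).inv ≫
    ν ▷ plus.map K ≫ (α_ (plus.map M) (plus.map G) (plus.map K)).hom ≫
      plus.map M ◁ plusSq h ≫ (α_ (plus.map M) (plus.map H) (plus.map K)).inv)
      (Comp.mk (F := F.toFunctor.toProfunctor)
        (G := comp H.toFunctor.toProfunctor K.toFunctor.toProfunctor) q (𝟙 _)))
    (ap_plusSq h l (𝟙 _))).trans ?_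
  refine (congrArg (fun q => ap ((α_ (plus.map M) (plus.map G) (plus.map K)).hom ≫
      plus.map M ◁ plusSq h ≫ (α_ (plus.map M) (plus.map H) (plus.map K)).inv)
      (Comp.mk (F := comp M.toFunctor.toProfunctor G.toFunctor.toProfunctor)
        (G := K.toFunctor.toProfunctor) (y := H.toFunctor.obj (F.toFunctor.obj a))
        ((l ≫ K.toFunctor.map (𝟙 _)) ≫
          eqToHom (congrArg (fun F : B ⟶ D => F.toFunctor.obj _) h)) q)) (hν a)).trans ?_
  refine (congrArg (fun q => ap (α_ (plus.map M) (plus.map H) (plus.map K)).inv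
      (Comp.mk (F := M.toFunctor.toProfunctor)
        (G := comp H.toFunctor.toProfunctor K.toFunctor.toProfunctor) q (𝟙 _)))
      (ap_plusSq h _ (eqToHom (e a)))).trans ?_
  refine Eq.trans ?_ (congrArg (fun q => ap ((α_ (plus.map N) (plus.map G) (plus.map K)).hom ≫
      plus.map N ◁ plusSq h ≫ (α_ (plus.map N) (plus.map H) (plus.map K)).inv ≫
        plusSq h' ▷ plus.map K)
      (Comp.mk (F := comp N.toFunctor.toProfunctor G.toFunctor.toProfunctor)
        (G := K.toFunctor.toProfunctor) l q)) (hθ a)).symm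
  refine Eq.trans ?_ (congrArg (fun q => ap ((α_ (plus.map N) (plus.map H) (plus.map K)).inv ≫
        plusSq h' ▷ plus.map K)
      (Comp.mk (F := N.toFunctor.toProfunctor)
        (G := comp H.toFunctor.toProfunctor K.toFunctor.toProfunctor) q (𝟙 _)))
      (ap_plusSq h l (eqToHom (e' a)))).symm
  refine Eq.trans ?_ (congrArg (Comp.mk (F := comp M.toFunctor.toProfunctor
      H.toFunctor.toProfunctor) (G := K.toFunctor.toProfunctor) _) (ap_plusSq_id h' a)).symm
  refine Eq.trans ?_ (mk_mk_toProfunctor M.toFunctor.toProfunctor H.toFunctor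
    K.toFunctor.toProfunctor _ _ _).symm
  exact congrArg (fun k => Comp.mk (F := comp M.toFunctor.toProfunctor H.toFunctor.toProfunctor)
    (G := K.toFunctor.toProfunctor) k (Comp.mk (F := M.toFunctor.toProfunctor)
      (G := H.toFunctor.toProfunctor) (𝟙 _) (𝟙 _)))
    (comp_eqToHoms_eq K.toFunctor l _ _ _ _ _ _)

/-- The value of the image of a square under `T̃`, for a square of the form produced by
`toCompPlus`. -/
lemma ap_mapSq {X Y : Cat.{u, u}} {W Z : Prof.{u}} {H : X ⟶ Y} {K : plus.obj Y ⟶ Z}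
    {p : plus.obj X ⟶ W} {b : W ⟶ Z} (σ : p ≫ b ⟶ plus.map H ≫ K)
    (s : ∀ z x, El (comp p b) z x → El K z (H.toFunctor.obj x))
    (hσ : ∀ z x q, ap σ q = Comp.mk (F := H.toFunctor.toProfunctor) (G := K) (s z x q) (𝟙 _))
    {c : BorelCat Λ Z.cat} {d : BorelCat Λ W.cat} {a : BorelCat Λ X}
    (m : El (mapProf Λ b) c d) (r : El (mapProf Λ p) d a) :
    ap (mapSq Λ.tildeOn.toPseudofunctor σ) (Comp.mk (F := mapProf Λ p) (G := mapProf Λ b) m r) =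
      Comp.mk (F := (BorelCat.map H.toFunctor).toProfunctor) (G := mapProf Λ K)
        (y := (BorelCat.map H.toFunctor).obj a)
        (Twist.map (P := fun i j => El (comp p b) (c.letter i) (a.letter j))
          (Q := fun i j => El K (c.letter i) (H.toFunctor.obj (a.letter j)))
          (fun _ _ q => s _ _ q) (pairArr m r)) (𝟙 _) := by
  refine Eq.trans ?_ (Λ.tildeMapComp_hom_mk_id H K (c := c) (a := a) _)
  refine congrArg (ap (Λ.tildeMapComp (plus.map H) K).hom) ?_
  refine Twist.ext' rfl fun i j h h' => ?_
  exact hσ _ _ _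

/-- Compatibility of an element with two triangles, as needed for the naturality of the unit
modifications. -/
lemma mk_plusTri {X X' Y Y' : Cat.{u, u}} {F : X ⟶ X'} {G : X' ⟶ X} (h : F ≫ G = 𝟙 X)
    {F' : Y ⟶ Y'} {G' : Y' ⟶ Y} (h' : F' ≫ G' = 𝟙 Y) (P : Profunctor.{u} X Y) {c : Y} {d : Y'}
    {b : Y} {a : X} (l : c ⟶ G'.toFunctor.obj d) (m : d ⟶ F'.toFunctor.obj b) (r : El P b a)
    (t : El P c (G.toFunctor.obj (F.toFunctor.obj a)))
    (e : post P (eqToHom (congrArg (fun F : X ⟶ X => F.toFunctor.obj a) h)) t =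
      pre P ((l ≫ G'.toFunctor.map m) ≫
        eqToHom (congrArg (fun F : Y ⟶ Y => F.toFunctor.obj b) h')) r) :
    Comp.mk (F := Profunctor.id (C := X)) (G := P) (pre P (ap (plusTri h')
        (Comp.mk (F := F'.toFunctor.toProfunctor) (G := G'.toFunctor.toProfunctor) l m)) r)
        (𝟙 a) =
      Comp.mk (F := Profunctor.id (C := X)) (G := P) t (ap (plusTri h)
        (Comp.mk (F := F.toFunctor.toProfunctor) (G := G.toFunctor.toProfunctor)
          (𝟙 (G.toFunctor.obj (F.toFunctor.obj a))) (𝟙 (F.toFunctor.obj a)))) := by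
  refine (congrArg (fun k => Comp.mk (F := Profunctor.id (C := X)) (G := P) (pre P k r) (𝟙 a))
    (ap_plusTri h' l m)).trans ?_
  refine Eq.trans ?_ (congrArg (Comp.mk (F := Profunctor.id (C := X)) (G := P) t)
    (ap_plusTri_id h a)).symm
  refine Eq.trans ?_ (mk_toProfunctor (𝟭 X) P t _).symm
  exact congrArg (Comp.mk (F := Profunctor.id (C := X)) (G := P) · (𝟙 a)) e.symm

/-- A criterion for the naturality of the unit modifications, in terms of elements. -/
lemma plusTri_naturality {X X' Y Y' : Cat.{u, u}} {F : X ⟶ X'} {G : X' ⟶ X} (h : F ≫ G = 𝟙 X)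
    {F' : Y ⟶ Y'} {G' : Y' ⟶ Y} (h' : F' ≫ G' = 𝟙 Y) (P : plus.obj X ⟶ plus.obj Y)
    (Q : plus.obj X' ⟶ plus.obj Y') (σ : P ≫ plus.map F' ⟶ plus.map F ≫ Q)
    (τ : Q ≫ plus.map G' ⟶ plus.map G ≫ P)
    (s : ∀ (d : Y') (b : Y) (a : X), (d ⟶ F'.toFunctor.obj b) → El P b a →
      El Q d (F.toFunctor.obj a))
    (t : ∀ (d : Y) (b : Y') (a : X'), (d ⟶ G'.toFunctor.obj b) → El Q b a →
      El P d (G.toFunctor.obj a))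
    (hσ : ∀ d b a m r, ap σ (Comp.mk (G := F'.toFunctor.toProfunctor) m r) =
      Comp.mk (F := F.toFunctor.toProfunctor) (s d b a m r) (𝟙 _))
    (hτ : ∀ d b a m r, ap τ (Comp.mk (G := G'.toFunctor.toProfunctor) m r) =
      Comp.mk (F := G.toFunctor.toProfunctor) (t d b a m r) (𝟙 _))
    (e : ∀ (c : Y) (d : Y') (b : Y) (a : X) (l : c ⟶ G'.toFunctor.obj d)
      (m : d ⟶ F'.toFunctor.obj b) (r : El P b a),
      post P (eqToHom (congrArg (fun F : X ⟶ X => F.toFunctor.obj a) h)) (t _ _ _ l (s _ _ _ m r)) =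
        pre P ((l ≫ G'.toFunctor.map m) ≫
          eqToHom (congrArg (fun F : Y ⟶ Y => F.toFunctor.obj b) h')) r) :
    P ◁ plusTri h' ≫ (ρ_ P).hom ≫ (λ_ P).inv = pasteSq σ τ ≫ plusTri h ▷ P := by
  refine Profunctor.hom_ext fun c a p => ?_
  induction p using Comp.ind with | h b q r =>
  induction q using Comp.ind with | h d l m =>
  refine Eq.trans ?_ (congrArg (ap (plusTri h ▷ P))
    (ap_pasteSq σ τ l m r _ _ _ _ (hσ _ _ _ m r) (hτ _ _ _ l _))).symm
  exact mk_plusTri h h' P l m r _ (e _ _ _ _ l m r)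

/-- A criterion for the naturality of the associativity modification, in terms of elements. -/
lemma plusSq_naturality {X₀ X₁ X₂ X₃ Y₀ Y₁ Y₂ Y₃ : Cat.{u, u}} {F : X₀ ⟶ X₁} {G : X₁ ⟶ X₃}
    {H : X₀ ⟶ X₂} {K : X₂ ⟶ X₃} (h : F ≫ G = H ≫ K) {F' : Y₀ ⟶ Y₁} {G' : Y₁ ⟶ Y₃}
    {H' : Y₀ ⟶ Y₂} {K' : Y₂ ⟶ Y₃} (h' : F' ≫ G' = H' ≫ K')
    (P₀ : plus.obj X₀ ⟶ plus.obj Y₀) (P₁ : plus.obj X₁ ⟶ plus.obj Y₁)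
    (P₂ : plus.obj X₂ ⟶ plus.obj Y₂) (P₃ : plus.obj X₃ ⟶ plus.obj Y₃)
    (σ : P₀ ≫ plus.map F' ⟶ plus.map F ≫ P₁) (τ : P₁ ≫ plus.map G' ⟶ plus.map G ≫ P₃)
    (σ' : P₀ ≫ plus.map H' ⟶ plus.map H ≫ P₂) (τ' : P₂ ≫ plus.map K' ⟶ plus.map K ≫ P₃)
    (s : ∀ (d : Y₁) (b : Y₀) (a : X₀), (d ⟶ F'.toFunctor.obj b) → El P₀ b a →
      El P₁ d (F.toFunctor.obj a))
    (t : ∀ (d : Y₃) (b : Y₁) (a : X₁), (d ⟶ G'.toFunctor.obj b) → El P₁ b a →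
      El P₃ d (G.toFunctor.obj a))
    (s' : ∀ (d : Y₂) (b : Y₀) (a : X₀), (d ⟶ H'.toFunctor.obj b) → El P₀ b a →
      El P₂ d (H.toFunctor.obj a))
    (t' : ∀ (d : Y₃) (b : Y₂) (a : X₂), (d ⟶ K'.toFunctor.obj b) → El P₂ b a →
      El P₃ d (K.toFunctor.obj a))
    (hσ : ∀ d b a m r, ap σ (Comp.mk (G := F'.toFunctor.toProfunctor) m r) =
      Comp.mk (F := F.toFunctor.toProfunctor) (s d b a m r) (𝟙 _))
    (hτ : ∀ d b a m r, ap τ (Comp.mk (G := G'.toFunctor.toProfunctor) m r) =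
      Comp.mk (F := G.toFunctor.toProfunctor) (t d b a m r) (𝟙 _))
    (hσ' : ∀ d b a m r, ap σ' (Comp.mk (G := H'.toFunctor.toProfunctor) m r) =
      Comp.mk (F := H.toFunctor.toProfunctor) (s' d b a m r) (𝟙 _))
    (hτ' : ∀ d b a m r, ap τ' (Comp.mk (G := K'.toFunctor.toProfunctor) m r) =
      Comp.mk (F := K.toFunctor.toProfunctor) (t' d b a m r) (𝟙 _))
    (e : ∀ (c : Y₃) (d : Y₁) (b : Y₀) (a : X₀) (l : c ⟶ G'.toFunctor.obj d)
      (m : d ⟶ F'.toFunctor.obj b) (r : El P₀ b a),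
      post P₃ (eqToHom (congrArg (fun F : X₀ ⟶ X₃ => F.toFunctor.obj a) h))
          (t _ _ _ l (s _ _ _ m r)) =
        t' _ _ _ ((l ≫ G'.toFunctor.map m) ≫
          eqToHom (congrArg (fun F : Y₀ ⟶ Y₃ => F.toFunctor.obj b) h')) (s' _ _ _ (𝟙 _) r)) :
    P₀ ◁ plusSq h' ≫ pasteSq σ' τ' = pasteSq σ τ ≫ plusSq h ▷ P₃ := by
  refine Profunctor.hom_ext fun c a p => ?_
  induction p using Comp.ind with | h b q r =>
  induction q using Comp.ind with | h d l m =>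
  refine Eq.trans ?_ (congrArg (ap (plusSq h ▷ P₃))
    (ap_pasteSq σ τ l m r _ _ _ _ (hσ _ _ _ m r) (hτ _ _ _ l _))).symm
  refine Eq.trans (congrArg (fun q => ap (pasteSq σ' τ')
    (Comp.mk (G := comp H'.toFunctor.toProfunctor K'.toFunctor.toProfunctor) q r))
    (ap_plusSq h' l m)) ?_
  refine Eq.trans (ap_pasteSq σ' τ' _ _ r _ _ _ _ (hσ' _ _ _ (𝟙 _) r) (hτ' _ _ _ _ _)) ?_
  refine Eq.trans ?_ (congrArg (Comp.mk (F := comp H.toFunctor.toProfunctor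
    K.toFunctor.toProfunctor) (G := P₃) (t _ _ _ l (s _ _ _ m r))) (ap_plusSq_id h a)).symm
  refine Eq.trans ?_ (mk_mk_toProfunctor H.toFunctor.toProfunctor K.toFunctor P₃ _ _ _).symm
  exact congrArg (fun k => Comp.mk (F := comp H.toFunctor.toProfunctor K.toFunctor.toProfunctor)
    (G := P₃) k (Comp.mk (F := H.toFunctor.toProfunctor) (G := K.toFunctor.toProfunctor) (𝟙 _)
      (𝟙 _))) (e _ _ _ _ l m r).symm

variable (Λ)

lemma tilde_assoc_naturality {X Y : Prof.{u}} (F : X ⟶ Y) :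
    Λ.tildeOn.toPseudofunctor.map (Λ.tildeOn.toPseudofunctor.map
        (Λ.tildeOn.toPseudofunctor.map F)) ◁ (plusSqIso (Λ.borel.map_mult_mult Y.cat)).hom ≫
        pasteSq (multNat Λ.tildeMultOn.toStrongTrans (Λ.tildeOn.toPseudofunctor.map F)).hom
          (multNat Λ.tildeMultOn.toStrongTrans F).hom =
      pasteSq (mapSq Λ.tildeOn.toPseudofunctor (multNat Λ.tildeMultOn.toStrongTrans F).hom)
          (multNat Λ.tildeMultOn.toStrongTrans F).hom ≫
        (plusSqIso (Λ.borel.map_mult_mult X.cat)).hom ▷ Λ.tildeOn.toPseudofunctor.map F :=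
  plusSq_naturality (Λ.borel.map_mult_mult X.cat) (Λ.borel.map_mult_mult Y.cat)
    (mapProf Λ (mapProf Λ (mapProf Λ F))) (mapProf Λ (mapProf Λ F)) (mapProf Λ (mapProf Λ F))
    (mapProf Λ F) _ _ _ _
    (fun _ _ _ m r => pre (mapProf Λ (mapProf Λ F)) m (mapMultArr F r))
    (fun _ _ _ m r => pre (mapProf Λ F) m (multArr F r))
    (fun _ _ _ m r => pre (mapProf Λ (mapProf Λ F)) m (multArr (mapProf Λ F) r))
    (fun _ _ _ m r => pre (mapProf Λ F) m (multArr F r))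
    (fun _ _ _ m r => ap_mapSq (H := Λ.borel.mult X.cat) (K := Λ.tilde.map F)
      (Λ.tildeMultNat F).hom (multSqMap F) (fun _ _ _ => rfl) m r)
    (fun _ _ _ _ _ => rfl) (fun _ _ _ _ _ => rfl) (fun _ _ _ _ _ => rfl)
    (fun _ _ _ _ l m r =>
      ((congrArg (post (mapProf Λ F) _) (pre_multArr_pre F l m (mapMultArr F r))).trans
        (post_pre_eq (mapProf Λ F) (multArr_mapMultArr r _ _)
          (l ≫ (BorelCat.mult Λ Y.cat).map m))).trans
        (congrArg (fun q => pre (mapProf Λ F) _ (multArr F q))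
          (pre_id (mapProf Λ (mapProf Λ F)) (multArr (mapProf Λ F) r)).symm))

lemma tilde_left_naturality {X Y : Prof.{u}} (F : X ⟶ Y) :
    Λ.tildeOn.toPseudofunctor.map F ◁ (plusTriIso (Λ.borel.unit_mult Y.cat)).hom ≫
        (ρ_ (Λ.tildeOn.toPseudofunctor.map F)).hom ≫
        (λ_ (Λ.tildeOn.toPseudofunctor.map F)).inv =
      pasteSq (unitNat Λ.tildeUnitOn.toStrongTrans (Λ.tildeOn.toPseudofunctor.map F)).hom
          (multNat Λ.tildeMultOn.toStrongTrans F).hom ≫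
        (plusTriIso (Λ.borel.unit_mult X.cat)).hom ▷ Λ.tildeOn.toPseudofunctor.map F :=
  plusTri_naturality (Λ.borel.unit_mult X.cat) (Λ.borel.unit_mult Y.cat)
    (mapProf Λ F) (mapProf Λ (mapProf Λ F)) _ _
    (fun _ _ _ m r => pre (mapProf Λ (mapProf Λ F)) m (unitArr (mapProf Λ F) r))
    (fun _ _ _ m r => pre (mapProf Λ F) m (multArr F r))
    (fun _ _ _ _ _ => rfl) (fun _ _ _ _ _ => rfl)
    (fun _ _ _ _ l m r =>
      (congrArg (post (mapProf Λ F) _) (pre_multArr_pre F l m (unitArr (mapProf Λ F) r))).trans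
        (post_pre_eq (mapProf Λ F) (multArr_unitArr r _ _) (l ≫ (BorelCat.mult Λ Y.cat).map m)))

lemma tilde_right_naturality {X Y : Prof.{u}} (F : X ⟶ Y) :
    Λ.tildeOn.toPseudofunctor.map F ◁ (plusTriIso (Λ.borel.map_unit_mult Y.cat)).hom ≫
        (ρ_ (Λ.tildeOn.toPseudofunctor.map F)).hom ≫
        (λ_ (Λ.tildeOn.toPseudofunctor.map F)).inv =
      pasteSq (mapSq Λ.tildeOn.toPseudofunctor (unitNat Λ.tildeUnitOn.toStrongTrans F).hom)
          (multNat Λ.tildeMultOn.toStrongTrans F).hom ≫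
        (plusTriIso (Λ.borel.map_unit_mult X.cat)).hom ▷ Λ.tildeOn.toPseudofunctor.map F :=
  plusTri_naturality (Λ.borel.map_unit_mult X.cat) (Λ.borel.map_unit_mult Y.cat)
    (mapProf Λ F) (mapProf Λ (mapProf Λ F)) _ _
    (fun _ _ _ m r => pre (mapProf Λ (mapProf Λ F)) m (mapUnitArr F r))
    (fun _ _ _ m r => pre (mapProf Λ F) m (multArr F r))
    (fun _ _ _ m r => ap_mapSq (H := Λ.borel.unit X.cat) (K := Λ.tilde.map F)
      (Λ.tildeUnitNat F).hom (unitSqMap F) (fun _ _ _ => rfl) m r)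
    (fun _ _ _ _ _ => rfl)
    (fun _ _ _ _ l m r =>
      (congrArg (post (mapProf Λ F) _) (pre_multArr_pre F l m (mapUnitArr F r))).trans
        (post_pre_eq (mapProf Λ F) (multArr_mapUnitArr r _ _) (l ≫ (BorelCat.mult Λ Y.cat).map m)))

end ActionOperad

/-! ### The coherence axioms -/

namespace BorelCat

lemma diagHom_eqToHom {Λ : ActionOperad.{u}} {X : Type u} [SmallCategory X] {n : ℕ}
    {x y : Fin n → X} (h : ∀ i, x i = y i) (h' : (⟨n, x⟩ : BorelCat Λ X) = ⟨n, y⟩) :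
    diagHom (fun i => eqToHom (h i)) = eqToHom h' := by
  obtain rfl : x = y := funext h
  rfl

end BorelCat

namespace ActionOperad

open Profunctor BorelCat

variable {Λ : ActionOperad.{u}}

/-- The image of `plusTri h` under `T̃` comes from the equality `T(F ≫ G) = 1`. -/
lemma ap_mapTri_id {X Y : Cat.{u, u}} {F : X ⟶ Y} {G : Y ⟶ X} (h : F ≫ G = 𝟙 X)
    (a : BorelCat Λ X) :
    ap ((Λ.tildeOn.toPseudofunctor.mapComp (plus.map F) (plus.map G)).inv ≫
        Λ.tildeOn.toPseudofunctor.map₂ (plusTri h) ≫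
          (Λ.tildeOn.toPseudofunctor.mapId (plus.obj X)).hom)
      (Comp.mk (F := (BorelCat.map F.toFunctor).toProfunctor)
        (G := (BorelCat.map G.toFunctor).toProfunctor)
        (𝟙 ((BorelCat.map G.toFunctor).obj ((BorelCat.map F.toFunctor).obj a)))
        (𝟙 ((BorelCat.map F.toFunctor).obj a))) =
      eqToHom (X := (BorelCat.map G.toFunctor).obj ((BorelCat.map F.toFunctor).obj a)) (Y := a)
        (congrArg (fun x => (⟨a.len, x⟩ : BorelCat Λ X))
        (funext fun i => congrArg (fun F : X ⟶ X => F.toFunctor.obj (a.letter i)) h)) := by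
  refine Eq.trans (congrArg (ap (mapProf₂ Λ (plusTri h))) (pairArr_diagArr
    (G := G.toFunctor.toProfunctor) (F := F.toFunctor.toProfunctor)
    (fun i => 𝟙 (G.toFunctor.obj (F.toFunctor.obj (a.letter i))))
    (fun i => 𝟙 (F.toFunctor.obj (a.letter i))))) ?_
  refine (mapProf₂_diagArr (plusTri h) _).trans ?_
  refine Eq.trans ?_ (diagHom_eqToHom
    (fun i => congrArg (fun F : X ⟶ X => F.toFunctor.obj (a.letter i)) h) _)
  exact congrArg (diagArr _) (funext fun i => ap_plusTri_id h (a.letter i))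

/-- The image of `plusSq h` under `T̃` comes from the equality `T(F ≫ G) = T(H ≫ K)`. -/
lemma ap_mapSq_plusSq_id {X Y Y' Z : Cat.{u, u}} {F : X ⟶ Y} {G : Y ⟶ Z} {H : X ⟶ Y'}
    {K : Y' ⟶ Z} (h : F ≫ G = H ≫ K) (a : BorelCat Λ X) :
    ap (mapSq Λ.tildeOn.toPseudofunctor (plusSq h))
      (Comp.mk (F := (BorelCat.map F.toFunctor).toProfunctor)
        (G := (BorelCat.map G.toFunctor).toProfunctor)
        (𝟙 ((BorelCat.map G.toFunctor).obj ((BorelCat.map F.toFunctor).obj a)))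
        (𝟙 ((BorelCat.map F.toFunctor).obj a))) =
      Comp.mk (F := (BorelCat.map H.toFunctor).toProfunctor)
        (G := (BorelCat.map K.toFunctor).toProfunctor) (y := (BorelCat.map H.toFunctor).obj a)
        (eqToHom (X := (BorelCat.map G.toFunctor).obj ((BorelCat.map F.toFunctor).obj a))
          (congrArg (fun x => (⟨a.len, x⟩ : BorelCat Λ Z))
          (funext fun i => congrArg (fun F : X ⟶ Z => F.toFunctor.obj (a.letter i)) h))) (𝟙 _) := by
  refine Eq.trans (ap_mapSq (H := H) (K := plus.map K) (plusSq h)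
    (fun _ _ q => ap ((plus.mapComp F G).inv ≫ plus.map₂ (eqToHom h)) q) (fun _ _ _ => rfl)
    (𝟙 ((BorelCat.map G.toFunctor).obj ((BorelCat.map F.toFunctor).obj a)))
    (𝟙 ((BorelCat.map F.toFunctor).obj a))) ?_
  refine congrArg (Comp.mk (F := (BorelCat.map H.toFunctor).toProfunctor)
    (G := (BorelCat.map K.toFunctor).toProfunctor) · (𝟙 _)) ?_
  refine Eq.trans (congrArg (ap (mapProf₂ Λ ((plus.mapComp F G).inv ≫ plus.map₂ (eqToHom h))))
    (pairArr_diagArr (G := G.toFunctor.toProfunctor) (F := F.toFunctor.toProfunctor)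
      (fun i => 𝟙 (G.toFunctor.obj (F.toFunctor.obj (a.letter i))))
      (fun i => 𝟙 (F.toFunctor.obj (a.letter i))))) ?_
  refine (mapProf₂_diagArr ((plus.mapComp F G).inv ≫ plus.map₂ (eqToHom h)) _).trans ?_
  refine Eq.trans ?_ (diagHom_eqToHom
    (fun i => congrArg (fun F : X ⟶ Z => F.toFunctor.obj (a.letter i)) h) _)
  refine congrArg (diagArr _) (funext fun i => ?_)
  refine (id_comp_map_id_comp G.toFunctor ((eqToHom h).toNatTrans.app (a.letter i))).trans ?_
  exact cat_eqToHom_app h (a.letter i)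

/-- The naturality square of `μ⁺` at a functor comes from the strict naturality of `μ`. -/
lemma ap_multSq_id {X Y : Cat.{u, u}} (G : X ⟶ Y) (a : BorelCat Λ (BorelCat Λ X)) :
    ap (multSq Λ (X := X) (Y := Y) (plus.map G))
      (Comp.mk (F := (BorelCat.map (BorelCat.map G.toFunctor)).toProfunctor)
        (G := (BorelCat.mult Λ Y).toProfunctor)
        (𝟙 ((BorelCat.mult Λ Y).obj ((BorelCat.map (BorelCat.map G.toFunctor)).obj a)))
        (𝟙 ((BorelCat.map (BorelCat.map G.toFunctor)).obj a))) =
      Comp.mk (F := (BorelCat.mult Λ X).toProfunctor)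
        (G := (BorelCat.map G.toFunctor).toProfunctor) (y := (BorelCat.mult Λ X).obj a)
        (𝟙 ((BorelCat.map G.toFunctor).obj ((BorelCat.mult Λ X).obj a))) (𝟙 _) :=
  congrArg (Comp.mk (F := (BorelCat.mult Λ X).toProfunctor)
    (G := (BorelCat.map G.toFunctor).toProfunctor) · (𝟙 _))
    ((pre_id (mapProf Λ (plus.map G)) (multArr (plus.map G) _)).trans
      ((BorelCat.mult Λ Y).map_id ((BorelCat.map (BorelCat.map G.toFunctor)).obj a)))

/-- The first coherence axiom only depends on the 1-cells and 2-cells up to equality; this passes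
from the 1-cells `T̃(η⁺)`, `T̃(μ⁺)` to `(Tη)⁺`, `(Tμ)⁺`. -/
lemma unit_coherence_of_heq {A B D : Prof.{u}} {f f' : A ⟶ B} {g g' k k' : B ⟶ A} {l l' : A ⟶ D}
    {σ : g ≫ l ⟶ k ≫ l} {σ' : g' ≫ l' ⟶ k' ≫ l'} {ρ : f ≫ k ⟶ 𝟙 A} {ρ' : f' ≫ k' ⟶ 𝟙 A}
    {τ : f ≫ g ⟶ 𝟙 A} {τ' : f' ≫ g' ⟶ 𝟙 A}
    (h : f' ◁ σ' ≫ (α_ _ _ _).inv ≫ ρ' ▷ l' ≫ (λ_ l').hom =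
      (α_ _ _ _).inv ≫ τ' ▷ l' ≫ (λ_ l').hom)
    (hf : f = f') (hg : g = g') (hk : k = k') (hl : l = l') (hσ : HEq σ σ') (hρ : HEq ρ ρ')
    (hτ : HEq τ τ') :
    f ◁ σ ≫ (α_ _ _ _).inv ≫ ρ ▷ l ≫ (λ_ l).hom = (α_ _ _ _).inv ≫ τ ▷ l ≫ (λ_ l).hom := by
  subst hf hg hk hl
  obtain rfl := eq_of_heq hσ
  obtain rfl := eq_of_heq hρ
  obtain rfl := eq_of_heq hτ
  exact h

/-- The second coherence axiom only depends on the 1-cells and 2-cells up to equality; this passes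
from the 1-cells `T̃(μ⁺)`, `T̃T̃(μ⁺)` to `(Tμ)⁺`, `(TTμ)⁺`. -/
lemma assoc_coherence_of_heq {A B C D : Prof.{u}} {f m n f' m' n' : A ⟶ B} {g k g' k' : B ⟶ C}
    {l l' : C ⟶ D} {σ : g ≫ l ⟶ k ≫ l} {τ : n ≫ k ⟶ m ≫ k} {ν : f ≫ k ⟶ m ≫ g}
    {θ : f ≫ g ⟶ n ≫ g} {σ' : g' ≫ l' ⟶ k' ≫ l'} {τ' : n' ≫ k' ⟶ m' ≫ k'}
    {ν' : f' ≫ k' ⟶ m' ≫ g'} {θ' : f' ≫ g' ⟶ n' ≫ g'}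
    (h : f' ◁ σ' ≫ (α_ _ _ _).inv ≫ ν' ▷ l' ≫ (α_ _ _ _).hom ≫ m' ◁ σ' ≫ (α_ _ _ _).inv =
      (α_ _ _ _).inv ≫ θ' ▷ l' ≫ (α_ _ _ _).hom ≫ n' ◁ σ' ≫ (α_ _ _ _).inv ≫ τ' ▷ l')
    (hf : f = f') (hm : m = m') (hn : n = n') (hg : g = g') (hk : k = k') (hl : l = l')
    (hσ : HEq σ σ') (hτ : HEq τ τ') (hν : HEq ν ν') (hθ : HEq θ θ') :
    f ◁ σ ≫ (α_ _ _ _).inv ≫ ν ▷ l ≫ (α_ _ _ _).hom ≫ m ◁ σ ≫ (α_ _ _ _).inv =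
      (α_ _ _ _).inv ≫ θ ▷ l ≫ (α_ _ _ _).hom ≫ n ◁ σ ≫ (α_ _ _ _).inv ≫ τ ▷ l := by
  subst hf hm hn hg hk hl
  obtain rfl := eq_of_heq hσ
  obtain rfl := eq_of_heq hτ
  obtain rfl := eq_of_heq hν
  obtain rfl := eq_of_heq hθ
  exact h

variable (Λ)

set_option maxHeartbeats 1000000 in
/-- The first coherence axiom, with all 1-cells written as images under `(-)⁺`. -/
lemma plusSq_unit_coherence (X : Cat.{u, u})
    (τ : plus.map (Λ.borel.T.map (Λ.borel.unit (Λ.borel.T.obj X))) ≫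
      plus.map (Λ.borel.T.map (Λ.borel.mult X)) ⟶
        𝟙 (plus.obj (Λ.borel.T.obj (Λ.borel.T.obj X))))
    (hτ : τ = (Λ.tildeOn.toPseudofunctor.mapComp
          (unitApp Λ.tildeUnitOn.toStrongTrans (Λ.tilde.obj ⟨X⟩))
          (multApp Λ.tildeMultOn.toStrongTrans ⟨X⟩)).inv ≫
        Λ.tildeOn.toPseudofunctor.map₂ (plusTri (Λ.borel.unit_mult X)) ≫
          (Λ.tildeOn.toPseudofunctor.mapId (Λ.tilde.obj ⟨X⟩)).hom) :
    plus.map (Λ.borel.T.map (Λ.borel.unit (Λ.borel.T.obj X))) ◁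
        plusSq (Λ.borel.map_mult_mult X) ≫ (α_ _ _ _).inv ≫
        plusTri (Λ.borel.map_unit_mult (Λ.borel.T.obj X)) ▷ plus.map (Λ.borel.mult X) ≫
        (λ_ (plus.map (Λ.borel.mult X))).hom =
      (α_ _ _ _).inv ≫ τ ▷ plus.map (Λ.borel.mult X) ≫
        (λ_ (plus.map (Λ.borel.mult X))).hom :=
  plus_unit_coherence (Λ.borel.map_mult_mult X)
    (Λ.borel.map_unit_mult (Λ.borel.T.obj X)) τ
    (fun a => congrArg (fun x => (⟨a.len, x⟩ : BorelCat Λ (Λ.borel.T.obj X)))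
      (funext fun i => congrArg
        (fun F : Λ.borel.T.obj X ⟶ Λ.borel.T.obj X => F.toFunctor.obj (a.letter i))
        (Λ.borel.unit_mult X)))
    (fun a => by
      subst hτ
      exact ap_mapTri_id (Λ.borel.unit_mult X) a)

set_option maxHeartbeats 1000000 in
/-- The second coherence axiom, with all 1-cells written as images under `(-)⁺`. -/
lemma plusSq_assoc_coherence (X : Cat.{u, u})
    (θ : plus.map (Λ.borel.T.map (Λ.borel.T.map (Λ.borel.mult X))) ≫
      plus.map (Λ.borel.T.map (Λ.borel.mult X)) ⟶
        plus.map (Λ.borel.T.map (Λ.borel.mult (Λ.borel.T.obj X))) ≫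
          plus.map (Λ.borel.T.map (Λ.borel.mult X)))
    (hθ : θ = mapSq Λ.tildeOn.toPseudofunctor (plusSq (Λ.borel.map_mult_mult X)))
    (ν : plus.map (Λ.borel.T.map (Λ.borel.T.map (Λ.borel.mult X))) ≫
      plus.map (Λ.borel.mult (Λ.borel.T.obj X)) ⟶
        plus.map (Λ.borel.mult (Λ.borel.T.obj (Λ.borel.T.obj X))) ≫
          plus.map (Λ.borel.T.map (Λ.borel.mult X)))
    (hν : ν = multSq Λ (BorelCat.mult Λ X).toProfunctor) :
    plus.map (Λ.borel.T.map (Λ.borel.T.map (Λ.borel.mult X))) ◁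
        plusSq (Λ.borel.map_mult_mult X) ≫ (α_ _ _ _).inv ≫
        ν ▷ plus.map (Λ.borel.mult X) ≫ (α_ _ _ _).hom ≫
        plus.map (Λ.borel.mult (Λ.borel.T.obj (Λ.borel.T.obj X))) ◁
          plusSq (Λ.borel.map_mult_mult X) ≫ (α_ _ _ _).inv =
      (α_ _ _ _).inv ≫ θ ▷ plus.map (Λ.borel.mult X) ≫ (α_ _ _ _).hom ≫
        plus.map (Λ.borel.T.map (Λ.borel.mult (Λ.borel.T.obj X))) ◁
          plusSq (Λ.borel.map_mult_mult X) ≫ (α_ _ _ _).inv ≫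
        plusSq (Λ.borel.map_mult_mult (Λ.borel.T.obj X)) ▷ plus.map (Λ.borel.mult X) :=
  plus_assoc_coherence (Λ.borel.map_mult_mult X)
    (Λ.borel.map_mult_mult (Λ.borel.T.obj X)) ν θ (fun _ => rfl)
    (fun a => congrArg (fun x => (⟨a.len, x⟩ : BorelCat Λ (Λ.borel.T.obj X)))
      (funext fun i => congrArg
        (fun F : Λ.borel.T.obj (Λ.borel.T.obj (Λ.borel.T.obj X)) ⟶ Λ.borel.T.obj X =>
          F.toFunctor.obj (a.letter i))
        (Λ.borel.map_mult_mult X)))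
    (fun a => by
      subst hν
      exact ap_multSq_id (Λ.borel.mult X) a)
    (fun a => by
      subst hθ
      exact ap_mapSq_plusSq_id (Λ.borel.map_mult_mult X) a)

set_option maxHeartbeats 1000000 in
/-- The associativity, left unit and right unit modifications. -/
noncomputable def tildePseudomonadOn :
    PseudomonadOn Λ.tildeUnitOn.toStrongTrans Λ.tildeMultOn.toStrongTrans where
  assoc X := plusSqIso (Λ.borel.map_mult_mult X.cat)
  left X := plusTriIso (Λ.borel.unit_mult X.cat)
  right X := plusTriIso (Λ.borel.map_unit_mult X.cat)
  assoc_naturality F := Λ.tilde_assoc_naturality F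
  left_naturality F := Λ.tilde_left_naturality F
  right_naturality F := Λ.tilde_right_naturality F
  unit_coherence X := unit_coherence_of_heq (Λ.plusSq_unit_coherence X.cat _ rfl)
    rfl rfl rfl rfl HEq.rfl HEq.rfl HEq.rfl
  assoc_coherence X := assoc_coherence_of_heq (Λ.plusSq_assoc_coherence X.cat _ rfl _ rfl)
    rfl rfl rfl rfl rfl rfl HEq.rfl HEq.rfl HEq.rfl HEq.rfl

end ActionOperad

/-! ### Compatibility with `(-)⁺` -/

section

universe w₁ w₂ v₁ v₂ u₁ u₂

variable {B : Type u₁} [Bicategory.{w₁, v₁} B] {C : Type u₂} [Bicategory.{w₂, v₂} C]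

/-! The 2-cells `plusIso` come from equalities of 1-cells, and disappear once 2-cells are compared
by heterogeneous equality. -/

lemma eqToIso_whiskerRight_comp_of_heq {a b c : B} {f f' : a ⟶ b} {g : b ⟶ c} {p : a ⟶ c}
    {x : f ≫ g ⟶ p} {y : f' ≫ g ⟶ p} (hf : f = f') (h : HEq x y) :
    x = (eqToIso hf).hom ▷ g ≫ y := by
  subst hf
  simpa using h

lemma comp_whiskerLeft_eqToIso_of_heq {a b c : B} {f : a ⟶ b} {g g' : b ⟶ c} {p : a ⟶ c}
    {x : p ⟶ f ≫ g} {y : p ⟶ f ≫ g'} (hg : g = g') (h : HEq x y) :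
    x ≫ f ◁ (eqToIso hg).hom = y := by
  subst hg
  simpa using h

lemma comp_whisker_eqToIso_of_heq {a b c : B} {f f' : a ⟶ b} {g g' : b ⟶ c} {p : a ⟶ c}
    {x : p ⟶ f ≫ g} {y : p ⟶ f' ≫ g'} (hf : f = f') (hg : g = g') (h : HEq x y) :
    x ≫ (eqToIso hf).hom ▷ g ≫ f' ◁ (eqToIso hg).hom = y := by
  subst hf hg
  simpa using h

lemma comp_whiskerLeft_eqToIso_map_of_heq (P : PrelaxFunctor B C) {a b : B} {a' b' : C}
    {f f' : a ⟶ b} {k : P.obj a ⟶ P.obj b} {m : P.obj b ⟶ b'} {m' : P.obj a ⟶ a'}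
    {g g' : a' ⟶ b'} {x : P.map f ≫ m ⟶ m' ≫ g} {y : k ≫ m ⟶ m' ≫ g'} (hf : f = f')
    (hk : P.map f' = k) (hg : g = g') (h : HEq x y) :
    x ≫ m' ◁ (eqToIso hg).hom =
      (P.map₂ (eqToIso hf).hom ≫ (eqToIso hk).hom) ▷ m ≫ y := by
  subst hf hk hg
  simpa using h

end

namespace ActionOperad

open Profunctor BorelCat

variable (Λ : ActionOperad.{u})

/-- A 2-cell between composites of functors is determined by its values at pairs of identities. -/
lemma plusSq_eq {X Y Y' Z : Cat.{u, u}} {F : X ⟶ Y} {G : Y ⟶ Z} {H : X ⟶ Y'} {K : Y' ⟶ Z}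
    (h : F ≫ G = H ≫ K) (σ : plus.map F ≫ plus.map G ⟶ plus.map H ≫ plus.map K)
    (hσ : ∀ x : X, ap σ (Comp.mk (F := F.toFunctor.toProfunctor) (G := G.toFunctor.toProfunctor)
      (𝟙 (G.toFunctor.obj (F.toFunctor.obj x))) (𝟙 (F.toFunctor.obj x))) =
      Comp.mk (F := H.toFunctor.toProfunctor) (G := K.toFunctor.toProfunctor)
        (y := H.toFunctor.obj x) (eqToHom (congrArg (fun F : X ⟶ Z => F.toFunctor.obj x) h))
        (𝟙 _)) : σ = plusSq h := by
  refine Profunctor.hom_ext fun c a p => ?_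
  obtain ⟨(k : c ⟶ _), rfl⟩ := (mk_id_bijective F.toFunctor G.toFunctor.toProfunctor c a).2 p
  have e : Comp.mk (F := F.toFunctor.toProfunctor) (G := G.toFunctor.toProfunctor) k
      (𝟙 (F.toFunctor.obj a)) = pre (comp F.toFunctor.toProfunctor G.toFunctor.toProfunctor) k
        (Comp.mk (F := F.toFunctor.toProfunctor) (G := G.toFunctor.toProfunctor)
          (𝟙 (G.toFunctor.obj (F.toFunctor.obj a))) (𝟙 (F.toFunctor.obj a))) :=
    congrArg (Comp.mk (F := F.toFunctor.toProfunctor) (G := G.toFunctor.toProfunctor) ·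
      (𝟙 (F.toFunctor.obj a))) (Category.comp_id k).symm
  refine (congrArg (ap σ) e).trans ((ap_pre σ k _).trans ?_)
  refine Eq.trans ?_ ((congrArg (ap (plusSq h)) e).trans (ap_pre (plusSq h) k _)).symm
  exact congrArg (pre (comp H.toFunctor.toProfunctor K.toFunctor.toProfunctor) k)
    ((hσ a).trans (ap_plusSq_id h a).symm)

lemma tilde_map₂_plus {X Y : Cat.{u, u}} {F G : X ⟶ Y} (α : F ⟶ G) :
    Λ.tilde.map₂ (plus.map₂ α) = plus.map₂ (Λ.borel.T.map₂ α) :=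
  Profunctor.hom_ext fun _ _ p => (comp_diagHom _ p).symm

lemma tildeOn_mapId_plus (X : Cat.{u, u}) :
    Λ.tilde.map₂ (plus.mapId X).hom ≫ (Λ.tildeOn.mapId (plus.obj X)).hom =
      plus.map₂ (Λ.borel.T.mapId X).hom ≫ (plus.mapId (Λ.borel.T.obj X)).hom := by
  refine Profunctor.hom_ext fun c a p => ?_
  exact ((congrArg (p ≫ ·) (cat_eqToHom_app (Λ.borelFunctor.map_id X) a)).trans
    (Category.comp_id (obj := BorelCat Λ X) (X := c) (Y := a) p)).symm

lemma tildeOn_mapComp_plus {X Y Z : Cat.{u, u}} (F : X ⟶ Y) (G : Y ⟶ Z) :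
    Λ.tilde.map₂ (plus.mapComp F G).hom ≫ (Λ.tildeOn.mapComp (plus.map F) (plus.map G)).hom =
      plus.map₂ (Λ.borel.T.mapComp F G).hom ≫
        (plus.mapComp (Λ.borel.T.map F) (Λ.borel.T.map G)).hom := by
  refine Profunctor.hom_ext fun c a p => ?_
  refine (Λ.tildeMapComp_hom_mk_id F (plus.map G) (c := c) (a := a) p).trans ?_
  refine congrArg (Comp.mk (F := (BorelCat.map F.toFunctor).toProfunctor)
    (G := (BorelCat.map G.toFunctor).toProfunctor) · (𝟙 _)) ?_
  exact ((congrArg (p ≫ ·) (cat_eqToHom_app (Λ.borelFunctor.map_comp F G) a)).trans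
    (Category.comp_id (obj := BorelCat Λ Z) (X := c)
      (Y := (BorelCat.map G.toFunctor).obj ((BorelCat.map F.toFunctor).obj a)) p)).symm

lemma tildeUnitNat_plus {X Y : Cat.{u, u}} (G : X ⟶ Y) :
    (Λ.tildeUnitNat (plus.map G)).hom = plusSq (Λ.borel.unit_naturality G) :=
  plusSq_eq (F := G) (G := Λ.borel.unit Y) (H := Λ.borel.unit X) (K := Λ.borel.T.map G) _ _
    fun _ => congrArg (Comp.mk (F := (BorelCat.unit Λ X).toProfunctor)
      (G := (BorelCat.map G.toFunctor).toProfunctor) · (𝟙 _))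
      (pre_id (mapProf Λ (plus.map G)) _)

lemma tildeMultNat_plus {X Y : Cat.{u, u}} (G : X ⟶ Y) :
    (Λ.tildeMultNat (plus.map G)).hom = plusSq (Λ.borel.mult_naturality G) :=
  plusSq_eq (F := Λ.borel.T.map (Λ.borel.T.map G)) (G := Λ.borel.mult Y)
    (H := Λ.borel.mult X) (K := Λ.borel.T.map G) _ _ fun x => ap_multSq_id G x

theorem tilde_isLift : IsLift Λ.tildeOn Λ.tildeUnitOn Λ.tildeMultOn Λ.tildePseudomonadOn where
  map₂ α := (Category.comp_id _).trans ((Λ.tilde_map₂_plus α).trans (Category.id_comp _).symm)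
  mapId X := (Λ.tildeOn_mapId_plus X).trans (Category.id_comp _).symm
  mapComp F G :=
    (Category.assoc _ _ _).symm.trans ((comp_whisker_eqToIso_of_heq (Λ.tilde_plus F)
      (Λ.tilde_plus G) (heq_of_eq (Λ.tildeOn_mapComp_plus F G))).trans (Category.id_comp _).symm)
  unit G := comp_whiskerLeft_eqToIso_of_heq (Λ.tilde_plus G) (heq_of_eq (Λ.tildeUnitNat_plus G))
  mult G := comp_whiskerLeft_eqToIso_map_of_heq Λ.tilde (Λ.tilde_plus G)
    (Λ.tilde_plus (Λ.borel.T.map G)) (Λ.tilde_plus G) (heq_of_eq (Λ.tildeMultNat_plus G))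
  assoc X := eqToIso_whiskerRight_comp_of_heq (Λ.tilde_plus (Λ.borel.mult X)) HEq.rfl
  left _ := rfl
  right X := eqToIso_whiskerRight_comp_of_heq (Λ.tilde_plus (Λ.borel.unit X)) HEq.rfl

end ActionOperad

theorem mainTheorem7 (Λ : ActionOperad.{u}) :
    ∃ (c : PseudofunctorOn Λ.tilde)
      (η : StrongTransOn (Pseudofunctor.id Prof.{u}) c.toPseudofunctor Λ.tildeUnit)
      (μ : StrongTransOn (c.toPseudofunctor.comp c.toPseudofunctor) c.toPseudofunctor
        Λ.tildeMult)
      (M : PseudomonadOn η.toStrongTrans μ.toStrongTrans),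
      ActionOperad.IsLift c η μ M :=
  ⟨Λ.tildeOn, Λ.tildeUnitOn, Λ.tildeMultOn, Λ.tildePseudomonadOn, Λ.tilde_isLift⟩
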